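/- **Theorem 3.** Let $U\subset\mathbb R^2$ be a planar domain (a connected nonempty open set). Let $\mathcal L=(L_1,L_2)$ be a linear net on $U$: two smooth foliations by (segments of) straight lines, transverse at every point. Let $\mathcal N=(N_1,N_2)$ be its bisector net: two smooth foliations whose directions at each point are the two bisectors of the angles formed by the lines of $\mathcal L$ there. The following conditions are equivalent: 1. $L_1,L_2$ and one of the foliations of $\mathcal N$ form a hexagonal 3-web, i.e. near every point of $U$ this 3-web is diffeomorphic to three families of parallel lines (and it does not matter which of $N_1,N_2$ is taken); 2. $\mathcal N$ is conformally flat, i.e. near every point of $U$ some conformal map carries $\mathcal N$ to the net of Cartesian coordinate lines. Moreover, under these conditions: - the 4-web $\mathcal W=(L_1,L_2,N_1,N_2)$ has maximal rank $3$: on every nonempty convex open $V\subset U$, the vector space of Abelian relations, i.e. of quadruples $(\omega_1,\dots,\omega_4)$ of smooth closed 1-forms on $V$ with sum zero such that $\omega_i$ vanishes along the leaves of the $i$-th foliation, has dimension $3$; - on each such $V$, for any basis $\sum_i\omega_i^\alpha=0$ $(\alpha=1,2,3)$ of Abelian relations, write $\omega_i^\alpha=x_i^\alpha(s_i)\,ds_i$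 locally with first integrals $s_i$. Then the four arcs traced by $[x_i^1:x_i^2:x_i^3]\in\mathbb P^2$ lie on one and only one plane quartic (the rank quartic), and this quartic splits into four concurrent lines, one for each foliation, such that the two lines corresponding to $\mathcal N$ divide the two lines corresponding to $\mathcal L$ harmonically; - either all lines of $\mathcal L$ are tangent to one smooth real conic $Q$ (asymptotes count as tangents), or each of $L_1,L_2$ belongs to a pencil of lines, with finite or ideal vertex; - in the first case, if $Q$ is not a circle, the leaves of $N_1$ and $N_2$ are arcs of conics of a confocal family that includes $Q$ (the degenerate members, lying on the axes, are allowed); - in the first case, if $Q$ is a circle, the leaves of $N_1$ and $N_2$ are arcs of coordinate lines of a polar coordinate system, $Q$ being one of these coordinate lines; - in the second case the leaves of $N_1$ and $N_2$ are arcs of ellipses and hyperbolas (possibly degenerate) with foci at the two vertices if both vertices are finite; arcs of parabolas (possibly degenerate to the axis) with focus at the finite vertex and axis in the direction of the ideal one if exactly one vertex is finite; and pieces of coordinate lines of a Cartesian coordinate system if both vertices are ideal. -/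

import Mathlib

open scoped ContDiff

namespace PlanarWeb

noncomputable section

/-! The Euclidean plane is `ℂ` with its real inner product. A foliation of a planar open set `U` by
curves is given by its field of tangent directions. -/

/-- A field of directions; only the values at points of the open set under consideration matter. -/
abbrev DirField := ℂ → Submodule ℝ ℂ

/-- `F` is (the tangent field of) a smooth foliation of `U` by curves: locally it is spanned by a
smooth nowhere vanishing vector field. -/
def IsFoliation (U : Set ℂ) (F : DirField) : Prop :=
  ∀ p ∈ U, ∃ V : Set ℂ, IsOpen V ∧ p ∈ V ∧ ∃ v : ℂ → ℂ, ContDiffOn ℝ ∞ v V ∧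
    ∀ q ∈ V, v q ≠ 0 ∧ F q = Submodule.span ℝ {v q}

/-- The leaves of the foliation `F` of `U` are straight: moving inside `U` along the straight line
through `p` in the direction `F p`, one stays tangent to `F`. -/
def IsRectilinear (U : Set ℂ) (F : DirField) : Prop :=
  ∀ p ∈ U, ∀ q, segment ℝ p q ⊆ U → q - p ∈ F p → F q = F p

/-- A linear net on `U`: two smooth transverse foliations by straight lines. -/
structure IsLinearNet (U : Set ℂ) (L₁ L₂ : DirField) : Prop where
  foliation₁ : IsFoliation U L₁
  foliation₂ : IsFoliation U L₂
  rectilinear₁ : IsRectilinear U L₁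
  rectilinear₂ : IsRectilinear U L₂
  transverse : ∀ p ∈ U, L₁ p ≠ L₂ p

/-- `(N₁, N₂)` is the bisector net of the net `(L₁, L₂)`: at every point its two directions bisect
the angles formed by the two lines of `L₁` and `L₂` that meet there. -/
structure IsBisectorNet (U : Set ℂ) (L₁ L₂ N₁ N₂ : DirField) : Prop where
  foliation₁ : IsFoliation U N₁
  foliation₂ : IsFoliation U N₂
  bisects : ∀ p ∈ U, ∃ v w : ℂ, ‖v‖ = 1 ∧ ‖w‖ = 1 ∧
    L₁ p = Submodule.span ℝ {v} ∧ L₂ p = Submodule.span ℝ {w} ∧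
    N₁ p = Submodule.span ℝ {v + w} ∧ N₂ p = Submodule.span ℝ {v - w}

/-- On its source, `φ` maps the leaves of `F` into parallel lines with direction `ℓ`. -/
def Straightens (φ : OpenPartialHomeomorph ℂ ℂ) (F : DirField) (ℓ : Submodule ℝ ℂ) : Prop :=
  ∀ q ∈ φ.source, (F q).map (fderiv ℝ φ q : ℂ →ₗ[ℝ] ℂ) = ℓ

/-- The three foliations form a hexagonal 3-web on `U`: near every point some diffeomorphism maps
them to three families of parallel lines. -/
def IsHexagonal (U : Set ℂ) (F₁ F₂ F₃ : DirField) : Prop :=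
  ∀ p ∈ U, ∃ φ : OpenPartialHomeomorph ℂ ℂ, p ∈ φ.source ∧ φ.source ⊆ U ∧
    ContDiffOn ℝ ∞ φ φ.source ∧ ContDiffOn ℝ ∞ φ.symm φ.target ∧
    ∃ ℓ₁ ℓ₂ ℓ₃ : Submodule ℝ ℂ, ℓ₁ ≠ ℓ₂ ∧ ℓ₁ ≠ ℓ₃ ∧ ℓ₂ ≠ ℓ₃ ∧
      Straightens φ F₁ ℓ₁ ∧ Straightens φ F₂ ℓ₂ ∧ Straightens φ F₃ ℓ₃

/-- The net `(N₁, N₂)` is conformally flat on `U`: near every point some conformal (holomorphic and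
injective) map carries it to the net of Cartesian coordinate lines. -/
def IsConformallyFlat (U : Set ℂ) (N₁ N₂ : DirField) : Prop :=
  ∀ p ∈ U, ∃ φ : OpenPartialHomeomorph ℂ ℂ, p ∈ φ.source ∧ φ.source ⊆ U ∧
    DifferentiableOn ℂ φ φ.source ∧
    Straightens φ N₁ (Submodule.span ℝ {1}) ∧ Straightens φ N₂ (Submodule.span ℝ {Complex.I})

/-! ### Abelian relations, rank, rank quartic -/

/-- The space of Abelian relations on `V` of the web with foliations `F i`: tuples of smooth closed
1-forms `η i` on `V`, with `η i` vanishing along the leaves of `F i`, and with sum zero.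
A form on `V` is represented by its extension by zero to the whole plane. -/
def abelianRelations {d : ℕ} (F : Fin d → DirField) (V : Set ℂ) :
    Submodule ℝ (Fin d → ℂ → (ℂ →L[ℝ] ℝ)) where
  carrier := {η |
    (∀ i, ∀ q ∈ V, ContDiffAt ℝ ∞ (η i) q) ∧
    (∀ i, ∀ q ∈ V, ∀ v w : ℂ, fderiv ℝ (η i) q v w = fderiv ℝ (η i) q w v) ∧
    (∀ i, ∀ q ∈ V, ∀ v ∈ F i q, η i q v = 0) ∧
    (∀ q ∈ V, ∑ i, η i q = 0) ∧
    (∀ i, ∀ q ∉ V, η i q = 0)}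
  zero_mem' := by
    refine ⟨fun i q _ => contDiffAt_const, fun i q _ v w => ?_, fun i q _ v _ => rfl,
      fun q _ => by simp, fun i q _ => rfl⟩
    simp
  add_mem' := by
    rintro a b ⟨ha, ha', ha'', hs, hz⟩ ⟨hb, hb', hb'', hs', hz'⟩
    refine ⟨fun i q hq => (ha i q hq).add (hb i q hq), fun i q hq v w => ?_,
      fun i q hq v hv => ?_, fun q hq => ?_, fun i q hq => ?_⟩
    · have e : fderiv ℝ ((a + b) i) q = fderiv ℝ (a i) q + fderiv ℝ (b i) q :=
        fderiv_add ((ha i q hq).differentiableAt (by simp))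
          ((hb i q hq).differentiableAt (by simp))
      rw [e]
      simp [ha' i q hq v w, hb' i q hq v w]
    · simp [ha'' i q hq v hv, hb'' i q hq v hv]
    · simp [Finset.sum_add_distrib, hs q hq, hs' q hq]
    · simp [hz i q hq, hz' i q hq]
  smul_mem' := by
    rintro c a ⟨ha, ha', ha'', hs, hz⟩
    refine ⟨fun i q hq => (ha i q hq).const_smul c, fun i q hq v w => ?_,
      fun i q hq v hv => ?_, fun q hq => ?_, fun i q hq => ?_⟩
    · have e : fderiv ℝ ((c • a) i) q = c • fderiv ℝ (a i) q :=
        fderiv_const_smul ((ha i q hq).differentiableAt (by simp)) c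
      rw [e]
      simp [ha' i q hq v w]
    · simp [ha'' i q hq v hv]
    · simp [← Finset.smul_sum, hs q hq]
    · simp [hz i q hq]

/-- Homogeneous coordinates of the point that the foliation `F i` contributes at `q` to the rank
curve, with respect to the basis `b` of Abelian relations: if `s` is a first integral of `F i` and
the basis elements have `i`-th components `x ^ α (s) ds`, these are the `x ^ α (s)` multiplied by the
common factor `ds (w)`. -/
def arcPoint {F : Fin 4 → DirField} {V : Set ℂ}
    (b : Module.Basis (Fin 3) ℝ (abelianRelations F V)) (i : Fin 4) (q w : ℂ) : Fin 3 → ℝ :=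
  fun α => (b α : Fin 4 → ℂ → (ℂ →L[ℝ] ℝ)) i q w

/-- `P` is an equation of the rank quartic: a plane projective quartic that contains the four arcs
traced by the foliations. -/
def IsRankQuartic {F : Fin 4 → DirField} {V : Set ℂ}
    (b : Module.Basis (Fin 3) ℝ (abelianRelations F V)) (P : MvPolynomial (Fin 3) ℝ) : Prop :=
  P ≠ 0 ∧ P.IsHomogeneous 4 ∧
    ∀ i, ∀ q ∈ V, ∀ w : ℂ, MvPolynomial.eval (arcPoint b i q w) P = 0

/-- The linear form with coefficient vector `m`; a nonzero `m` is a line of the projective plane. -/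
def linForm (m : Fin 3 → ℝ) : MvPolynomial (Fin 3) ℝ :=
  ∑ j, MvPolynomial.C (m j) * MvPolynomial.X j

/-- The lines `m 0, m 1, m 2, m 3` of the projective plane pass through a common point, and the pair
`m 2, m 3` divides the pair of distinct lines `m 0, m 1` harmonically (cross-ratio `-1`). -/
def IsHarmonicQuadruple (m : Fin 4 → Fin 3 → ℝ) : Prop :=
  (∃ O : Fin 3 → ℝ, O ≠ 0 ∧ ∀ i, m i ⬝ᵥ O = 0) ∧
  LinearIndependent ℝ ![m 0, m 1] ∧
  ∃ s t s' t' : ℝ, s ≠ 0 ∧ t ≠ 0 ∧ s' ≠ 0 ∧ t' ≠ 0 ∧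
    m 2 = s • m 0 + t • m 1 ∧ m 3 = s' • m 0 + t' • m 1 ∧ (t / s) / (t' / s') = -1

/-! ### Conics and confocal families -/

/-- Homogeneous coordinates of a point of the plane. -/
def hpt (z : ℂ) : Fin 3 → ℝ := ![z.re, z.im, 1]

/-- Homogeneous coordinates of the ideal point in the direction `v`. -/
def hdir (v : ℂ) : Fin 3 → ℝ := ![v.re, v.im, 0]

/-- A smooth real conic, given by a symmetric nondegenerate matrix with a real isotropic vector. -/
def IsSmoothConic (A : Matrix (Fin 3) (Fin 3) ℝ) : Prop :=
  A.IsSymm ∧ A.det ≠ 0 ∧ ∃ x : Fin 3 → ℝ, x ≠ 0 ∧ x ⬝ᵥ A.mulVec x = 0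

/-- The points of the conic in the plane. -/
def locus (A : Matrix (Fin 3) (Fin 3) ℝ) : Set ℂ := {z | hpt z ⬝ᵥ A.mulVec (hpt z) = 0}

/-- The line through `p` with direction `ℓ` is tangent to the conic: the equation of the conic has a
double root on it (the contact point may be ideal: asymptotes are tangents). -/
def IsTangentLine (A : Matrix (Fin 3) (Fin 3) ℝ) (p : ℂ) (ℓ : Submodule ℝ ℂ) : Prop :=
  ∀ v ∈ ℓ, (hpt p ⬝ᵥ A.mulVec (hdir v)) ^ 2 =
    (hpt p ⬝ᵥ A.mulVec (hpt p)) * (hdir v ⬝ᵥ A.mulVec (hdir v))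

/-- Ellipses and hyperbolas with foci `f` and `g`, with the degenerate ones: the segment between the
foci, the two rays that continue it, and the perpendicular bisector. -/
def centralConfocal (f g : ℂ) : Set (Set ℂ) :=
  {C | (∃ s, dist f g ≤ s ∧ C = {z | dist z f + dist z g = s}) ∨
    ∃ s, 0 ≤ s ∧ s ≤ dist f g ∧ C = {z | |dist z f - dist z g| = s}}

/-- Parabolas with focus `f` and axis direction `d`, a unit vector, described by focus and directrix;
for `k = 0` the axis. -/
def parabolicConfocal (f d : ℂ) : Set (Set ℂ) :=
  {C | ∃ k : ℝ, C = {z | dist z f = |inner ℝ (z - f) d - k|}}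

/-- A confocal family of conics. -/
def IsConfocalFamily (𝓕 : Set (Set ℂ)) : Prop :=
  (∃ f g : ℂ, f ≠ g ∧ 𝓕 = centralConfocal f g) ∨ ∃ f d : ℂ, ‖d‖ = 1 ∧ 𝓕 = parabolicConfocal f d

/-- The coordinate lines of the polar coordinate system with centre `o`. -/
def polarLines (o : ℂ) : Set (Set ℂ) :=
  {C | (∃ s, 0 < s ∧ C = Metric.sphere o s) ∨
    ∃ u : ℂ, ‖u‖ = 1 ∧ C = {z | ∃ t : ℝ, 0 < t ∧ z = o + t * u}}

/-- The coordinate lines of the Cartesian coordinate system with axes along the unit vector `d` and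
along `I * d`. -/
def cartesianLines (d : ℂ) : Set (Set ℂ) :=
  {C | ∃ k : ℝ, C = {z | inner ℝ z d = k} ∨ C = {z | inner ℝ z (Complex.I * d) = k}}

/-- The leaves of the foliation `F` of `U` are arcs of curves of the family `𝓕`: every smooth regular
integral curve of `F` in `U` stays on one of these curves. -/
def LeavesAreArcsOf (U : Set ℂ) (F : DirField) (𝓕 : Set (Set ℂ)) : Prop :=
  ∀ (a b : ℝ) (γ : ℝ → ℂ), a < b → ContDiffOn ℝ ∞ γ (Set.Ioo a b) →
    (∀ t ∈ Set.Ioo a b, γ t ∈ U ∧ deriv γ t ≠ 0 ∧ deriv γ t ∈ F (γ t)) →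
    ∃ C ∈ 𝓕, ∀ t ∈ Set.Ioo a b, γ t ∈ C

/-- The lines of `L` belong to the pencil of lines through `c`. -/
def InPencil (U : Set ℂ) (L : DirField) (c : ℂ) : Prop := ∀ p ∈ U, c - p ∈ L p

/-- The lines of `L` belong to the pencil of parallel lines with direction `d`. -/
def InParallelPencil (U : Set ℂ) (L : DirField) (d : ℂ) : Prop := ∀ p ∈ U, d ∈ L p

/-- The lines of the net are tangents of a smooth conic; the bisector net consists of arcs of a
confocal family containing this conic, or, when the conic is a circle, of polar coordinate lines,
the circle being one of them. -/
def TangentCase (U : Set ℂ) (L₁ L₂ N₁ N₂ : DirField) : Prop :=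
  ∃ A, IsSmoothConic A ∧
    (∀ p ∈ U, IsTangentLine A p (L₁ p) ∧ IsTangentLine A p (L₂ p)) ∧
    ((¬ ∃ o r, 0 < r ∧ locus A = Metric.sphere o r) →
      ∃ 𝓕, IsConfocalFamily 𝓕 ∧ locus A ∈ 𝓕 ∧
        LeavesAreArcsOf U N₁ 𝓕 ∧ LeavesAreArcsOf U N₂ 𝓕) ∧
    ((∃ o r, 0 < r ∧ locus A = Metric.sphere o r) →
      ∃ o, locus A ∈ polarLines o ∧
        LeavesAreArcsOf U N₁ (polarLines o) ∧ LeavesAreArcsOf U N₂ (polarLines o))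

/-- The lines of the net form two pencils; the bisector net consists of arcs of the confocal family
whose foci are the two vertices. If one vertex is ideal, the family is that of the parabolas with
axes in its direction; if both are, the bisector net is a Cartesian one. -/
def PencilCase (U : Set ℂ) (L₁ L₂ N₁ N₂ : DirField) : Prop :=
  (∃ f g : ℂ, f ≠ g ∧ InPencil U L₁ f ∧ InPencil U L₂ g ∧
    LeavesAreArcsOf U N₁ (centralConfocal f g) ∧ LeavesAreArcsOf U N₂ (centralConfocal f g)) ∨
  (∃ f d : ℂ, ‖d‖ = 1 ∧
    ((InPencil U L₁ f ∧ InParallelPencil U L₂ d) ∨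
      (InParallelPencil U L₁ d ∧ InPencil U L₂ f)) ∧
    LeavesAreArcsOf U N₁ (parabolicConfocal f d) ∧
    LeavesAreArcsOf U N₂ (parabolicConfocal f d)) ∨
  (∃ d₁ d₂ d : ℂ, ‖d₁‖ = 1 ∧ ‖d₂‖ = 1 ∧ ‖d‖ = 1 ∧
    InParallelPencil U L₁ d₁ ∧ InParallelPencil U L₂ d₂ ∧
    LeavesAreArcsOf U N₁ (cartesianLines d) ∧ LeavesAreArcsOf U N₂ (cartesianLines d))

end

end PlanarWeb

open PlanarWeb

/-!
The plane is `ℂ`, and everything is read off from one holomorphic function. A net is the net of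
horizontal and vertical trajectories of a quadratic differential `dz² / P` with holomorphic `P` iff
it is conformally flat: flat coordinates `φ` give `P = 1 / φ'²`
(`IsConformallyFlat.exists_isHorizontal`), and conversely `∫ dz / √P` is a flat coordinate
(`isConformallyFlat_of_model`). Let `v`, `w` be unit vectors along the lines of the linear net with
`P = ‖P‖ v w`, and put `D = ‖P‖ re (conj v * w)`.

*Rigidity.* Along a line with constant direction `v` one has `D = re (conj v ^ 2 * P)`, so the
derivative of `D` along each of the two lines is that of the linear form with gradient `P'`; hence
`grad D = P'` (`exists_modelAt_of_isHorizontal`). A holomorphic gradient has real derivative, so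
`P''` is a real constant, `P` is a polynomial of degree at most two with real leading coefficient,
and `D` is determined up to a constant (`exists_quad_modelAt`). Connectedness of `U` makes this
description global (`exists_global_quad_model`).

*Hexagonality.* If `L₁`, `L₂` and one bisector form a hexagonal web, pull back constant vector
fields by a straightening diffeomorphism: this gives commuting fields `E'`, `E` along `L₁`, `L₂`
whose sum spans the bisector, so that they have equal length. Straightness of the lines and
commutation make `E E' / ‖E‖` satisfy the Cauchy–Riemann equations (`differentiableAt_mul_div_norm`),
and this product is, up to sign, the `P` required (`IsHexagonal.exists_isHorizontal`). Conversely,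
let `X = (‖P‖ + D) / 2` and `Y = (‖P‖ - D) / 2`. By `grad D = P'` each of them is constant along one
of the bisector foliations, so `re (dz / √P) / √X` and `im (dz / √P) / √Y` are closed. Their
primitives `S`, `T` straighten the whole 4-web: the leaves are the level curves of `T - S`, `T + S`,
`T`, `S` (`exists_parallelCoords`).

*Rank.* For a web of four such families of parallel lines a short computation with the closed forms
`K (h) dh` shows that the Abelian relations are spanned by two with constant coefficients and one
with linear coefficients (`IsParallelCoords.exists_eq_relation`). In the resulting coordinates the
four arcs lie on four explicit lines through one point. A quartic form that vanishes at infinitely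
many points of each of these lines is divisible by their equations
(`IsParallelCoords.rank_and_quartic`).

*Classification.* For a line of the net with direction `u` through `q`, the identity
`D = re (conj u ^ 2 * P) / |u|²` says, when `P = β x y`, that
`im (conj u * x) * im (conj u * y) = B |u|²` with a constant `B` (`IsModelAt.im_mul_im_eq`). If
`P = β (z - f) (z - g)` this means that the product of the signed distances of the line from `f` and
`g` is constant: the lines touch a conic with foci `f`, `g`, or pass through `f` or `g` if `B = 0`. If
`P = β (z - f) d`, one focus has moved to infinity and the conic is a parabola; if `P` is constant,
both vertices are ideal. The leaves of the bisector net are found by differentiating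
`dist z f ± dist z g` and its limiting forms along the trajectories of `dz² / P`.
-/

namespace PlanarWeb

open scoped ComplexConjugate ContDiff Topology
open Complex Filter

/-! ### The net at one point -/

/-- Unit vectors `v`, `w` on the two lines of the net at `q`, chosen so that `v + w` and `v - w`
span the two directions of the bisector net. -/
structure IsNetFrame (L₁ L₂ N₁ N₂ : DirField) (q v w : ℂ) : Prop where
  norm_left : ‖v‖ = 1
  norm_right : ‖w‖ = 1
  L₁_eq : L₁ q = Submodule.span ℝ {v}
  L₂_eq : L₂ q = Submodule.span ℝ {w}
  N₁_eq : N₁ q = Submodule.span ℝ {v + w}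
  N₂_eq : N₂ q = Submodule.span ℝ {v - w}
  indep : (conj v * w).im ≠ 0

theorem conj_mul_self_of_norm_eq_one {v : ℂ} (h : ‖v‖ = 1) : conj v * v = 1 := by
  rw [Complex.conj_mul', h]; simp

theorem mul_conj_self_of_norm_eq_one {v : ℂ} (h : ‖v‖ = 1) : v * conj v = 1 := by
  rw [Complex.mul_conj', h]; simp

/-- A complex number whose product with `conj v` is real is a real multiple of `v ≠ 0`. -/
theorem exists_real_smul_of_im_eq_zero {v u : ℂ} (hv : v ≠ 0) (h : (conj v * u).im = 0) :
    ∃ r : ℝ, u = r • v := by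
  refine ⟨(conj v * u).re / normSq v, ?_⟩
  have h1 : ((conj v * u).re : ℂ) = conj v * u := by
    apply Complex.ext <;> simp [h]
  have h2 : (normSq v : ℂ) ≠ 0 := by exact_mod_cast (normSq_pos.2 hv).ne'
  rw [real_smul, ofReal_div, h1]
  field_simp
  rw [← Complex.mul_conj]; ring

theorem IsLinearNet.exists_netFrame {U : Set ℂ} {L₁ L₂ N₁ N₂ : DirField}
    (hL : IsLinearNet U L₁ L₂) (hN : IsBisectorNet U L₁ L₂ N₁ N₂) {q : ℂ} (hq : q ∈ U) :
    ∃ v w, IsNetFrame L₁ L₂ N₁ N₂ q v w := by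
  obtain ⟨v, w, hv, hw, h1, h2, h3, h4⟩ := hN.bisects q hq
  refine ⟨v, w, hv, hw, h1, h2, h3, h4, fun h => hL.transverse q hq ?_⟩
  have hv0 : v ≠ 0 := by rintro rfl; simp at hv
  have hw0 : w ≠ 0 := by rintro rfl; simp at hw
  obtain ⟨r, hr⟩ := exists_real_smul_of_im_eq_zero hv0 h
  have hr0 : r ≠ 0 := by rintro rfl; simp [hw0] at hr
  rw [h1, h2, hr, Submodule.span_singleton_smul_eq (IsUnit.mk0 r hr0)]

namespace IsNetFrame
variable {L₁ L₂ N₁ N₂ : DirField} {q v w : ℂ}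

theorem left_ne_zero (h : IsNetFrame L₁ L₂ N₁ N₂ q v w) : v ≠ 0 := by
  rintro rfl; simpa using h.norm_left

theorem right_ne_zero (h : IsNetFrame L₁ L₂ N₁ N₂ q v w) : w ≠ 0 := by
  rintro rfl; simpa using h.norm_right

theorem sq_re_add_sq_im (h : IsNetFrame L₁ L₂ N₁ N₂ q v w) :
    (conj v * w).re ^ 2 + (conj v * w).im ^ 2 = 1 := by
  have : ‖conj v * w‖ = 1 := by simp [h.norm_left, h.norm_right]
  have h2 := Complex.sq_norm (conj v * w)
  rw [this, normSq_apply] at h2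
  nlinarith

theorem abs_re_lt_one (h : IsNetFrame L₁ L₂ N₁ N₂ q v w) : |(conj v * w).re| < 1 := by
  have h1 := h.sq_re_add_sq_im
  have h2 : 0 < (conj v * w).im ^ 2 := by have := h.indep; positivity
  rw [← sq_lt_one_iff_abs_lt_one]
  linarith

theorem add_sq (h : IsNetFrame L₁ L₂ N₁ N₂ q v w) :
    (v + w) ^ 2 = ((2 + 2 * (conj v * w).re : ℝ) : ℂ) * (v * w) := by
  have h1 := conj_mul_self_of_norm_eq_one h.norm_left
  have h2 := conj_mul_self_of_norm_eq_one h.norm_right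
  have h3 : ((2 * (conj v * w).re : ℝ) : ℂ) = conj v * w + v * conj w := by
    apply Complex.ext <;> simp <;> ring
  rw [ofReal_add, h3]
  push_cast
  linear_combination -w ^ 2 * h1 - v ^ 2 * h2

theorem sub_sq (h : IsNetFrame L₁ L₂ N₁ N₂ q v w) :
    (v - w) ^ 2 = -((2 - 2 * (conj v * w).re : ℝ) : ℂ) * (v * w) := by
  have h1 := conj_mul_self_of_norm_eq_one h.norm_left
  have h2 := conj_mul_self_of_norm_eq_one h.norm_right
  have h3 : ((2 * (conj v * w).re : ℝ) : ℂ) = conj v * w + v * conj w := by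
    apply Complex.ext <;> simp <;> ring
  rw [ofReal_sub, h3]
  push_cast
  linear_combination -w ^ 2 * h1 - v ^ 2 * h2

theorem add_ne_zero (h : IsNetFrame L₁ L₂ N₁ N₂ q v w) : v + w ≠ 0 := fun h0 => by
  have := h.indep
  rw [eq_neg_of_add_eq_zero_right h0, mul_neg, conj_mul_self_of_norm_eq_one h.norm_left] at this
  simp at this

theorem sub_ne_zero (h : IsNetFrame L₁ L₂ N₁ N₂ q v w) : v - w ≠ 0 := fun h0 => by
  have := h.indep
  rw [← _root_.sub_eq_zero.1 h0, conj_mul_self_of_norm_eq_one h.norm_left] at this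
  simp at this

end IsNetFrame

/-- The direction `F q` is horizontal for the quadratic differential `dz² / P`. -/
def IsHorizontal (P : ℂ → ℂ) (F : DirField) (q : ℂ) : Prop :=
  P q ≠ 0 ∧ ∀ v ∈ F q, ∃ r : ℝ, 0 ≤ r ∧ v ^ 2 = r * P q

theorem IsNetFrame.eq_norm_mul {L₁ L₂ N₁ N₂ : DirField} {q v w : ℂ} {P : ℂ → ℂ}
    (h : IsNetFrame L₁ L₂ N₁ N₂ q v w) (hP : IsHorizontal P N₁ q) :
    P q = ‖P q‖ * (v * w) := by
  obtain ⟨hP0, hP⟩ := hP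
  obtain ⟨r, hr, e⟩ := hP (v + w) (by rw [h.N₁_eq]; exact Submodule.mem_span_singleton_self _)
  rw [h.add_sq] at e
  have hk : 0 < 2 + 2 * (conj v * w).re := by have := abs_lt.1 h.abs_re_lt_one; linarith
  set k : ℝ := 2 + 2 * (conj v * w).re
  have hn := congrArg norm e
  rw [norm_mul, norm_mul, norm_mul, norm_real, norm_real, h.norm_left, h.norm_right,
    Real.norm_of_nonneg hk.le, Real.norm_of_nonneg hr] at hn
  have hr0 : (r : ℂ) ≠ 0 := by
    rintro h0; have : r = 0 := by exact_mod_cast h0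
    rw [this] at hn; simp at hn; exact hk.ne' hn
  apply mul_left_cancel₀ hr0
  rw [← e]
  have : (k : ℂ) = r * ‖P q‖ := by rw [← ofReal_mul, ← hn]; simp
  rw [this]; ring

/-! ### Straight leaves -/

/-- A vector field tangent to a foliation by straight lines has its derivative along itself
parallel to itself. -/
theorem IsRectilinear.im_conj_mul_fderiv {U : Set ℂ} (hU : IsOpen U) {F : DirField}
    (hF : IsRectilinear U F) {E : ℂ → ℂ} {q : ℂ} (hq : q ∈ U) (hE : DifferentiableAt ℝ E q)
    (hspan : ∀ᶠ x in 𝓝 q, F x = Submodule.span ℝ {E x}) :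
    (conj (E q) * fderiv ℝ E q (E q)).im = 0 := by
  have hline : HasDerivAt (fun t : ℝ => q + t • E q) (E q) 0 := by
    simpa using ((hasDerivAt_id (0 : ℝ)).smul_const (E q)).const_add q
  have hE' : HasFDerivAt E (fderiv ℝ E q) (q + (0 : ℝ) • E q) := by simpa using hE.hasFDerivAt
  have h1 := hE'.comp_hasDerivAt (0 : ℝ) hline
  have h2 := (h1.const_mul (conj (E q)))
  have h3 := Complex.imCLM.hasFDerivAt.comp_hasDerivAt (0 : ℝ) h2
  have hcont : Tendsto (fun t : ℝ => q + t • E q) (𝓝 0) (𝓝 q) := by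
    simpa using hline.continuousAt.tendsto
  obtain ⟨ε, hε, hball⟩ := Metric.isOpen_iff.1 hU q hq
  have hev : ∀ᶠ t : ℝ in 𝓝 0, (conj (E q) * E (q + t • E q)).im = 0 := by
    filter_upwards [hcont.eventually hspan, hcont.eventually (Metric.ball_mem_nhds q hε)]
      with t ht hb
    have hFq : F q = Submodule.span ℝ {E q} := hspan.self_of_nhds
    have := hF q hq (q + t • E q)
      (((convex_ball q ε).segment_subset (Metric.mem_ball_self hε) hb).trans hball)
      (by rw [hFq]; simpa using Submodule.smul_mem _ t (Submodule.mem_span_singleton_self (E q)))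
    rw [ht, hFq] at this
    have hm : E (q + t • E q) ∈ Submodule.span ℝ {E q} :=
      this ▸ Submodule.mem_span_singleton_self _
    obtain ⟨r, hr⟩ := Submodule.mem_span_singleton.1 hm
    rw [← hr, real_smul, mul_left_comm, Complex.conj_mul', im_ofReal_mul]
    norm_cast
    simp
  have h4 : HasDerivAt (fun t : ℝ => (0 : ℝ)) ((conj (E q) * fderiv ℝ E q (E q)).im) 0 :=
    h3.congr_of_eventuallyEq (hev.mono fun t ht => by simpa using ht.symm)
  exact h4.unique (hasDerivAt_const _ _)

/-! ### The quadratic differential of a conformally flat bisector net -/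

/-- At `q` the bisector net is the net of `dz² / P`, and `D` is the function `‖P‖ cos φ`, where `φ`
is the angle between the unit vectors `v`, `w` along the lines of the linear net. The normalization
`P = ‖P‖ v w` fixes the pair `v`, `w` up to a common sign, and therefore the value `D q`. -/
def IsModelAt (L₁ L₂ N₁ N₂ : DirField) (P : ℂ → ℂ) (D : ℂ → ℝ) (q : ℂ) : Prop :=
  P q ≠ 0 ∧ ∃ v w, IsNetFrame L₁ L₂ N₁ N₂ q v w ∧ P q = ‖P q‖ * (v * w) ∧
    D q = ‖P q‖ * (conj v * w).re

/-- If the derivative of `E` along itself is parallel to `E`, then `re (conj E * P / E)`, the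
projection of `P` that is compared with `‖P‖ cos φ`, has derivative `re (conj P' * E)` along `E`. -/
theorem fderiv_re_conj_mul_div {E P : ℂ → ℂ} {q P' : ℂ} (hE : DifferentiableAt ℝ E q)
    (hE0 : E q ≠ 0) (hlin : (conj (E q) * fderiv ℝ E q (E q)).im = 0)
    (hP : HasDerivAt P P' q) :
    DifferentiableAt ℝ (fun z => (conj (E z) * P z / E z).re) q ∧
    fderiv ℝ (fun z => (conj (E z) * P z / E z).re) q (E q) = (conj P' * E q).re := by
  have h1 := hE.hasFDerivAt
  have h2 : HasFDerivAt (𝕜 := ℝ) (fun z => conj (E z)) _ q :=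
    (conjCLE : ℂ →L[ℝ] ℂ).hasFDerivAt.comp q h1
  have h3 : HasFDerivAt (𝕜 := ℝ) P _ q := hP.hasFDerivAt.restrictScalars ℝ
  have h4 : HasFDerivAt (𝕜 := ℝ) (fun z => (E z)⁻¹) _ q :=
    ((hasDerivAt_inv hE0).hasFDerivAt.restrictScalars ℝ).comp q h1
  have h5 : HasFDerivAt (𝕜 := ℝ) (fun z => (conj (E z) * P z * (E z)⁻¹).re) _ q :=
    reCLM.hasFDerivAt.comp q ((h2.mul h3).mul h4)
  simp only [div_eq_mul_inv]
  refine ⟨h5.differentiableAt, ?_⟩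
  rw [h5.fderiv]
  obtain ⟨ρ, hρ⟩ := exists_real_smul_of_im_eq_zero hE0 hlin
  simp only [ContinuousLinearMap.comp_apply, add_apply, smul_apply, Pi.mul_apply,
    ContinuousLinearMap.coe_restrictScalars', hρ,
    ContinuousLinearMap.toSpanSingleton_apply, reCLM_apply, real_smul, smul_eq_mul,
    ContinuousLinearEquiv.coe_coe, conjCLE_apply, map_mul, conj_ofReal]
  have : conj (E q) * P q * (↑ρ * E q * -(E q ^ 2)⁻¹) +
      (E q)⁻¹ * (conj (E q) * (E q * P') + P q * (↑ρ * conj (E q))) = conj (E q) * P' := by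
    field_simp
    ring
  rw [this, ← conj_re, map_mul, conj_conj, mul_comm]

theorem ContinuousLinearMap.eq_of_eq_on_frame {f g : ℂ →L[ℝ] ℝ} {v w : ℂ}
    (hvw : (conj v * w).im ≠ 0) (hv : f v = g v) (hw : f w = g w) : f = g := by
  have hv0 : v ≠ 0 := by rintro rfl; simp at hvw
  have key : ∀ u, ∃ s t : ℝ, u = s • v + t • w := by
    intro u
    set t : ℝ := (conj v * u).im / (conj v * w).im
    obtain ⟨s, hs⟩ := exists_real_smul_of_im_eq_zero (u := u - t • w) hv0 (by
      rw [mul_sub, sub_im, mul_smul_comm, real_smul, im_ofReal_mul]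
      simp only [t]; field_simp; ring)
    exact ⟨s, t, by rw [← hs]; ring⟩
  ext u
  obtain ⟨s, t, h⟩ := key u
  rw [h, map_add, map_smul, map_smul, map_add, map_smul, map_smul, hv, hw]

/-- The linear form with gradient `a`. -/
noncomputable def gradForm (a : ℂ) : ℂ →L[ℝ] ℝ := reCLM.comp (conj a • (1 : ℂ →L[ℝ] ℂ))

@[simp] theorem gradForm_apply (a u : ℂ) : gradForm a u = (conj a * u).re := by
  simp [gradForm]

/-- With `P = n v w`, the function `n cos φ` is `re (conj e * P / e)` for every vector `e` along a
line of the net. -/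
theorem IsNetFrame.re_left {L₁ L₂ N₁ N₂ : DirField} {q v w : ℂ}
    (h : IsNetFrame L₁ L₂ N₁ N₂ q v w) (n : ℝ) {e : ℂ} (he : e ∈ L₁ q) (he0 : e ≠ 0) :
    (conj e * (n * (v * w)) / e).re = n * (conj v * w).re := by
  rw [h.L₁_eq] at he
  obtain ⟨r, rfl⟩ := Submodule.mem_span_singleton.1 he
  have hr : (r : ℂ) ≠ 0 := by rintro h0; rw [real_smul, h0] at he0; simp at he0
  have hv := h.left_ne_zero
  rw [← re_ofReal_mul]
  congr 1
  rw [real_smul, map_mul, conj_ofReal]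
  field_simp

theorem IsNetFrame.re_right {L₁ L₂ N₁ N₂ : DirField} {q v w : ℂ}
    (h : IsNetFrame L₁ L₂ N₁ N₂ q v w) (n : ℝ) {e : ℂ} (he : e ∈ L₂ q) (he0 : e ≠ 0) :
    (conj e * (n * (v * w)) / e).re = n * (conj v * w).re := by
  rw [h.L₂_eq] at he
  obtain ⟨r, rfl⟩ := Submodule.mem_span_singleton.1 he
  have hr : (r : ℂ) ≠ 0 := by rintro h0; rw [real_smul, h0] at he0; simp at he0
  have hw := h.right_ne_zero
  have : (conj v * w).re = (conj w * v).re := by simp; ring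
  rw [this, ← re_ofReal_mul]
  congr 1
  rw [real_smul, map_mul, conj_ofReal]
  field_simp

/-- If the bisector net is that of `dz² / P` on an open set, then the gradient of `‖P‖ cos φ` is
`P'`. -/
theorem exists_modelAt_of_isHorizontal {U : Set ℂ} (hU : IsOpen U) {L₁ L₂ N₁ N₂ : DirField}
    (hL : IsLinearNet U L₁ L₂) (hN : IsBisectorNet U L₁ L₂ N₁ N₂) {P : ℂ → ℂ} {W : Set ℂ}
    (hW : IsOpen W) (hWU : W ⊆ U) (hP : DifferentiableOn ℂ P W)
    (hPN : ∀ q ∈ W, IsHorizontal P N₁ q) :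
    ∃ D : ℂ → ℝ, ∀ q ∈ W, IsModelAt L₁ L₂ N₁ N₂ P D q ∧
      HasFDerivAt D (gradForm (deriv P q)) q := by
  classical
  have hex : ∀ q, ∃ d : ℝ, q ∈ W → ∃ v w, IsNetFrame L₁ L₂ N₁ N₂ q v w ∧
      P q = ‖P q‖ * (v * w) ∧ d = ‖P q‖ * (conj v * w).re := by
    intro q
    by_cases hq : q ∈ W
    · obtain ⟨v, w, h⟩ := hL.exists_netFrame hN (hWU hq)
      exact ⟨_, fun _ => ⟨v, w, h, h.eq_norm_mul (hPN q hq), rfl⟩⟩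
    · exact ⟨0, fun h => absurd h hq⟩
  choose D hD using hex
  refine ⟨D, fun q hq => ⟨⟨(hPN q hq).1, hD q hq⟩, ?_⟩⟩
  obtain ⟨V₁, hV₁, hqV₁, E₁, hE₁, hF₁⟩ := hL.foliation₁ q (hWU hq)
  obtain ⟨V₂, hV₂, hqV₂, E₂, hE₂, hF₂⟩ := hL.foliation₂ q (hWU hq)
  have hd₁ : DifferentiableAt ℝ E₁ q := (hE₁.contDiffAt (hV₁.mem_nhds hqV₁)).differentiableAt
    (by simp)
  have hd₂ : DifferentiableAt ℝ E₂ q := (hE₂.contDiffAt (hV₂.mem_nhds hqV₂)).differentiableAt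
    (by simp)
  have hP' : HasDerivAt P (deriv P q) q :=
    (hP.differentiableAt (hW.mem_nhds hq)).hasDerivAt
  have hl₁ := hL.rectilinear₁.im_conj_mul_fderiv hU (hWU hq) hd₁
    (by filter_upwards [hV₁.mem_nhds hqV₁] with x hx using (hF₁ x hx).2)
  have hl₂ := hL.rectilinear₂.im_conj_mul_fderiv hU (hWU hq) hd₂
    (by filter_upwards [hV₂.mem_nhds hqV₂] with x hx using (hF₂ x hx).2)
  have h₁ := fderiv_re_conj_mul_div hd₁ (hF₁ q hqV₁).1 hl₁ hP'
  have h₂ := fderiv_re_conj_mul_div hd₂ (hF₂ q hqV₂).1 hl₂ hP'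
  have e₁ : D =ᶠ[𝓝 q] fun z => (conj (E₁ z) * P z / E₁ z).re := by
    filter_upwards [hV₁.mem_nhds hqV₁, hW.mem_nhds hq] with z hz hzW
    obtain ⟨v, w, h, hPz, hDz⟩ := hD z hzW
    have := h.re_left ‖P z‖ (e := E₁ z) (by
      rw [(hF₁ z hz).2]; exact Submodule.mem_span_singleton_self _) (hF₁ z hz).1
    rw [← hPz] at this
    rw [this, hDz]
  have e₂ : D =ᶠ[𝓝 q] fun z => (conj (E₂ z) * P z / E₂ z).re := by
    filter_upwards [hV₂.mem_nhds hqV₂, hW.mem_nhds hq] with z hz hzW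
    obtain ⟨v, w, h, hPz, hDz⟩ := hD z hzW
    have := h.re_right ‖P z‖ (e := E₂ z) (by
      rw [(hF₂ z hz).2]; exact Submodule.mem_span_singleton_self _) (hF₂ z hz).1
    rw [← hPz] at this
    rw [this, hDz]
  have hdiff : DifferentiableAt ℝ D q := h₁.1.congr_of_eventuallyEq e₁
  have hfd : fderiv ℝ D q = gradForm (deriv P q) := by
    have a₁ : fderiv ℝ D q (E₁ q) = gradForm (deriv P q) (E₁ q) := by
      rw [e₁.fderiv_eq, h₁.2, gradForm_apply]
    have a₂ : fderiv ℝ D q (E₂ q) = gradForm (deriv P q) (E₂ q) := by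
      rw [e₂.fderiv_eq, h₂.2, gradForm_apply]
    refine ContinuousLinearMap.eq_of_eq_on_frame (v := E₁ q) (w := E₂ q) (fun h => ?_) a₁ a₂
    obtain ⟨r, hr⟩ := exists_real_smul_of_im_eq_zero (hF₁ q hqV₁).1 h
    have hr0 : r ≠ 0 := by rintro rfl; simp [(hF₂ q hqV₂).1] at hr
    refine hL.transverse q (hWU hq) ?_
    rw [(hF₁ q hqV₁).2, (hF₂ q hqV₂).2, hr, Submodule.span_singleton_smul_eq (IsUnit.mk0 r hr0)]
  rw [← hfd]
  exact hdiff.hasFDerivAt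

/-- A holomorphic function that is the gradient of a real function has real derivative. -/
theorem im_deriv_eq_zero_of_gradient {W : Set ℂ} (hW : IsOpen W) {D : ℂ → ℝ} {G : ℂ → ℂ}
    (hG : DifferentiableOn ℂ G W) (hD : ∀ q ∈ W, HasFDerivAt D (gradForm (G q)) q)
    {q : ℂ} (hq : q ∈ W) : (deriv G q).im = 0 := by
  have h1 : HasFDerivAt G _ q :=
    ((hG.differentiableAt (hW.mem_nhds hq)).hasDerivAt.hasFDerivAt).restrictScalars ℝ
  have h2 : HasFDerivAt (𝕜 := ℝ) (fun z => conj (G z)) _ q :=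
    (conjCLE : ℂ →L[ℝ] ℂ).hasFDerivAt.comp q h1
  have h3 := h2.smul_const (1 : ℂ →L[ℝ] ℂ)
  have h4 : HasFDerivAt (fun z => gradForm (G z)) _ q :=
    (ContinuousLinearMap.compL ℝ ℂ ℂ ℝ reCLM).hasFDerivAt.comp q h3
  have := second_derivative_symmetric_of_eventually
    (by filter_upwards [hW.mem_nhds hq] with x hx using hD x hx) h4 1 I
  simp at this
  linarith

theorem exists_const_of_im_eq_zero {W : Set ℂ} (hW : IsOpen W) (hc : IsPreconnected W)
    {G : ℂ → ℂ} (hG : DifferentiableOn ℂ G W) (h : ∀ q ∈ W, (G q).im = 0) :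
    ∃ c : ℝ, ∀ q ∈ W, G q = c := by
  obtain ⟨c, hc'⟩ := hW.exists_is_const_of_deriv_eq_zero hc hG (fun q hq => by
    have h1 : HasFDerivAt G _ q :=
      ((hG.differentiableAt (hW.mem_nhds hq)).hasDerivAt.hasFDerivAt).restrictScalars ℝ
    have h2 := imCLM.hasFDerivAt.comp q h1
    have h3 : HasFDerivAt (fun _ : ℂ => (0 : ℝ)) _ q := h2.congr_of_eventuallyEq (by
      filter_upwards [hW.mem_nhds hq] with z hz using by simp [h z hz])
    have h4 := h3.unique (hasFDerivAt_const (0 : ℝ) q)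
    have a1 := DFunLike.congr_fun h4 1
    have a2 := DFunLike.congr_fun h4 I
    apply Complex.ext
    · simpa using a2
    · simpa using a1)
  refine ⟨c.re, fun q hq => ?_⟩
  have := h q hq
  rw [hc' q hq] at this ⊢
  apply Complex.ext <;> simp [this]

/-- The polynomials that occur as `P`: the leading coefficient is real. -/
noncomputable def quadPoly (c : ℝ) (b a : ℂ) (z : ℂ) : ℂ := c * z ^ 2 + b * z + a

/-- The real functions with gradient `(quadPoly c b a)'`. -/
noncomputable def quadPot (c : ℝ) (b : ℂ) (k : ℝ) (z : ℂ) : ℝ :=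
  c * normSq z + (conj b * z).re + k

theorem hasDerivAt_quadPoly (c : ℝ) (b a z : ℂ) :
    HasDerivAt (quadPoly c b a) (2 * c * z + b) z := by
  have := ((((hasDerivAt_id z).pow 2).const_mul (c : ℂ)).add
    ((hasDerivAt_id z).const_mul b)).add_const a
  refine this.congr_deriv ?_
  simp
  ring

theorem hasFDerivAt_quadPot (c : ℝ) (b : ℂ) (k : ℝ) (z : ℂ) :
    HasFDerivAt (quadPot c b k) (gradForm (2 * c * z + b)) z := by
  have h1 : HasFDerivAt (fun z : ℂ => c * (z.re * z.re + z.im * z.im) + (gradForm b) z + k) _ z :=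
    ((((reCLM.hasFDerivAt (x := z)).mul reCLM.hasFDerivAt).add
      ((imCLM.hasFDerivAt (x := z)).mul imCLM.hasFDerivAt)).const_mul c).add
      (gradForm b).hasFDerivAt |>.add_const k
  have h2 : quadPot c b k = fun z : ℂ => c * (z.re * z.re + z.im * z.im) + (gradForm b) z + k := by
    funext z; simp [quadPot, normSq_apply]
  rw [h2]
  refine h1.congr_fderiv (ContinuousLinearMap.ext fun u => ?_)
  simp
  ring

/-- If the bisector net is the net of `dz² / P` with holomorphic `P`, then `P` is a polynomial of
degree at most two: `P'` is the gradient of `‖P‖ cos φ`, so that `P''` is real, hence constant. -/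
theorem exists_quad_modelAt {U : Set ℂ} (hU : IsOpen U) {L₁ L₂ N₁ N₂ : DirField}
    (hL : IsLinearNet U L₁ L₂) (hN : IsBisectorNet U L₁ L₂ N₁ N₂) {P : ℂ → ℂ} {p : ℂ} (hp : p ∈ U)
    (hP : ∀ᶠ q in 𝓝 p, DifferentiableAt ℂ P q ∧ IsHorizontal P N₁ q) :
    ∃ (c : ℝ) (b a : ℂ) (k : ℝ), ∀ᶠ q in 𝓝 p,
      IsModelAt L₁ L₂ N₁ N₂ (quadPoly c b a) (quadPot c b k) q := by
  obtain ⟨ε, hε, hball⟩ := Metric.eventually_nhds_iff_ball.1 (hP.and (hU.mem_nhds hp))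
  set W := Metric.ball p ε
  have hW : IsOpen W := Metric.isOpen_ball
  have hWc : IsPreconnected W := (convex_ball p ε).isPreconnected
  have hPW : DifferentiableOn ℂ P W := fun q hq => (hball q hq).1.1.differentiableWithinAt
  obtain ⟨D, hD⟩ := exists_modelAt_of_isHorizontal hU hL hN hW (fun q hq => (hball q hq).2) hPW
    (fun q hq => (hball q hq).1.2)
  have hP' : DifferentiableOn ℂ (deriv P) W := hPW.deriv hW
  obtain ⟨c, hc⟩ := exists_const_of_im_eq_zero hW hWc (hP'.deriv hW)
    (fun q hq => im_deriv_eq_zero_of_gradient hW hP' (fun q hq => (hD q hq).2) hq)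
  have hlin : ∀ q, HasDerivAt (fun z : ℂ => (c : ℂ) * z) c q := fun q => by
    simpa using (hasDerivAt_id q).const_mul (c : ℂ)
  obtain ⟨b, hb⟩ := hW.exists_eq_add_of_deriv_eq hWc hP'
    (fun q _ => (hlin q).differentiableAt.differentiableWithinAt)
    (fun q hq => by rw [hc q hq, (hlin q).deriv])
  have hPd : ∀ q ∈ W, deriv P q = 2 * ((c / 2 : ℝ) : ℂ) * q + b := fun q hq => by
    rw [hb hq]; push_cast; ring
  obtain ⟨a, ha⟩ := hW.exists_eq_add_of_deriv_eq hWc hPW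
    (fun q _ => (hasDerivAt_quadPoly (c / 2) b 0 q).differentiableAt.differentiableWithinAt)
    (fun q hq => by rw [hPd q hq, (hasDerivAt_quadPoly (c / 2) b 0 q).deriv])
  obtain ⟨k, hk⟩ := hW.exists_eq_add_of_fderiv_eq hWc
    (fun q hq => (hD q hq).2.differentiableAt.differentiableWithinAt)
    (fun q _ => (hasFDerivAt_quadPot (c / 2) b 0 q).differentiableAt.differentiableWithinAt)
    (fun q hq => by
      rw [(hD q hq).2.fderiv, hPd q hq, (hasFDerivAt_quadPot (c / 2) b 0 q).fderiv])
  refine ⟨c / 2, b, a, k, ?_⟩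
  filter_upwards [Metric.ball_mem_nhds p hε] with q hq
  have e1 : quadPoly (c / 2) b a q = P q := by
    rw [ha hq]; simp [quadPoly]
  have e2 : quadPot (c / 2) b k q = D q := by
    rw [hk hq]; simp [quadPot]
  have := (hD q hq).1
  unfold IsModelAt at this ⊢
  rw [e1, e2]
  exact this

/-! ### Globalisation -/

namespace IsModelAt
variable {L₁ L₂ N₁ N₂ : DirField} {P : ℂ → ℂ} {D : ℂ → ℝ} {q : ℂ}

theorem exists_sq_eq_of_mem_N₁ (h : IsModelAt L₁ L₂ N₁ N₂ P D q) {n : ℂ} (hn : n ∈ N₁ q) :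
    ∃ r : ℝ, 0 ≤ r ∧ n ^ 2 = r * P q := by
  obtain ⟨hP, v, w, hf, hPq, -⟩ := h
  rw [hf.N₁_eq] at hn
  obtain ⟨t, rfl⟩ := Submodule.mem_span_singleton.1 hn
  have hk : 0 < 2 + 2 * (conj v * w).re := by have := abs_lt.1 hf.abs_re_lt_one; linarith
  have hP0 : (‖P q‖ : ℂ) ≠ 0 := by simpa using hP
  refine ⟨t ^ 2 * (2 + 2 * (conj v * w).re) / ‖P q‖, by positivity, ?_⟩
  have : v * w = P q / ‖P q‖ := by
    rw [eq_div_iff hP0, mul_comm]; exact hPq.symm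
  rw [real_smul, mul_pow, hf.add_sq, this]
  push_cast
  ring

theorem exists_sq_eq_of_mem_N₂ (h : IsModelAt L₁ L₂ N₁ N₂ P D q) {n : ℂ} (hn : n ∈ N₂ q) :
    ∃ r : ℝ, r ≤ 0 ∧ n ^ 2 = r * P q := by
  obtain ⟨hP, v, w, hf, hPq, -⟩ := h
  rw [hf.N₂_eq] at hn
  obtain ⟨t, rfl⟩ := Submodule.mem_span_singleton.1 hn
  have hk : 0 < 2 - 2 * (conj v * w).re := by have := abs_lt.1 hf.abs_re_lt_one; linarith
  have hP0 : (‖P q‖ : ℂ) ≠ 0 := by simpa using hP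
  refine ⟨-(t ^ 2 * (2 - 2 * (conj v * w).re) / ‖P q‖),
    neg_nonpos.2 (by positivity), ?_⟩
  have : v * w = P q / ‖P q‖ := by
    rw [eq_div_iff hP0, mul_comm]; exact hPq.symm
  rw [real_smul, mul_pow, hf.sub_sq, this]
  push_cast
  ring

theorem re_left (h : IsModelAt L₁ L₂ N₁ N₂ P D q) {e : ℂ} (he : e ∈ L₁ q) (he0 : e ≠ 0) :
    (conj e * P q / e).re = D q := by
  obtain ⟨hP, v, w, hf, hPq, hD⟩ := h
  have := hf.re_left ‖P q‖ he he0
  rwa [← hPq, ← hD] at this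

theorem re_right (h : IsModelAt L₁ L₂ N₁ N₂ P D q) {e : ℂ} (he : e ∈ L₂ q) (he0 : e ≠ 0) :
    (conj e * P q / e).re = D q := by
  obtain ⟨hP, v, w, hf, hPq, hD⟩ := h
  have := hf.re_right ‖P q‖ he he0
  rwa [← hPq, ← hD] at this

theorem abs_lt (h : IsModelAt L₁ L₂ N₁ N₂ P D q) : |D q| < ‖P q‖ := by
  obtain ⟨hP, v, w, hf, hPq, hD⟩ := h
  rw [hD, abs_mul, abs_norm]
  exact mul_lt_of_lt_one_right (norm_pos_iff.2 hP) hf.abs_re_lt_one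

/-- Two models at a point differ by a positive factor. -/
theorem exists_pos_smul {P' : ℂ → ℂ} {D' : ℂ → ℝ} (h : IsModelAt L₁ L₂ N₁ N₂ P D q)
    (h' : IsModelAt L₁ L₂ N₁ N₂ P' D' q) : ∃ r : ℝ, 0 < r ∧ P q = r * P' q ∧ D q = r * D' q := by
  obtain ⟨-, v, w, hf, -, -⟩ := id h
  have hn : v + w ∈ N₁ q := by rw [hf.N₁_eq]; exact Submodule.mem_span_singleton_self _
  have hn0 : (v + w) ^ 2 ≠ 0 := by
    rw [hf.add_sq]
    have hk : 0 < 2 + 2 * (conj v * w).re := by have := _root_.abs_lt.1 hf.abs_re_lt_one; linarith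
    exact mul_ne_zero (ofReal_ne_zero.2 hk.ne') (mul_ne_zero hf.left_ne_zero hf.right_ne_zero)
  obtain ⟨r, hr, e⟩ := h.exists_sq_eq_of_mem_N₁ hn
  obtain ⟨r', hr', e'⟩ := h'.exists_sq_eq_of_mem_N₁ hn
  have hr0 : r ≠ 0 := by rintro rfl; rw [e] at hn0; simp at hn0
  have hr0' : r' ≠ 0 := by rintro rfl; rw [e'] at hn0; simp at hn0
  have hpos : 0 < r' / r := div_pos (hr'.lt_of_ne' hr0') (hr.lt_of_ne' hr0)
  have hPP : P q = ((r' / r : ℝ) : ℂ) * P' q := by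
    have : (r : ℂ) ≠ 0 := ofReal_ne_zero.2 hr0
    push_cast
    field_simp
    rw [← e', e, mul_comm]
  refine ⟨r' / r, hpos, hPP, ?_⟩
  have hv : v ∈ L₁ q := by rw [hf.L₁_eq]; exact Submodule.mem_span_singleton_self _
  rw [← h.re_left hv hf.left_ne_zero, ← h'.re_left hv hf.left_ne_zero, hPP, ← re_ofReal_mul]
  congr 1
  ring

theorem pos_smul {r : ℝ} (hr : 0 < r) (h : IsModelAt L₁ L₂ N₁ N₂ P D q) :
    IsModelAt L₁ L₂ N₁ N₂ (fun z => r * P z) (fun z => r * D z) q := by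
  obtain ⟨hP, v, w, hf, hPq, hD⟩ := h
  refine ⟨mul_ne_zero (ofReal_ne_zero.2 hr.ne') hP, v, w, hf, ?_, ?_⟩
  · rw [norm_mul, norm_real, Real.norm_of_nonneg hr.le]
    push_cast
    rw [mul_assoc, ← hPq]
  · rw [norm_mul, norm_real, Real.norm_of_nonneg hr.le]
    simp only [hD]
    ring

end IsModelAt

theorem quadPoly_eq_zero_of_eventually {c : ℝ} {b a s : ℂ}
    (h : ∀ᶠ z in 𝓝 s, quadPoly c b a z = 0) : c = 0 ∧ b = 0 ∧ a = 0 := by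
  have h0 : quadPoly c b a =ᶠ[𝓝 s] fun _ => 0 := h
  have h1 : (fun z : ℂ => 2 * (c : ℂ) * z + b) =ᶠ[𝓝 s] fun _ => 0 := by
    have := h0.deriv
    simp only [deriv_const'] at this
    refine Filter.EventuallyEq.trans (Filter.Eventually.of_forall fun z => ?_) this
    exact (hasDerivAt_quadPoly c b a z).deriv.symm
  have h2 : 2 * (c : ℂ) = 0 := by
    have h3 := h1.deriv_eq
    have h4 : HasDerivAt (fun z : ℂ => 2 * (c : ℂ) * z + b) (2 * (c : ℂ)) s := by
      simpa using ((hasDerivAt_id s).const_mul (2 * (c : ℂ))).add_const b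
    rw [h4.deriv] at h3
    simpa using h3
  have hc : c = 0 := by simpa using h2
  have hb : b = 0 := by simpa [hc] using h1.self_of_nhds
  exact ⟨hc, hb, by simpa [quadPoly, hc, hb] using h0.self_of_nhds⟩

/-- The polynomial models of a net are unique up to a common positive factor. -/
theorem quad_model_unique {L₁ L₂ N₁ N₂ : DirField} {c c' k k' : ℝ} {b a b' a' s : ℂ}
    (h : ∀ᶠ q in 𝓝 s, IsModelAt L₁ L₂ N₁ N₂ (quadPoly c b a) (quadPot c b k) q)
    (h' : ∀ᶠ q in 𝓝 s, IsModelAt L₁ L₂ N₁ N₂ (quadPoly c' b' a') (quadPot c' b' k') q) :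
    ∃ r : ℝ, 0 < r ∧ c = r * c' ∧ b = r * b' ∧ a = r * a' ∧ k = r * k' := by
  obtain ⟨ε, hε, hball⟩ := Metric.eventually_nhds_iff_ball.1 (h.and h')
  have hs := Metric.mem_ball_self (x := s) hε
  have hdiff : DifferentiableOn ℂ (fun z => quadPoly c b a z / quadPoly c' b' a' z)
      (Metric.ball s ε) := fun z hz =>
    ((hasDerivAt_quadPoly c b a z).differentiableAt.div
      (hasDerivAt_quadPoly c' b' a' z).differentiableAt (hball z hz).2.1).differentiableWithinAt
  obtain ⟨r, hr⟩ := exists_const_of_im_eq_zero Metric.isOpen_ball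
    (convex_ball s ε).isPreconnected hdiff (fun q hq => by
      obtain ⟨t, ht, e, -⟩ := (hball q hq).1.exists_pos_smul (hball q hq).2
      rw [e, mul_div_cancel_right₀ _ (hball q hq).2.1, ofReal_im])
  obtain ⟨t, ht, e, eD⟩ := (hball s hs).1.exists_pos_smul (hball s hs).2
  have hrt : r = t := by
    have := hr s hs
    simp only [e, mul_div_cancel_right₀ _ (hball s hs).2.1] at this
    exact_mod_cast this.symm
  subst hrt
  obtain ⟨hc, hb, ha⟩ := quadPoly_eq_zero_of_eventually (c := c - r * c') (b := b - r * b')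
    (a := a - r * a') (s := s) (by
      filter_upwards [Metric.ball_mem_nhds s hε] with z hz
      have := hr z hz
      rw [div_eq_iff (hball z hz).2.1] at this
      simp only [quadPoly] at this ⊢
      push_cast
      linear_combination this)
  have hc := sub_eq_zero.1 hc
  have hb := sub_eq_zero.1 hb
  refine ⟨r, ht, hc, hb, sub_eq_zero.1 ha, ?_⟩
  simp only [quadPot, hc, hb, map_mul, conj_ofReal, mul_assoc, re_ofReal_mul] at eD
  linarith

/-- If the net has local polynomial models on a connected open set, then it has a global one. -/
theorem exists_global_quad_model {U : Set ℂ} (hc : IsConnected U)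
    {L₁ L₂ N₁ N₂ : DirField}
    (h : ∀ p ∈ U, ∃ (c : ℝ) (b a : ℂ) (k : ℝ), ∀ᶠ q in 𝓝 p,
      IsModelAt L₁ L₂ N₁ N₂ (quadPoly c b a) (quadPot c b k) q) :
    ∃ (c : ℝ) (b a : ℂ) (k : ℝ), ∀ q ∈ U,
      IsModelAt L₁ L₂ N₁ N₂ (quadPoly c b a) (quadPot c b k) q := by
  obtain ⟨p₀, hp₀⟩ := hc.nonempty
  obtain ⟨c, b, a, k, h₀⟩ := h p₀ hp₀
  refine ⟨c, b, a, k, ?_⟩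
  set S : Set ℂ := {p | ∀ᶠ q in 𝓝 p, IsModelAt L₁ L₂ N₁ N₂ (quadPoly c b a) (quadPot c b k) q}
  have hS : IsOpen S := isOpen_setOfPred_eventually_nhds
  have : U ⊆ S := by
    refine hc.isPreconnected.subset_of_closure_inter_subset hS ⟨p₀, hp₀, h₀⟩ ?_
    rintro p ⟨hpS, hpU⟩
    obtain ⟨c', b', a', k', hp⟩ := h p hpU
    obtain ⟨s, hs, hsS⟩ := mem_closure_iff_nhds.1 hpS _ (eventually_eventually_nhds.2 hp)
    obtain ⟨r, hr, rfl, rfl, rfl, rfl⟩ := quad_model_unique hsS hs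
    refine hp.mono fun q hq => ?_
    have := hq.pos_smul hr
    convert this using 1
    · funext z; simp only [quadPoly]; push_cast; ring
    · funext z
      simp only [quadPot, map_mul, conj_ofReal, mul_assoc, re_ofReal_mul]
      ring
  exact fun q hq => (this hq).self_of_nhds

/-! ### Conformal flatness and hexagonality give a quadratic differential -/

/-- The function `P` is `1 / φ'²` for a conformal map `φ` that flattens the net. -/
theorem IsConformallyFlat.exists_isHorizontal {U : Set ℂ} {N₁ N₂ : DirField}
    (h : IsConformallyFlat U N₁ N₂) {p : ℂ} (hp : p ∈ U) :
    ∃ P : ℂ → ℂ, ∀ᶠ q in 𝓝 p, DifferentiableAt ℂ P q ∧ IsHorizontal P N₁ q := by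
  obtain ⟨φ, hpφ, -, hφ, h1, -⟩ := h p hp
  have hd := hφ.deriv φ.open_source
  have key : ∀ q ∈ φ.source, fderiv ℝ φ q = (fderiv ℂ φ q).restrictScalars ℝ := fun q hq =>
    (hφ.differentiableAt (φ.open_source.mem_nhds hq)).fderiv_restrictScalars ℝ
  have happ : ∀ q ∈ φ.source, ∀ u, fderiv ℝ φ q u = deriv φ q * u := fun q hq u => by
    rw [key q hq, ContinuousLinearMap.coe_restrictScalars', fderiv_eq_smul_deriv, smul_eq_mul,
      mul_comm]
  have hne : ∀ q ∈ φ.source, deriv φ q ≠ 0 := fun q hq h0 => by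
    have h2 : (1 : ℂ) ∈ (N₁ q).map (fderiv ℝ φ q : ℂ →ₗ[ℝ] ℂ) := by
      rw [h1 q hq]; exact Submodule.mem_span_singleton_self _
    obtain ⟨u, -, hu⟩ := Submodule.mem_map.1 h2
    rw [ContinuousLinearMap.coe_coe, happ q hq, h0, zero_mul] at hu
    exact zero_ne_one hu
  refine ⟨fun q => ((deriv φ q) ^ 2)⁻¹, ?_⟩
  filter_upwards [φ.open_source.mem_nhds hpφ] with q hq
  refine ⟨((hd.differentiableAt (φ.open_source.mem_nhds hq)).pow 2).inv (pow_ne_zero 2 (hne q hq)),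
    inv_ne_zero (pow_ne_zero 2 (hne q hq)), fun v hv => ?_⟩
  have h2 : fderiv ℝ φ q v ∈ Submodule.span ℝ {(1 : ℂ)} := by
    rw [← h1 q hq]; exact Submodule.mem_map_of_mem hv
  obtain ⟨t, ht⟩ := Submodule.mem_span_singleton.1 h2
  rw [happ q hq] at ht
  refine ⟨t ^ 2, sq_nonneg t, ?_⟩
  have : (t : ℂ) = deriv φ q * v := by rw [← ht, real_smul, mul_one]
  have h3 := hne q hq
  push_cast
  rw [this]
  field_simp

theorem two_le_infty : (2 : WithTop ℕ∞) ≤ ∞ := by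
  decide

/-- The derivative of `‖E‖` in the direction of `E`, when the integral curves of `E` are straight. -/
theorem fderiv_norm_apply_self {E : ℂ → ℂ} {q : ℂ} {ρ : ℝ} (hE : DifferentiableAt ℝ E q)
    (hE0 : E q ≠ 0) (h : fderiv ℝ E q (E q) = ρ • E q) :
    fderiv ℝ (fun z => ‖E z‖) q (E q) = ρ * ‖E q‖ := by
  have h1 : HasFDerivAt (fun z => ‖E z‖) _ q := (hE.norm ℝ hE0).hasFDerivAt
  have h2 := (h1.pow 2).unique hE.hasFDerivAt.norm_sq
  have h3 := DFunLike.congr_fun h2 (E q)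
  have hn : ‖E q‖ ≠ 0 := norm_ne_zero_iff.2 hE0
  simp only [smul_apply, ContinuousLinearMap.comp_apply, h, innerSL_apply_apply,
    inner_smul_right, real_inner_self_eq_norm_sq, smul_eq_mul] at h3
  simp only [Nat.cast_ofNat, Nat.add_one_sub_one, pow_one, nsmul_eq_mul] at h3
  have h4 : 2 * ‖E q‖ * (fderiv ℝ (fun z => ‖E z‖) q) (E q) = 2 * ‖E q‖ * (ρ * ‖E q‖) := by
    rw [h3]; ring
  exact mul_left_cancel₀ (mul_ne_zero two_ne_zero hn) h4

/-- Two commuting vector fields of equal length with straight integral curves have a product that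
becomes holomorphic after division by their length. -/
theorem differentiableAt_mul_div_norm {E E' : ℂ → ℂ} {q : ℂ}
    (hE : DifferentiableAt ℝ E q) (hE' : DifferentiableAt ℝ E' q)
    (hind : (conj (E q) * E' q).im ≠ 0) (hnorm : ∀ᶠ z in 𝓝 q, ‖E z‖ = ‖E' z‖)
    (hcomm : fderiv ℝ E q (E' q) = fderiv ℝ E' q (E q))
    (hs : (conj (E q) * fderiv ℝ E q (E q)).im = 0)
    (hs' : (conj (E' q) * fderiv ℝ E' q (E' q)).im = 0) :
    DifferentiableAt ℂ (fun z => E z * E' z / ‖E z‖) q := by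
  have hE0 : E q ≠ 0 := by intro h; simp [h] at hind
  have hE0' : E' q ≠ 0 := by intro h; simp [h] at hind
  obtain ⟨ρ, hρ⟩ := exists_real_smul_of_im_eq_zero hE0 hs
  obtain ⟨ρ', hρ'⟩ := exists_real_smul_of_im_eq_zero hE0' hs'
  have n1 := fderiv_norm_apply_self hE hE0 hρ
  have n2 := fderiv_norm_apply_self hE' hE0' hρ'
  rw [← Filter.EventuallyEq.fderiv_eq (𝕜 := ℝ) (f₁ := fun z => ‖E z‖) hnorm,
    ← hnorm.self_of_nhds] at n2
  have hN : HasFDerivAt (fun z => ‖E z‖) _ q := (hE.norm ℝ hE0).hasFDerivAt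
  have hn : ‖E q‖ ≠ 0 := norm_ne_zero_iff.2 hE0
  have hNc : HasFDerivAt (fun z => ((‖E z‖⁻¹ : ℝ) : ℂ)) _ q :=
    ofRealCLM.hasFDerivAt.comp q ((hasDerivAt_inv hn).hasFDerivAt.comp q hN)
  have hP : HasFDerivAt (fun z => E z * E' z * ((‖E z‖⁻¹ : ℝ) : ℂ)) _ q :=
    (hE.hasFDerivAt.mul hE'.hasFDerivAt).mul hNc
  have heq : (fun z => E z * E' z / ‖E z‖) = fun z => E z * E' z * ((‖E z‖⁻¹ : ℝ) : ℂ) := by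
    funext z; push_cast; rw [div_eq_mul_inv]
  rw [heq]
  have hdiff := hP.differentiableAt
  have hfd := hP.fderiv
  set L := fderiv ℝ (fun z => E z * E' z * ((‖E z‖⁻¹ : ℝ) : ℂ)) q
  set Z := fderiv ℝ E q (E' q)
  have hnc : ((‖E q‖ : ℝ) : ℂ) ≠ 0 := ofReal_ne_zero.2 hn
  have LE : L (E q) = E q * Z / ‖E q‖ := by
    rw [hfd]
    simp only [add_apply, smul_apply, smul_eq_mul, ContinuousLinearMap.comp_apply, n1, ← hcomm, hρ,
      Pi.mul_apply, ContinuousLinearMap.toSpanSingleton_apply, ofRealCLM_apply, real_smul]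
    push_cast
    field_simp
    ring
  have LE' : L (E' q) = E' q * Z / ‖E q‖ := by
    rw [hfd]
    simp only [add_apply, smul_apply, smul_eq_mul, ContinuousLinearMap.comp_apply, n2, hρ',
      Pi.mul_apply, ContinuousLinearMap.toSpanSingleton_apply, ofRealCLM_apply, real_smul]
    push_cast
    field_simp
    ring
  have hL : ((Z / ‖E q‖) • (1 : ℂ →L[ℂ] ℂ)).restrictScalars ℝ = L := by
    have hre : ∀ f : ℂ →L[ℝ] ℝ, f.comp (((Z / ‖E q‖) • (1 : ℂ →L[ℂ] ℂ)).restrictScalars ℝ)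
        = f.comp L := fun f => by
      refine ContinuousLinearMap.eq_of_eq_on_frame hind ?_ ?_
      · simp only [ContinuousLinearMap.comp_apply, LE]
        congr 1
        simp
        ring
      · simp only [ContinuousLinearMap.comp_apply, LE']
        congr 1
        simp
        ring
    refine ContinuousLinearMap.ext fun u => Complex.ext ?_ ?_
    · exact DFunLike.congr_fun (hre reCLM) u
    · exact DFunLike.congr_fun (hre imCLM) u
  exact (hasFDerivAt_of_restrictScalars ℝ hdiff.hasFDerivAt hL).differentiableAt

/-- The web of `L₁`, `L₂` and one bisector foliation `N` is treated for both bisectors at once: `σ = 1`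
for `N₁` and `σ = -1` for `N₂`. -/
theorem IsHexagonal.exists_isHorizontal {U : Set ℂ} (hU : IsOpen U) {L₁ L₂ N₁ N₂ N : DirField}
    (hL : IsLinearNet U L₁ L₂) (hN : IsBisectorNet U L₁ L₂ N₁ N₂) {σ : ℝ} (hσ : σ ^ 2 = 1)
    (hNσ : ∀ q v w, IsNetFrame L₁ L₂ N₁ N₂ q v w → N q = Submodule.span ℝ {v + σ • w})
    (h : IsHexagonal U L₁ L₂ N) {p : ℂ} (hp : p ∈ U) :
    ∃ P : ℂ → ℂ, ∀ᶠ q in 𝓝 p, DifferentiableAt ℂ P q ∧ IsHorizontal P N₁ q := by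
  obtain ⟨φ, hpφ, hφU, hφ, hφs, ℓ₁, ℓ₂, ℓ₃, -, -, -, h1, h2, h3⟩ := h p hp
  obtain ⟨v₀, w₀, hf₀⟩ := hL.exists_netFrame hN hp
  set ζ := φ.symm
  have hσ0 : σ ≠ 0 := by rintro rfl; simp at hσ
  have hdφ : ∀ q ∈ φ.source, DifferentiableAt ℝ φ q := fun q hq =>
    (hφ.contDiffAt (φ.open_source.mem_nhds hq)).differentiableAt (by simp)
  have hcζ : ∀ q ∈ φ.source, ContDiffAt ℝ ∞ ζ (φ q) := fun q hq =>
    hφs.contDiffAt (φ.open_target.mem_nhds (φ.map_source hq))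
  have hdζ : ∀ q ∈ φ.source, DifferentiableAt ℝ ζ (φ q) := fun q hq =>
    (hcζ q hq).differentiableAt (by simp)
  have hinv : ∀ q ∈ φ.source, ∀ u, fderiv ℝ ζ (φ q) (fderiv ℝ φ q u) = u := fun q hq u => by
    have e := (hdζ q hq).hasFDerivAt.comp q (hdφ q hq).hasFDerivAt
    have e' : HasFDerivAt (ζ ∘ φ) (ContinuousLinearMap.id ℝ ℂ) q :=
      (hasFDerivAt_id q).congr_of_eventuallyEq (by
        filter_upwards [φ.open_source.mem_nhds hq] with z hz using φ.left_inv hz)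
    exact DFunLike.congr_fun (e.unique e') u
  -- `E'` and `E` are the pullbacks under `φ` of the constant fields `ε'` and `ε`. They commute, they
  -- are tangent to `L₁` and `L₂`, and `E' + E` is tangent to `N`, which bisects only if they have
  -- equal length.
  set ε' := fderiv ℝ φ p v₀
  set ε := fderiv ℝ φ p (σ • w₀)
  have hmem : ∀ (F : DirField) (ℓ : Submodule ℝ ℂ), Straightens φ F ℓ → ∀ u ∈ F p,
      ∀ q ∈ φ.source, fderiv ℝ ζ (φ q) (fderiv ℝ φ p u) ∈ F q ∧
        fderiv ℝ φ q (fderiv ℝ ζ (φ q) (fderiv ℝ φ p u)) = fderiv ℝ φ p u := by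
    intro F ℓ hF u hu q hq
    have : fderiv ℝ φ p u ∈ (F q).map (fderiv ℝ φ q : ℂ →ₗ[ℝ] ℂ) := by
      rw [hF q hq, ← hF p hpφ]; exact Submodule.mem_map_of_mem hu
    obtain ⟨x, hx, hxu⟩ := Submodule.mem_map.1 this
    rw [ContinuousLinearMap.coe_coe] at hxu
    rw [← hxu, hinv q hq]
    exact ⟨hx, rfl⟩
  set E : ℂ → ℂ := fun q => fderiv ℝ ζ (φ q) ε
  set E' : ℂ → ℂ := fun q => fderiv ℝ ζ (φ q) ε'
  have hE'L : ∀ q ∈ φ.source, E' q ∈ L₁ q ∧ fderiv ℝ φ q (E' q) = ε' :=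
    hmem L₁ ℓ₁ h1 v₀ (by rw [hf₀.L₁_eq]; exact Submodule.mem_span_singleton_self _)
  have hEL : ∀ q ∈ φ.source, E q ∈ L₂ q ∧ fderiv ℝ φ q (E q) = ε :=
    hmem L₂ ℓ₂ h2 (σ • w₀)
      (by rw [hf₀.L₂_eq]; exact Submodule.smul_mem _ _ (Submodule.mem_span_singleton_self _))
  have hEN : ∀ q ∈ φ.source, E' q + E q ∈ N q := fun q hq => by
    have := (hmem N ℓ₃ h3 (v₀ + σ • w₀)
      (by rw [hNσ p v₀ w₀ hf₀]; exact Submodule.mem_span_singleton_self _) q hq).1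
    rwa [map_add, map_add] at this
  have hε' : ε' ≠ 0 := fun h0 => hf₀.left_ne_zero (by
    have := hinv p hpφ v₀
    change fderiv ℝ ζ (φ p) ε' = v₀ at this
    rw [← this, h0, map_zero])
  have hcoef : ∀ q ∈ φ.source, ∀ v w, IsNetFrame L₁ L₂ N₁ N₂ q v w →
      ∃ s : ℝ, s ≠ 0 ∧ E' q = s • v ∧ E q = (σ * s) • w := by
    intro q hq v w hf
    have m1 := (hE'L q hq).1
    have m2 := (hEL q hq).1
    have m3 := hEN q hq
    rw [hf.L₁_eq] at m1
    rw [hf.L₂_eq] at m2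
    rw [hNσ q v w hf] at m3
    obtain ⟨s, hs⟩ := Submodule.mem_span_singleton.1 m1
    obtain ⟨t, ht⟩ := Submodule.mem_span_singleton.1 m2
    obtain ⟨r, hr⟩ := Submodule.mem_span_singleton.1 m3
    have hs0 : s ≠ 0 := by
      rintro rfl
      rw [zero_smul] at hs
      have := (hE'L q hq).2
      rw [← hs, map_zero] at this
      exact hε' this.symm
    refine ⟨s, hs0, hs.symm, ?_⟩
    rw [← hs, ← ht] at hr
    have i1 : ((r - s : ℝ) : ℂ) * v + ((r * σ - t : ℝ) : ℂ) * w = 0 := by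
      simp only [real_smul] at hr
      push_cast
      linear_combination hr
    have i2 : (r * σ - t) * (conj v * w).im = 0 := by
      have := congrArg (fun x => (conj v * x).im) i1
      simp only [mul_add, mul_left_comm (conj v), add_im, im_ofReal_mul, mul_zero, zero_im,
        conj_mul_self_of_norm_eq_one hf.norm_left, one_im, zero_add] at this
      exact this
    have i3 : (r - s) * (conj v * w).im = 0 := by
      have := congrArg (fun x => (x * conj w).im) i1
      have hc : (v * conj w).im = -(conj v * w).im := by simp; ring
      simp only [add_mul, mul_assoc, add_im, im_ofReal_mul, zero_mul, zero_im, hc,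
        mul_conj_self_of_norm_eq_one hf.norm_right, one_im, mul_zero, add_zero] at this
      linarith
    have j2 := (mul_eq_zero.1 i2).resolve_right hf.indep
    have j3 := (mul_eq_zero.1 i3).resolve_right hf.indep
    rw [← ht]
    congr 1
    linear_combination j3 * σ - j2
  have hspan : ∀ {F : DirField} {x e u : ℂ} {r : ℝ}, F x = Submodule.span ℝ {u} → e = r • u →
      r ≠ 0 → F x = Submodule.span ℝ {e} := fun hF he hr => by
    rw [hF, he, Submodule.span_singleton_smul_eq (IsUnit.mk0 _ hr)]
  have habs : |σ| = 1 := by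
    rw [← abs_one]
    exact sq_eq_sq_iff_abs_eq_abs _ _ |>.1 (by rw [hσ, one_pow])
  have hfder : ∀ q ∈ φ.source, ∀ e, HasFDerivAt (fun z => fderiv ℝ ζ (φ z) e)
      ((((fderiv ℝ (fderiv ℝ ζ) (φ q)).comp (fderiv ℝ φ q))).flip e) q := fun q hq e => by
    have d2 : DifferentiableAt ℝ (fderiv ℝ ζ) (φ q) :=
      ((hcζ q hq).fderiv_right (m := 1)
        (by rw [one_add_one_eq_two]; exact two_le_infty)).differentiableAt (by simp)
    exact (d2.hasFDerivAt.comp q (hdφ q hq).hasFDerivAt).clm_apply (hasFDerivAt_const e q)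
      |>.congr_fderiv (by ext; simp)
  refine ⟨fun z => σ * (E z * E' z / ‖E z‖), ?_⟩
  filter_upwards [φ.open_source.mem_nhds hpφ] with q hq
  obtain ⟨v, w, hf⟩ := hL.exists_netFrame hN (hφU hq)
  obtain ⟨s, hs, hE', hE⟩ := hcoef q hq v w hf
  have hnorm : ‖E q‖ = |s| := by
    rw [hE, norm_smul, hf.norm_right, mul_one, Real.norm_eq_abs, abs_mul, habs, one_mul]
  have hPq : (σ : ℂ) * (E q * E' q / ‖E q‖) = (|s| : ℝ) * (v * w) := by
    have h1 : ((|s| : ℝ) : ℂ) ≠ 0 := ofReal_ne_zero.2 (abs_ne_zero.2 hs)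
    have h2 : (σ : ℂ) ^ 2 = 1 := by exact_mod_cast hσ
    have h3 : ((|s| : ℝ) : ℂ) ^ 2 = (s : ℂ) ^ 2 := by exact_mod_cast sq_abs s
    rw [hnorm, hE, hE']
    simp only [real_smul]
    push_cast
    field_simp
    rw [h3, h2]
    ring
  refine ⟨(differentiableAt_mul_div_norm (hfder q hq ε).differentiableAt
    (hfder q hq ε').differentiableAt ?_ ?_ ?_ ?_ ?_).const_mul _, ?_, ?_⟩
  · change (conj (E q) * E' q).im ≠ 0
    have : (conj (E q) * E' q).im = -(σ * s * s) * (conj v * w).im := by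
      rw [hE, hE']; simp; ring
    rw [this]
    exact mul_ne_zero (neg_ne_zero.2 (mul_ne_zero (mul_ne_zero hσ0 hs) hs)) hf.indep
  · filter_upwards [φ.open_source.mem_nhds hq] with z hz
    obtain ⟨v, w, hf⟩ := hL.exists_netFrame hN (hφU hz)
    obtain ⟨s, hs, hE', hE⟩ := hcoef z hz v w hf
    change ‖E z‖ = ‖E' z‖
    rw [hE, hE', norm_smul, norm_smul, hf.norm_right, hf.norm_left, Real.norm_eq_abs, abs_mul, habs,
      one_mul, Real.norm_eq_abs]
  · change fderiv ℝ (fun z => fderiv ℝ ζ (φ z) ε) q (E' q) =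
      fderiv ℝ (fun z => fderiv ℝ ζ (φ z) ε') q (E q)
    rw [(hfder q hq ε).fderiv, (hfder q hq ε').fderiv]
    simp only [ContinuousLinearMap.flip_apply, ContinuousLinearMap.comp_apply,
      (hE'L q hq).2, (hEL q hq).2]
    exact ((hcζ q hq).isSymmSndFDerivAt (by simpa using two_le_infty)) ε' ε
  · refine hL.rectilinear₂.im_conj_mul_fderiv hU (hφU hq) (hfder q hq ε).differentiableAt ?_
    filter_upwards [φ.open_source.mem_nhds hq] with z hz
    obtain ⟨v, w, hf⟩ := hL.exists_netFrame hN (hφU hz)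
    obtain ⟨s, hs, hE', hE⟩ := hcoef z hz v w hf
    exact hspan hf.L₂_eq hE (mul_ne_zero hσ0 hs)
  · refine hL.rectilinear₁.im_conj_mul_fderiv hU (hφU hq) (hfder q hq ε').differentiableAt ?_
    filter_upwards [φ.open_source.mem_nhds hq] with z hz
    obtain ⟨v, w, hf⟩ := hL.exists_netFrame hN (hφU hz)
    obtain ⟨s, hs, hE', hE⟩ := hcoef z hz v w hf
    exact hspan hf.L₁_eq hE' hs
  · simp only [hPq]
    exact mul_ne_zero (ofReal_ne_zero.2 (abs_ne_zero.2 hs))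
      (mul_ne_zero hf.left_ne_zero hf.right_ne_zero)
  · intro n hn
    rw [hf.N₁_eq] at hn
    obtain ⟨t, rfl⟩ := Submodule.mem_span_singleton.1 hn
    have hk : 0 < 2 + 2 * (conj v * w).re := by have := abs_lt.1 hf.abs_re_lt_one; linarith
    refine ⟨t ^ 2 * (2 + 2 * (conj v * w).re) / |s|, by positivity, ?_⟩
    have h1 : ((|s| : ℝ) : ℂ) ≠ 0 := ofReal_ne_zero.2 (abs_ne_zero.2 hs)
    simp only [hPq]
    rw [real_smul, mul_pow, hf.add_sq, ofReal_div]
    push_cast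
    field_simp

/-! ### Coordinates in which the four foliations become parallel -/

/-- Functions `S`, `T` on `V` whose differentials are independent, such that the leaves of `N₁`,
`N₂`, `L₁`, `L₂` are level curves of `T`, `S`, `T - S`, `T + S`. -/
structure IsParallelCoords (V : Set ℂ) (L₁ L₂ N₁ N₂ : DirField) (S T : ℂ → ℝ) : Prop where
  contDiff_left : ContDiffOn ℝ ∞ S V
  contDiff_right : ContDiffOn ℝ ∞ T V
  indep : ∀ q ∈ V, ∀ u, fderiv ℝ S q u = 0 → fderiv ℝ T q u = 0 → u = 0
  mem_L₁ : ∀ q ∈ V, ∀ u, u ∈ L₁ q ↔ fderiv ℝ T q u = fderiv ℝ S q u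
  mem_L₂ : ∀ q ∈ V, ∀ u, u ∈ L₂ q ↔ fderiv ℝ T q u = -fderiv ℝ S q u
  mem_N₁ : ∀ q ∈ V, ∀ u, u ∈ N₁ q ↔ fderiv ℝ T q u = 0
  mem_N₂ : ∀ q ∈ V, ∀ u, u ∈ N₂ q ↔ fderiv ℝ S q u = 0

theorem exists_holomorphic_sqrt {V : Set ℂ} (hV : IsOpen V) (hc : Convex ℝ V) {P : ℂ → ℂ}
    (hP : DifferentiableOn ℂ P V) (h0 : ∀ q ∈ V, P q ≠ 0) :
    ∃ f : ℂ → ℂ, DifferentiableOn ℂ f V ∧ ∀ q ∈ V, f q ^ 2 = P q := by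
  obtain ⟨g, hg⟩ := hc.exists_forall_hasDerivWithinAt
    (((hP.deriv hV).div hP h0).div_const 2)
  have hg : ∀ q ∈ V, HasDerivAt g (deriv P q / P q / 2) q := fun q hq =>
    (hg q hq).hasDerivAt (hV.mem_nhds hq)
  have hder : ∀ q ∈ V, HasDerivAt (fun z => P z * exp (-2 * g z)) 0 q := fun q hq => by
    have h1 := (hP.differentiableAt (hV.mem_nhds hq)).hasDerivAt
    have h2 := h1.mul ((hg q hq).const_mul (-2)).cexp
    refine h2.congr_deriv ?_
    have := h0 q hq
    field_simp
    ring
  obtain ⟨a, ha⟩ := hV.exists_is_const_of_deriv_eq_zero hc.isPreconnected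
    (fun q hq => (hder q hq).differentiableAt.differentiableWithinAt)
    (fun q hq => (hder q hq).deriv)
  obtain ⟨s, hs⟩ := IsSquare.exists_sq a (IsAlgClosed.exists_eq_mul_self a)
  refine ⟨fun z => s * exp (g z), fun q hq =>
    ((hg q hq).cexp.differentiableAt.const_mul s).differentiableWithinAt, fun q hq => ?_⟩
  have := ha q hq
  rw [mul_pow, ← hs, ← this, ← Complex.exp_nat_mul, mul_assoc, ← Complex.exp_add]
  norm_num

/-- The linear form `u ↦ im (a * u)`. -/
noncomputable def imForm (a : ℂ) : ℂ →L[ℝ] ℝ := imCLM.comp (a • (1 : ℂ →L[ℝ] ℂ))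

@[simp] theorem imForm_apply (a u : ℂ) : imForm a u = (a * u).im := by simp [imForm]

theorem contDiffOn_of_forall_hasFDerivAt {V : Set ℂ} (hV : IsOpen V) {T : ℂ → ℝ}
    {η : ℂ → ℂ →L[ℝ] ℝ} (hη : ContDiffOn ℝ ∞ η V) (hT : ∀ q ∈ V, HasFDerivAt T (η q) q) :
    ContDiffOn ℝ ∞ T V := by
  rw [contDiffOn_infty_iff_fderiv_of_isOpen hV]
  exact ⟨fun q hq => (hT q hq).differentiableAt.differentiableWithinAt,
    hη.congr fun q hq => (hT q hq).fderiv⟩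

/-- A closed form `im (ψ dz)`, divided by a function of its primitive, has a primitive. -/
theorem exists_primitive_imForm_div_sqrt {V : Set ℂ} (hV : IsOpen V) (hc : Convex ℝ V) {ψ : ℂ → ℂ}
    (hψ : DifferentiableOn ℂ ψ V) {Y c : ℂ → ℝ} (hY : ContDiffOn ℝ ∞ Y V)
    (hY0 : ∀ q ∈ V, 0 < Y q) (hdY : ∀ q ∈ V, HasFDerivAt Y (c q • imForm (ψ q)) q) :
    ∃ T : ℂ → ℝ, ContDiffOn ℝ ∞ T V ∧
      ∀ q ∈ V, HasFDerivAt T ((√(Y q))⁻¹ • imForm (ψ q)) q := by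
  have hm : ContDiffOn ℝ ∞ (fun q => (√(Y q))⁻¹) V := fun q hq =>
    ((hY q hq).sqrt (hY0 q hq).ne').inv (Real.sqrt_pos.2 (hY0 q hq)).ne'
  have hψ' : ContDiffOn ℝ ∞ ψ V := (hψ.contDiffOn hV).restrict_scalars ℝ
  have hi : ContDiffOn ℝ ∞ (fun q => imForm (ψ q)) V :=
    (ContinuousLinearMap.compL ℝ ℂ ℂ ℝ imCLM).contDiff.comp_contDiffOn
      (hψ'.smul contDiffOn_const)
  have hω : ContDiffOn ℝ ∞ (fun q => (√(Y q))⁻¹ • imForm (ψ q)) V := hm.smul hi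
  obtain ⟨T, hT⟩ := hc.exists_forall_hasFDerivAt_of_fderiv_symmetric hV
    (hω.differentiableOn (by simp)) (by
      intro q hq u v
      have h1 : HasFDerivAt (𝕜 := ℝ) ψ _ q :=
        (hψ.differentiableAt (hV.mem_nhds hq)).hasDerivAt.hasFDerivAt.restrictScalars ℝ
      have h2 : HasFDerivAt (𝕜 := ℝ) (fun q => imForm (ψ q)) _ q :=
        (ContinuousLinearMap.compL ℝ ℂ ℂ ℝ imCLM).hasFDerivAt.comp q
          (h1.smul_const (1 : ℂ →L[ℝ] ℂ))
      have h3 : HasFDerivAt (𝕜 := ℝ) (fun q => (√(Y q))⁻¹) _ q :=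
        (hasDerivAt_inv (Real.sqrt_pos.2 (hY0 q hq)).ne').hasFDerivAt.comp q
          ((hdY q hq).sqrt (hY0 q hq).ne')
      have h4 : HasFDerivAt (𝕜 := ℝ) (fun q => (√(Y q))⁻¹ • imForm (ψ q)) _ q := h3.smul h2
      rw [h4.fderiv]
      simp
      ring)
  exact ⟨T, contDiffOn_of_forall_hasFDerivAt hV hω hT, hT⟩

theorem mem_span_iff_of_ne_zero {l : ℂ →L[ℝ] ℝ} (hl : l ≠ 0) {n : ℂ} (hn : n ≠ 0) (hln : l n = 0)
    (u : ℂ) : u ∈ Submodule.span ℝ {n} ↔ l u = 0 := by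
  constructor
  · intro h
    obtain ⟨t, rfl⟩ := Submodule.mem_span_singleton.1 h
    rw [map_smul, hln, smul_zero]
  · intro h
    by_cases hi : (conj n * u).im = 0
    · obtain ⟨r, rfl⟩ := exists_real_smul_of_im_eq_zero hn hi
      exact Submodule.smul_mem _ _ (Submodule.mem_span_singleton_self _)
    · exact absurd (ContinuousLinearMap.eq_of_eq_on_frame hi (by simpa using hln)
        (by simpa using h)) hl

theorem im_eq_zero_of_sq_eq {z : ℂ} {r : ℝ} (hr : 0 ≤ r) (h : z ^ 2 = r) : z.im = 0 := by
  have h1 := congrArg re h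
  have h2 := congrArg im h
  simp only [sq, mul_re, mul_im, ofReal_re, ofReal_im] at h1 h2
  by_contra hy
  have hx : z.re = 0 := (mul_eq_zero.1 (by linarith : z.re * z.im = 0)).resolve_right hy
  rw [hx] at h1
  have := mul_self_pos.2 hy
  linarith

theorem re_eq_zero_of_sq_eq {z : ℂ} {r : ℝ} (hr : r ≤ 0) (h : z ^ 2 = r) : z.re = 0 := by
  have h1 : (I * z) ^ 2 = ((-r : ℝ) : ℂ) := by rw [mul_pow, I_sq, h]; push_cast; ring
  simpa using im_eq_zero_of_sq_eq (neg_nonneg.2 hr) h1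

/-- If `conj z / z` has real part `D / n = cos φ`, then `z` makes the angle `φ / 2` with the real axis
up to sign and orientation, so `z.re : z.im` is `cos (φ / 2) : ± sin (φ / 2)`. -/
theorem sq_div_eq_sq_div {z : ℂ} {n D : ℝ} (hz : z ≠ 0) (hD : |D| < n)
    (h : (n * (conj z / z)).re = D) :
    (z.re / √((n + D) / 2)) ^ 2 = (z.im / √((n - D) / 2)) ^ 2 := by
  obtain ⟨h1, h2⟩ := abs_lt.1 hD
  rw [div_pow, div_pow, Real.sq_sqrt (by linarith), Real.sq_sqrt (by linarith),
    div_eq_div_iff (by linarith) (by linarith)]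
  have hz' : z.re ^ 2 + z.im ^ 2 ≠ 0 := by
    have := (normSq_pos.2 hz).ne'
    rw [normSq_apply] at this
    simpa [sq] using this
  have : D * (z.re ^ 2 + z.im ^ 2) = n * (z.re ^ 2 - z.im ^ 2) := by
    rw [← h, re_ofReal_mul, div_re, normSq_apply]
    simp only [conj_re, conj_im]
    have : z.re * z.re + z.im * z.im ≠ 0 := by simpa [sq] using hz'
    field_simp
    ring
  linear_combination -this / 2

/-- Coordinates straightening the four foliations exist on every convex open set on which the net
has a model `dz² / P`. -/
theorem exists_parallelCoords {U : Set ℂ} {L₁ L₂ N₁ N₂ : DirField} (hL : IsLinearNet U L₁ L₂)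
    {V : Set ℂ} (hVU : V ⊆ U) (hV : IsOpen V) (hc : Convex ℝ V) {P : ℂ → ℂ} {D : ℂ → ℝ}
    (hP : DifferentiableOn ℂ P V) (hDc : ContDiffOn ℝ ∞ D V)
    (hD : ∀ q ∈ V, HasFDerivAt D (gradForm (deriv P q)) q)
    (hmod : ∀ q ∈ V, IsModelAt L₁ L₂ N₁ N₂ P D q) :
    ∃ S T : ℂ → ℝ, IsParallelCoords V L₁ L₂ N₁ N₂ S T := by
  obtain ⟨f, hf, hfP⟩ := exists_holomorphic_sqrt hV hc hP fun q hq => (hmod q hq).1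
  have hf0 : ∀ q ∈ V, f q ≠ 0 := fun q hq h0 => (hmod q hq).1 (by rw [← hfP q hq, h0]; simp)
  have hnorm : ∀ q ∈ V, ‖P q‖ = normSq (f q) := fun q hq => by
    rw [← hfP q hq, norm_pow, Complex.sq_norm]
  have hfc : ContDiffOn ℝ ∞ f V := (hf.contDiffOn hV).restrict_scalars ℝ
  have hnc : ContDiffOn ℝ ∞ (fun q => normSq (f q)) V := by
    have : (fun q => normSq (f q)) = fun q => reCLM (f q) * reCLM (f q) + imCLM (f q) * imCLM (f q) :=
      funext fun q => normSq_apply _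
    rw [this]
    have h1 := reCLM.contDiff.comp_contDiffOn hfc
    have h2 := imCLM.contDiff.comp_contDiffOn hfc
    exact (h1.mul h1).add (h2.mul h2)
  have hdf : ∀ q ∈ V, HasDerivAt f (deriv f q) q := fun q hq =>
    (hf.differentiableAt (hV.mem_nhds hq)).hasDerivAt
  have hdP : ∀ q ∈ V, deriv P q = 2 * f q * deriv f q := fun q hq => by
    have h1 : P =ᶠ[𝓝 q] fun z => f z ^ 2 := by
      filter_upwards [hV.mem_nhds hq] with z hz using (hfP z hz).symm
    have h2 : HasDerivAt (fun z => f z ^ 2) _ q := (hdf q hq).pow 2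
    rw [h1.deriv_eq, h2.deriv]
    simp
  have hdn : ∀ q ∈ V, HasFDerivAt (fun z => normSq (f z))
      (2 • imForm (I * conj (f q) * deriv f q)) q := fun q hq => by
    have h1 : HasFDerivAt (𝕜 := ℝ) f _ q := (hdf q hq).hasFDerivAt.restrictScalars ℝ
    have h2 := reCLM.hasFDerivAt.comp q h1
    have h3 := imCLM.hasFDerivAt.comp q h1
    have : (fun q => normSq (f q)) = fun q => reCLM (f q) * reCLM (f q) + imCLM (f q) * imCLM (f q) :=
      funext fun q => normSq_apply _
    rw [this]
    refine ((h2.mul h2).add (h3.mul h3)).congr_fderiv (ContinuousLinearMap.ext fun u => ?_)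
    simp
    ring
  -- `X = ‖P‖ cos² (φ / 2)` is constant along `N₂` and `Y = ‖P‖ sin² (φ / 2)` is constant along `N₁`;
  -- this is the content of `hdX` and `hdY`.
  set X : ℂ → ℝ := fun z => (normSq (f z) + D z) / 2
  set Y : ℂ → ℝ := fun z => (normSq (f z) - D z) / 2
  have hX0 : ∀ q ∈ V, 0 < X q := fun q hq => by
    have := abs_lt.1 (hmod q hq).abs_lt
    rw [hnorm q hq] at this
    simp only [X]; linarith
  have hY0 : ∀ q ∈ V, 0 < Y q := fun q hq => by
    have := abs_lt.1 (hmod q hq).abs_lt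
    rw [hnorm q hq] at this
    simp only [Y]; linarith
  have hinv : ∀ q ∈ V, conj (f q) = normSq (f q) * (f q)⁻¹ := fun q hq => by
    have := hf0 q hq
    field_simp
    exact Complex.normSq_eq_conj_mul_self.symm
  have hdX : ∀ q ∈ V, HasFDerivAt X
      ((2 * normSq (f q) * (deriv f q).re) • imForm (I * (f q)⁻¹)) q := fun q hq => by
    have h := ((hdn q hq).add (hD q hq)).mul_const (1 / 2 : ℝ)
    have e : X = fun z => (normSq (f z) + D z) * (1 / 2 : ℝ) := by
      funext z; simp only [X]; ring
    rw [e]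
    refine h.congr_fderiv (ContinuousLinearMap.ext fun u => ?_)
    have h2 : ((2 * normSq (f q) * (deriv f q).re) • imForm (I * (f q)⁻¹)) u =
        (2 * (deriv f q).re) * (I * (normSq (f q) * (f q)⁻¹) * u).im := by
      simp only [smul_apply, imForm_apply, smul_eq_mul]
      rw [show I * (normSq (f q) * (f q)⁻¹) * u = normSq (f q) * (I * (f q)⁻¹ * u) by ring,
        im_ofReal_mul]
      ring
    rw [h2, ← hinv q hq, hdP q hq]
    simp
    ring
  have hdY : ∀ q ∈ V, HasFDerivAt Y
      ((-2 * normSq (f q) * (deriv f q).im) • imForm ((f q)⁻¹)) q := fun q hq => by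
    have h := ((hdn q hq).sub (hD q hq)).mul_const (1 / 2 : ℝ)
    have e : Y = fun z => (normSq (f z) - D z) * (1 / 2 : ℝ) := by
      funext z; simp only [Y]; ring
    rw [e]
    refine h.congr_fderiv (ContinuousLinearMap.ext fun u => ?_)
    have h2 : ((-2 * normSq (f q) * (deriv f q).im) • imForm ((f q)⁻¹)) u =
        (-2 * (deriv f q).im) * (normSq (f q) * (f q)⁻¹ * u).im := by
      simp only [smul_apply, imForm_apply, smul_eq_mul]
      rw [mul_assoc, mul_assoc (normSq (f q) : ℂ), im_ofReal_mul]
      ring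
    rw [h2, ← hinv q hq, hdP q hq]
    simp
    ring
  have hψ : DifferentiableOn ℂ (fun z => (f z)⁻¹) V := hf.inv hf0
  obtain ⟨S, hSc, hS⟩ := exists_primitive_imForm_div_sqrt hV hc (hψ.const_mul I)
    ((hnc.add hDc).div_const 2) hX0 hdX
  obtain ⟨T, hTc, hT⟩ := exists_primitive_imForm_div_sqrt hV hc hψ
    ((hnc.sub hDc).div_const 2) hY0 hdY
  have hSu : ∀ q ∈ V, ∀ u, fderiv ℝ S q u = ((f q)⁻¹ * u).re / √(X q) := fun q hq u => by
    rw [(hS q hq).fderiv, smul_apply, imForm_apply, smul_eq_mul, mul_assoc, I_mul_im]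
    exact (div_eq_inv_mul _ _).symm
  have hTu : ∀ q ∈ V, ∀ u, fderiv ℝ T q u = ((f q)⁻¹ * u).im / √(Y q) := fun q hq u => by
    rw [(hT q hq).fderiv, smul_apply, imForm_apply, smul_eq_mul]
    exact (div_eq_inv_mul _ _).symm
  have hXs : ∀ q ∈ V, √(X q) ≠ 0 := fun q hq => (Real.sqrt_pos.2 (hX0 q hq)).ne'
  have hYs : ∀ q ∈ V, √(Y q) ≠ 0 := fun q hq => (Real.sqrt_pos.2 (hY0 q hq)).ne'
  have hindep : ∀ q ∈ V, ∀ u, fderiv ℝ S q u = 0 → fderiv ℝ T q u = 0 → u = 0 := by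
    intro q hq u h1 h2
    rw [hSu q hq, div_eq_zero_iff] at h1
    rw [hTu q hq, div_eq_zero_iff] at h2
    have : (f q)⁻¹ * u = 0 :=
      Complex.ext (h1.resolve_right (hXs q hq)) (h2.resolve_right (hYs q hq))
    exact (mul_eq_zero.1 this).resolve_left (inv_ne_zero (hf0 q hq))
  have hsq : ∀ q ∈ V, ∀ e, e ∈ L₁ q ∨ e ∈ L₂ q → (fderiv ℝ T q e) ^ 2 = (fderiv ℝ S q e) ^ 2 := by
    intro q hq e he
    rcases eq_or_ne e 0 with rfl | he0
    · simp
    have h1 : (conj e * P q / e).re = D q :=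
      he.elim (fun h => (hmod q hq).re_left h he0) (fun h => (hmod q hq).re_right h he0)
    have hz : (f q)⁻¹ * e ≠ 0 := mul_ne_zero (inv_ne_zero (hf0 q hq)) he0
    rw [hSu q hq, hTu q hq]
    refine (sq_div_eq_sq_div hz (by rw [← hnorm q hq]; exact (hmod q hq).abs_lt) ?_).symm
    rw [← h1, ← hfP q hq]
    congr 1
    have := hf0 q hq
    have h2 : conj (f q) ≠ 0 := by simpa using this
    rw [map_mul, map_inv₀, Complex.normSq_eq_conj_mul_self]
    field_simp
  have hS0 : ∀ q ∈ V, ∀ e, e ≠ 0 → e ∈ L₁ q ∨ e ∈ L₂ q → fderiv ℝ S q e ≠ 0 := by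
    intro q hq e he0 he h0
    have := hsq q hq e he
    rw [h0] at this
    exact he0 (hindep q hq e h0 (by simpa using this))
  -- The sign in `dT = ± dS` along `L₁` is constant, since `V` is connected.
  have hsign : ∃ σ : ℝ, σ ^ 2 = 1 ∧ ∀ q ∈ V, ∀ e ∈ L₁ q, σ * fderiv ℝ T q e = fderiv ℝ S q e := by
    have hex : ∀ q, ∃ e, q ∈ V → e ∈ L₁ q ∧ e ≠ 0 ∧ L₁ q = Submodule.span ℝ {e} := fun q => by
      by_cases hq : q ∈ V
      · obtain ⟨-, v, w, h, -⟩ := hmod q hq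
        exact ⟨v, fun _ => ⟨by rw [h.L₁_eq]; exact Submodule.mem_span_singleton_self _,
          h.left_ne_zero, h.L₁_eq⟩⟩
      · exact ⟨0, fun h => absurd h hq⟩
    choose e he using hex
    set κ : ℂ → ℝ := fun q => fderiv ℝ T q (e q) / fderiv ℝ S q (e q)
    have hκeq : ∀ q ∈ V, ∀ x ∈ L₁ q, x ≠ 0 → κ q = fderiv ℝ T q x / fderiv ℝ S q x := by
      intro q hq x hx hx0
      have := (he q hq).2.2 ▸ hx
      obtain ⟨r, rfl⟩ := Submodule.mem_span_singleton.1 this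
      have hr : r ≠ 0 := by rintro rfl; simp at hx0
      rw [map_smul, map_smul, smul_eq_mul, smul_eq_mul, mul_div_mul_left _ _ hr]
    have hκ1 : ∀ q ∈ V, κ q ^ 2 = 1 := fun q hq => by
      have := hS0 q hq (e q) (he q hq).2.1 (Or.inl (he q hq).1)
      simp only [κ]
      rw [div_pow, hsq q hq _ (Or.inl (he q hq).1), div_self (pow_ne_zero 2 this)]
    have hκc : ContinuousOn κ V := by
      intro q hq
      apply ContinuousAt.continuousWithinAt
      obtain ⟨W, hW, hqW, E, hE, hF⟩ := hL.foliation₁ q (hVU hq)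
      have hEc : ContinuousAt E q := hE.continuousOn.continuousAt (hW.mem_nhds hqW)
      have c1 : ContinuousAt (fun z => fderiv ℝ T z (E z)) q :=
        ((hTc.continuousOn_fderiv_of_isOpen hV (by simp)).continuousAt (hV.mem_nhds hq)).clm_apply
          hEc
      have c2 : ContinuousAt (fun z => fderiv ℝ S z (E z)) q :=
        ((hSc.continuousOn_fderiv_of_isOpen hV (by simp)).continuousAt (hV.mem_nhds hq)).clm_apply
          hEc
      have hm : ∀ z ∈ W, E z ∈ L₁ z := fun z hz => by
        rw [(hF z hz).2]; exact Submodule.mem_span_singleton_self _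
      refine (c1.div c2 (hS0 q hq _ (hF q hqW).1 (Or.inl (hm q hqW)))).congr ?_
      filter_upwards [hV.mem_nhds hq, hW.mem_nhds hqW] with z hz hzW
      exact (hκeq z hz _ (hm z hzW) (hF z hzW).1).symm
    have hfin : ∀ σ : ℝ, σ ^ 2 = 1 → (∀ q ∈ V, κ q = σ) →
        ∀ q ∈ V, ∀ x ∈ L₁ q, σ * fderiv ℝ T q x = fderiv ℝ S q x := by
      intro σ hσ h q hq x hx
      rcases eq_or_ne x 0 with rfl | hx0
      · simp
      have h1 := hκeq q hq x hx hx0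
      have h2 := hS0 q hq x hx0 (Or.inl hx)
      rw [h q hq, eq_div_iff h2] at h1
      rw [← h1, ← mul_assoc, ← sq, hσ, one_mul]
    have hor := hc.isPreconnected.eq_one_or_eq_neg_one_of_sq_eq hκc
      (fun q hq => by simpa using hκ1 q hq)
    rcases hor with h | h
    · exact ⟨1, by norm_num, hfin 1 (by norm_num) fun q hq => h hq⟩
    · exact ⟨-1, by norm_num, hfin (-1) (by norm_num) fun q hq => h hq⟩
  obtain ⟨σ, hσ, hσT⟩ := hsign
  have hσ0 : σ ≠ 0 := by rintro rfl; simp at hσ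
  have hfT : ∀ q ∈ V, ∀ u, fderiv ℝ (fun z => σ * T z) q u = σ * fderiv ℝ T q u := fun q hq u => by
    rw [((hT q hq).const_mul σ).fderiv, (hT q hq).fderiv]; rfl
  have hTf : ∀ q ∈ V, fderiv ℝ T q (f q) = 0 := fun q hq => by
    rw [hTu q hq, inv_mul_cancel₀ (hf0 q hq)]; simp
  have hSf : ∀ q ∈ V, fderiv ℝ S q (f q) ≠ 0 := fun q hq => by
    rw [hSu q hq, inv_mul_cancel₀ (hf0 q hq)]; simpa using hXs q hq
  have hSif : ∀ q ∈ V, fderiv ℝ S q (I * f q) = 0 := fun q hq => by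
    rw [hSu q hq, mul_left_comm, inv_mul_cancel₀ (hf0 q hq)]; simp
  have hTif : ∀ q ∈ V, fderiv ℝ T q (I * f q) ≠ 0 := fun q hq => by
    rw [hTu q hq, mul_left_comm, inv_mul_cancel₀ (hf0 q hq)]; simpa using hYs q hq
  refine ⟨S, fun z => σ * T z, hSc, contDiffOn_const.mul hTc, ?_, ?_, ?_, ?_, ?_⟩
  · intro q hq u h1 h2
    rw [hfT q hq] at h2
    exact hindep q hq u h1 ((mul_eq_zero.1 h2).resolve_left hσ0)
  · intro q hq u
    obtain ⟨-, v, w, h, -⟩ := hmod q hq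
    have hv : v ∈ L₁ q := by rw [h.L₁_eq]; exact Submodule.mem_span_singleton_self _
    rw [h.L₁_eq, mem_span_iff_of_ne_zero (l := σ • fderiv ℝ T q - fderiv ℝ S q) ?_ h.left_ne_zero ?_,
      hfT q hq]
    · simp [sub_eq_zero]
    · intro h0
      have := DFunLike.congr_fun h0 (f q)
      simp [hTf q hq, hSf q hq] at this
    · simp [hσT q hq v hv]
  · intro q hq u
    obtain ⟨-, v, w, h, -⟩ := hmod q hq
    have hv : v ∈ L₁ q := by rw [h.L₁_eq]; exact Submodule.mem_span_singleton_self _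
    have hw : w ∈ L₂ q := by rw [h.L₂_eq]; exact Submodule.mem_span_singleton_self _
    have hw' : σ * fderiv ℝ T q w = -fderiv ℝ S q w := by
      have h1 : (σ * fderiv ℝ T q w) ^ 2 = (fderiv ℝ S q w) ^ 2 := by
        rw [mul_pow, hσ, one_mul, hsq q hq w (Or.inr hw)]
      refine (sq_eq_sq_iff_eq_or_eq_neg.1 h1).resolve_left fun h2 => ?_
      have h3 : σ • fderiv ℝ T q = fderiv ℝ S q :=
        ContinuousLinearMap.eq_of_eq_on_frame h.indep (hσT q hq v hv) h2
      have := DFunLike.congr_fun h3 (f q)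
      rw [smul_apply, hTf q hq, smul_zero] at this
      exact hSf q hq this.symm
    rw [h.L₂_eq, mem_span_iff_of_ne_zero (l := σ • fderiv ℝ T q + fderiv ℝ S q) ?_ h.right_ne_zero
      ?_, hfT q hq]
    · simp [eq_neg_iff_add_eq_zero]
    · intro h0
      have := DFunLike.congr_fun h0 (f q)
      simp [hTf q hq, hSf q hq] at this
    · simp [hw']
  · intro q hq u
    obtain ⟨-, v, w, h, -⟩ := id (hmod q hq)
    have hn : v + w ∈ N₁ q := by rw [h.N₁_eq]; exact Submodule.mem_span_singleton_self _
    have hn0 := h.add_ne_zero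
    have hTn : fderiv ℝ T q (v + w) = 0 := by
      obtain ⟨r, hr, e⟩ := (hmod q hq).exists_sq_eq_of_mem_N₁ hn
      have h1 : ((f q)⁻¹ * (v + w)) ^ 2 = r := by
        rw [mul_pow, e, ← hfP q hq]
        have := hf0 q hq
        field_simp
      rw [hTu q hq, im_eq_zero_of_sq_eq hr h1, zero_div]
    rw [h.N₁_eq, mem_span_iff_of_ne_zero (l := fderiv ℝ T q) ?_ hn0 hTn, hfT q hq]
    · simp [hσ0]
    · intro h0
      have := hTif q hq
      rw [h0] at this
      simp at this
  · intro q hq u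
    obtain ⟨-, v, w, h, -⟩ := id (hmod q hq)
    have hn : v - w ∈ N₂ q := by rw [h.N₂_eq]; exact Submodule.mem_span_singleton_self _
    have hn0 := h.sub_ne_zero
    have hSn : fderiv ℝ S q (v - w) = 0 := by
      obtain ⟨r, hr, e⟩ := (hmod q hq).exists_sq_eq_of_mem_N₂ hn
      have h1 : ((f q)⁻¹ * (v - w)) ^ 2 = r := by
        rw [mul_pow, e, ← hfP q hq]
        have := hf0 q hq
        field_simp
      rw [hSu q hq, re_eq_zero_of_sq_eq hr h1, zero_div]
    rw [h.N₂_eq, mem_span_iff_of_ne_zero (l := fderiv ℝ S q) ?_ hn0 hSn]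
    intro h0
    have := hSf q hq
    rw [h0] at this
    simp at this

/-! ### From the model back to conformal flatness and hexagonality -/

theorem mem_span_real_iff_im_div_eq_zero {a u : ℂ} (ha : a ≠ 0) :
    u ∈ Submodule.span ℝ {a} ↔ (u / a).im = 0 := by
  constructor
  · intro h
    obtain ⟨t, rfl⟩ := Submodule.mem_span_singleton.1 h
    rw [real_smul, mul_div_cancel_right₀ _ ha, ofReal_im]
  · intro h
    refine Submodule.mem_span_singleton.2 ⟨(u / a).re, ?_⟩
    have : (((u / a).re : ℝ) : ℂ) = u / a := Complex.ext (by simp) (by simp [h])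
    rw [real_smul, this, div_mul_cancel₀ _ ha]

/-- The image of a line under a linear map, one nonzero vector of the image being known. -/
theorem map_span_eq {A : ℂ →L[ℝ] ℂ} {u x : ℂ} {r : ℝ} (hr : r ≠ 0) (h : A u = r • x) :
    (Submodule.span ℝ {u}).map (A : ℂ →ₗ[ℝ] ℂ) = Submodule.span ℝ {x} := by
  rw [Submodule.map_span, Set.image_singleton, ContinuousLinearMap.coe_coe, h,
    Submodule.span_singleton_smul_eq (IsUnit.mk0 r hr)]

/-- The flattening map is a primitive of `1 / √P`. -/
theorem isConformallyFlat_of_model {U : Set ℂ} (hU : IsOpen U) {L₁ L₂ N₁ N₂ : DirField}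
    {P : ℂ → ℂ} {D : ℂ → ℝ} (hP : DifferentiableOn ℂ P U)
    (hmod : ∀ q ∈ U, IsModelAt L₁ L₂ N₁ N₂ P D q) : IsConformallyFlat U N₁ N₂ := by
  intro p hp
  obtain ⟨ε, hε, hball⟩ := Metric.isOpen_iff.1 hU p hp
  set V := Metric.ball p ε
  have hV : IsOpen V := Metric.isOpen_ball
  have hpV : p ∈ V := Metric.mem_ball_self hε
  have hc : Convex ℝ V := convex_ball p ε
  obtain ⟨f, hf, hfP⟩ := exists_holomorphic_sqrt hV hc (hP.mono hball)
    fun q hq => (hmod q (hball hq)).1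
  have hf0 : ∀ q ∈ V, f q ≠ 0 := fun q hq h0 =>
    (hmod q (hball hq)).1 (by rw [← hfP q hq, h0]; simp)
  have hψ : DifferentiableOn ℂ (fun z => (f z)⁻¹) V := hf.inv hf0
  obtain ⟨g, hg⟩ := hc.exists_forall_hasDerivWithinAt hψ
  have hg : ∀ q ∈ V, HasDerivAt g (f q)⁻¹ q := fun q hq => (hg q hq).hasDerivAt (hV.mem_nhds hq)
  have hgd : DifferentiableOn ℂ g V := fun q hq => (hg q hq).differentiableAt.differentiableWithinAt
  have hstrict : HasStrictDerivAt g (f p)⁻¹ p :=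
    ((hgd.contDiffOn (n := 1) hV).contDiffAt (hV.mem_nhds hpV)).hasStrictDerivAt' (hg p hpV)
      one_ne_zero
  have hst := hstrict.hasStrictFDerivAt_equiv (inv_ne_zero (hf0 p hpV))
  set ψ := (hst.toOpenPartialHomeomorph g).restrOpen V hV
  have hsrc : ψ.source ⊆ V := fun x hx => hx.2
  have hcoe : (ψ : ℂ → ℂ) = g := rfl
  have hfd : ∀ q ∈ V, ∀ u, fderiv ℝ g q u = (f q)⁻¹ * u := fun q hq u => by
    have h1 : HasFDerivAt (𝕜 := ℝ) g _ q := (hg q hq).hasFDerivAt.restrictScalars ℝ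
    rw [h1.fderiv]
    simp [mul_comm]
  refine ⟨ψ, ⟨hst.mem_toOpenPartialHomeomorph_source, hpV⟩, hsrc.trans hball, hgd.mono hsrc,
    fun q hq => ?_, fun q hq => ?_⟩
  · obtain ⟨-, v, w, h, -⟩ := id (hmod q (hball (hsrc hq)))
    have hn : v + w ∈ N₁ q := by rw [h.N₁_eq]; exact Submodule.mem_span_singleton_self _
    have hn0 := h.add_ne_zero
    obtain ⟨r, hr, e⟩ := (hmod q (hball (hsrc hq))).exists_sq_eq_of_mem_N₁ hn
    have hf := hf0 q (hsrc hq)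
    have h1 : ((f q)⁻¹ * (v + w)) ^ 2 = r := by
      rw [mul_pow, e, ← hfP q (hsrc hq)]
      field_simp
    have h2 := im_eq_zero_of_sq_eq hr h1
    set z := (f q)⁻¹ * (v + w)
    have hz : z = z.re • (1 : ℂ) := by apply Complex.ext <;> simp [h2]
    rw [h.N₁_eq]
    refine map_span_eq (r := z.re) (fun h0 => ?_) ?_
    · rw [h0, zero_smul] at hz
      exact mul_ne_zero (inv_ne_zero hf) hn0 hz
    · rw [hcoe, hfd q (hsrc hq), ← hz]
  · obtain ⟨-, v, w, h, -⟩ := id (hmod q (hball (hsrc hq)))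
    have hn : v - w ∈ N₂ q := by rw [h.N₂_eq]; exact Submodule.mem_span_singleton_self _
    have hn0 := h.sub_ne_zero
    obtain ⟨r, hr, e⟩ := (hmod q (hball (hsrc hq))).exists_sq_eq_of_mem_N₂ hn
    have hf := hf0 q (hsrc hq)
    have h1 : ((f q)⁻¹ * (v - w)) ^ 2 = r := by
      rw [mul_pow, e, ← hfP q (hsrc hq)]
      field_simp
    have h2 := re_eq_zero_of_sq_eq hr h1
    set z := (f q)⁻¹ * (v - w)
    have hz : z = z.im • I := by apply Complex.ext <;> simp [h2]
    rw [h.N₂_eq]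
    refine map_span_eq (r := z.im) (fun h0 => ?_) ?_
    · rw [h0, zero_smul] at hz
      exact mul_ne_zero (inv_ne_zero hf) hn0 hz
    · rw [hcoe, hfd q (hsrc hq), ← hz]

namespace IsParallelCoords
variable {V : Set ℂ} {L₁ L₂ N₁ N₂ : DirField} {S T : ℂ → ℝ}

/-- The image of a line under an injective linear map of the plane, from an equation of the line. -/
theorem map_eq {A : ℂ →L[ℝ] ℂ} (hA : Function.Injective A) {F : Submodule ℝ ℂ} {x : ℂ}
    (hx : x ≠ 0) (h : ∀ u, u ∈ F ↔ (A u / x).im = 0) :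
    F.map (A : ℂ →ₗ[ℝ] ℂ) = Submodule.span ℝ {x} := by
  have hs : Function.Surjective (A : ℂ →ₗ[ℝ] ℂ) := LinearMap.injective_iff_surjective.1 hA
  ext y
  rw [mem_span_real_iff_im_div_eq_zero hx]
  constructor
  · intro hy
    obtain ⟨u, hu, rfl⟩ := Submodule.mem_map.1 hy
    exact (h u).1 hu
  · intro hy
    obtain ⟨u, rfl⟩ := hs y
    exact Submodule.mem_map_of_mem ((h u).2 hy)

/-- Coordinates straightening the four foliations provide a local diffeomorphism to the web of
horizontal, vertical and diagonal lines. -/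
theorem exists_straightens (h : IsParallelCoords V L₁ L₂ N₁ N₂ S T) (hV : IsOpen V) {p : ℂ}
    (hp : p ∈ V) :
    ∃ φ : OpenPartialHomeomorph ℂ ℂ, p ∈ φ.source ∧ φ.source ⊆ V ∧
      ContDiffOn ℝ ∞ φ φ.source ∧ ContDiffOn ℝ ∞ φ.symm φ.target ∧
      Straightens φ L₁ (Submodule.span ℝ {1 + I}) ∧ Straightens φ L₂ (Submodule.span ℝ {1 - I}) ∧
      Straightens φ N₁ (Submodule.span ℝ {1}) ∧ Straightens φ N₂ (Submodule.span ℝ {I}) := by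
  set Φ : ℂ → ℂ := fun z => (S z : ℂ) + T z * I
  have hΦ : ContDiffOn ℝ ∞ Φ V :=
    (ofRealCLM.contDiff.comp_contDiffOn h.contDiff_left).add
      ((ofRealCLM.contDiff.comp_contDiffOn h.contDiff_right).mul contDiffOn_const)
  have hΦa : ∀ q ∈ V, ContDiffAt ℝ ∞ Φ q := fun q hq => hΦ.contDiffAt (hV.mem_nhds hq)
  have hfd : ∀ q ∈ V, ∀ u, fderiv ℝ Φ q u = (fderiv ℝ S q u : ℂ) + fderiv ℝ T q u * I := by
    intro q hq u
    have h1 := ((h.contDiff_left.contDiffAt (hV.mem_nhds hq)).differentiableAt (by simp)).hasFDerivAt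
    have h2 := ((h.contDiff_right.contDiffAt (hV.mem_nhds hq)).differentiableAt
      (by simp)).hasFDerivAt
    have h3 : HasFDerivAt Φ _ q := (ofRealCLM.hasFDerivAt.comp q h1).add
      ((ofRealCLM.hasFDerivAt.comp q h2).mul_const I)
    rw [h3.fderiv]
    simp [mul_comm]
  have hinj : ∀ q ∈ V, Function.Injective (fderiv ℝ Φ q) := fun q hq =>
    (injective_iff_map_eq_zero _).2 fun u hu => by
      rw [hfd q hq] at hu
      have e1 := congrArg re hu
      have e2 := congrArg im hu
      simp at e1 e2
      exact h.indep q hq u e1 e2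
  have hequiv : ∀ q ∈ V, ∃ A : ℂ ≃L[ℝ] ℂ, (A : ℂ →L[ℝ] ℂ) = fderiv ℝ Φ q := fun q hq =>
    ⟨(LinearEquiv.ofInjectiveEndo (fderiv ℝ Φ q : ℂ →ₗ[ℝ] ℂ)
      (hinj q hq)).toContinuousLinearEquiv, by ext; rfl⟩
  have hder : ∀ q ∈ V, HasFDerivAt Φ (fderiv ℝ Φ q) q := fun q hq =>
    ((hΦa q hq).differentiableAt (by simp)).hasFDerivAt
  obtain ⟨A, hA⟩ := hequiv p hp
  set φ := ((hΦa p hp).toOpenPartialHomeomorph Φ (f' := A) (by rw [hA]; exact hder p hp)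
    (by simp)).restrOpen V hV
  have hsrc : φ.source ⊆ V := fun x hx => hx.2
  have hcoe : (φ : ℂ → ℂ) = Φ := rfl
  refine ⟨φ, ⟨(hΦa p hp).mem_toOpenPartialHomeomorph_source _ _, hp⟩, hsrc, hΦ.mono hsrc, ?_,
    ?_, ?_, ?_, ?_⟩
  · intro y hy
    have hyV : φ.symm y ∈ V := hsrc (φ.map_target hy)
    obtain ⟨B, hB⟩ := hequiv _ hyV
    exact (φ.contDiffAt_symm (f₀' := B) hy (by rw [hB]; exact hder _ hyV)
      (hΦa _ hyV)).contDiffWithinAt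
  · intro q hq
    rw [hcoe]
    refine map_eq (hinj q (hsrc hq)) (fun h0 => ?_) fun u => ?_
    · have := congrArg re h0
      simp at this
    · rw [h.mem_L₁ q (hsrc hq), hfd q (hsrc hq), div_im]
      simp [normSq_apply]
      constructor <;> intro h <;> linarith
  · intro q hq
    rw [hcoe]
    refine map_eq (hinj q (hsrc hq)) (fun h0 => ?_) fun u => ?_
    · have := congrArg re h0
      simp at this
    · rw [h.mem_L₂ q (hsrc hq), hfd q (hsrc hq), div_im]
      simp [normSq_apply]
      constructor <;> intro h <;> linarith
  · intro q hq
    rw [hcoe]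
    refine map_eq (hinj q (hsrc hq)) one_ne_zero fun u => ?_
    rw [h.mem_N₁ q (hsrc hq), hfd q (hsrc hq)]
    simp
  · intro q hq
    rw [hcoe]
    refine map_eq (hinj q (hsrc hq)) I_ne_zero fun u => ?_
    rw [h.mem_N₂ q (hsrc hq), hfd q (hsrc hq)]
    simp

end IsParallelCoords

theorem span_ne_span {a b : ℂ} (ha : a ≠ 0) (h : (b / a).im ≠ 0) :
    Submodule.span ℝ {a} ≠ Submodule.span ℝ {b} := fun e => h
  ((mem_span_real_iff_im_div_eq_zero ha).1 (e ▸ Submodule.mem_span_singleton_self b))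

theorem isHexagonal_of_coords {U : Set ℂ} {L₁ L₂ N₁ N₂ : DirField}
    (h : ∀ p ∈ U, ∃ V ⊆ U, IsOpen V ∧ p ∈ V ∧ ∃ S T, IsParallelCoords V L₁ L₂ N₁ N₂ S T) :
    IsHexagonal U L₁ L₂ N₁ ∧ IsHexagonal U L₁ L₂ N₂ := by
  have h1 : (1 + I : ℂ) ≠ 0 := fun h0 => by simpa using congrArg re h0
  have h2 : (1 - I : ℂ) ≠ 0 := fun h0 => by simpa using congrArg re h0
  constructor
  all_goals
    intro p hp
    obtain ⟨V, hVU, hV, hpV, S, T, hST⟩ := h p hp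
    obtain ⟨φ, hpφ, hφV, c1, c2, s1, s2, s3, s4⟩ := hST.exists_straightens hV hpV
  · refine ⟨φ, hpφ, hφV.trans hVU, c1, c2, _, _, _, ?_, ?_, ?_, s1, s2, s3⟩
    · exact span_ne_span h1 (by rw [div_im]; norm_num [normSq_apply])
    · exact span_ne_span h1 (by rw [div_im]; norm_num [normSq_apply])
    · exact span_ne_span h2 (by rw [div_im]; norm_num [normSq_apply])
  · refine ⟨φ, hpφ, hφV.trans hVU, c1, c2, _, _, _, ?_, ?_, ?_, s1, s2, s4⟩
    · exact span_ne_span h1 (by rw [div_im]; norm_num [normSq_apply])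
    · exact span_ne_span h1 (by rw [div_im]; norm_num [normSq_apply])
    · exact span_ne_span h2 (by rw [div_im]; norm_num [normSq_apply])

/-! ### Abelian relations of the web -/

/-- The differential of a form `k • dh`. -/
theorem fderiv_smul_fderiv {k h : ℂ → ℝ} {η : ℂ → ℂ →L[ℝ] ℝ} {q : ℂ} (hk : DifferentiableAt ℝ k q)
    (hh : ContDiffAt ℝ ∞ h q) (hη : η =ᶠ[𝓝 q] fun z => k z • fderiv ℝ h z) (u v : ℂ) :
    fderiv ℝ η q u v = fderiv ℝ k q u * fderiv ℝ h q v + k q * fderiv ℝ (fderiv ℝ h) q u v := by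
  have h2 : DifferentiableAt ℝ (fderiv ℝ h) q :=
    (hh.fderiv_right (m := 1) (by rw [one_add_one_eq_two]; exact two_le_infty)).differentiableAt
      (by simp)
  have h3 : HasFDerivAt (fun z => k z • fderiv ℝ h z) _ q := hk.hasFDerivAt.smul h2.hasFDerivAt
  rw [hη.fderiv_eq, h3.fderiv]
  simp
  ring

/-- The form `k • dh` is closed iff `dk ∧ dh = 0`. -/
theorem fderiv_smul_fderiv_symm_iff {k h : ℂ → ℝ} {η : ℂ → ℂ →L[ℝ] ℝ} {q : ℂ}
    (hk : DifferentiableAt ℝ k q) (hh : ContDiffAt ℝ ∞ h q)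
    (hη : η =ᶠ[𝓝 q] fun z => k z • fderiv ℝ h z) (u v : ℂ) :
    fderiv ℝ η q u v = fderiv ℝ η q v u ↔
      fderiv ℝ k q u * fderiv ℝ h q v = fderiv ℝ k q v * fderiv ℝ h q u := by
  rw [fderiv_smul_fderiv hk hh hη, fderiv_smul_fderiv hk hh hη,
    (hh.isSymmSndFDerivAt (by simpa using two_le_infty)) u v]
  constructor <;> intro h <;> linarith

/-- The first integrals of the four foliations. -/
def integrals (S T : ℂ → ℝ) : Fin 4 → ℂ → ℝ :=
  ![fun z => T z - S z, fun z => T z + S z, T, S]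

/-- The three components, with respect to the relations
`dh₀ - dT + dS`, `dh₁ - dT - dS`, `2 h₀ dh₀ + 2 h₁ dh₁ - 4 T dT - 4 S dS` between the first integrals
`h₀ = T - S`, `h₁ = T + S`, `T`, `S`, of the coefficient of the `i`-th form, as functions of the
value `t` of the `i`-th first integral. -/
def relationCoeff : Fin 4 → ℝ → Fin 3 → ℝ :=
  ![fun t => ![1, 0, 2 * t], fun t => ![0, 1, 2 * t], fun t => ![-1, -1, -4 * t],
    fun t => ![1, -1, -4 * t]]

namespace IsParallelCoords
variable {V : Set ℂ} {L₁ L₂ N₁ N₂ : DirField} {S T : ℂ → ℝ}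

theorem contDiffAt_left (h : IsParallelCoords V L₁ L₂ N₁ N₂ S T) (hV : IsOpen V) {q : ℂ}
    (hq : q ∈ V) : ContDiffAt ℝ ∞ S q := h.contDiff_left.contDiffAt (hV.mem_nhds hq)

theorem contDiffAt_right (h : IsParallelCoords V L₁ L₂ N₁ N₂ S T) (hV : IsOpen V) {q : ℂ}
    (hq : q ∈ V) : ContDiffAt ℝ ∞ T q := h.contDiff_right.contDiffAt (hV.mem_nhds hq)

theorem contDiffAt_integrals (h : IsParallelCoords V L₁ L₂ N₁ N₂ S T) (hV : IsOpen V) {q : ℂ}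
    (hq : q ∈ V) (i : Fin 4) : ContDiffAt ℝ ∞ (integrals S T i) q := by
  have h1 := h.contDiffAt_left hV hq
  have h2 := h.contDiffAt_right hV hq
  fin_cases i
  · exact h2.sub h1
  · exact h2.add h1
  · exact h2
  · exact h1

theorem fderiv_integrals (h : IsParallelCoords V L₁ L₂ N₁ N₂ S T) (hV : IsOpen V) {q : ℂ}
    (hq : q ∈ V) (i : Fin 4) :
    fderiv ℝ (integrals S T i) q =
      (![fderiv ℝ T q - fderiv ℝ S q, fderiv ℝ T q + fderiv ℝ S q, fderiv ℝ T q, fderiv ℝ S q] :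
        Fin 4 → ℂ →L[ℝ] ℝ) i := by
  have h1 := (h.contDiffAt_left hV hq).differentiableAt (by simp)
  have h2 := (h.contDiffAt_right hV hq).differentiableAt (by simp)
  fin_cases i
  · exact fderiv_fun_sub h2 h1
  · exact fderiv_fun_add h2 h1
  · rfl
  · rfl

theorem mem_iff (h : IsParallelCoords V L₁ L₂ N₁ N₂ S T) (hV : IsOpen V) {q : ℂ} (hq : q ∈ V)
    (i : Fin 4) (u : ℂ) :
    u ∈ (![L₁, L₂, N₁, N₂] : Fin 4 → DirField) i q ↔ fderiv ℝ (integrals S T i) q u = 0 := by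
  rw [h.fderiv_integrals hV hq]
  fin_cases i
  · simpa [sub_eq_zero] using h.mem_L₁ q hq u
  · simpa [eq_neg_iff_add_eq_zero] using h.mem_L₂ q hq u
  · exact h.mem_N₁ q hq u
  · exact h.mem_N₂ q hq u

/-- The vector fields dual to `dS` and `dT`. -/
theorem exists_dual_frame (h : IsParallelCoords V L₁ L₂ N₁ N₂ S T) (hV : IsOpen V) :
    ∃ eS eT : ℂ → ℂ, (∀ q ∈ V, ContDiffAt ℝ ∞ eS q ∧ ContDiffAt ℝ ∞ eT q) ∧
      ∀ q ∈ V, fderiv ℝ S q (eS q) = 1 ∧ fderiv ℝ T q (eS q) = 0 ∧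
        fderiv ℝ S q (eT q) = 0 ∧ fderiv ℝ T q (eT q) = 1 := by
  set J : ℂ → ℝ := fun q => fderiv ℝ S q 1 * fderiv ℝ T q I - fderiv ℝ S q I * fderiv ℝ T q 1
  have hJ : ∀ q ∈ V, J q ≠ 0 := by
    intro q hq h0
    have key : ∀ l : ℂ →L[ℝ] ℝ, ∀ a b : ℝ, l (a + b * I) = a * l 1 + b * l I := fun l a b => by
      have : (a + b * I : ℂ) = a • (1 : ℂ) + b • I := by simp
      rw [this, map_add, map_smul, map_smul, smul_eq_mul, smul_eq_mul]
    have zero : ∀ a b : ℝ, (a + b * I : ℂ) = 0 → a = 0 ∧ b = 0 := fun a b hab =>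
      ⟨by simpa using congrArg re hab, by simpa using congrArg im hab⟩
    simp only [J] at h0
    have z1 := zero _ _ (h.indep q hq ((fderiv ℝ T q I : ℝ) + ((-fderiv ℝ T q 1 : ℝ) : ℂ) * I)
      (by rw [key]; linarith) (by rw [key]; ring))
    have z2 := zero _ _ (h.indep q hq ((fderiv ℝ S q I : ℝ) + ((-fderiv ℝ S q 1 : ℝ) : ℂ) * I)
      (by rw [key]; ring) (by rw [key]; linarith))
    exact one_ne_zero (h.indep q hq 1 (by linarith [z2.2]) (by linarith [z1.2]))
  have c : ∀ (R : ℂ → ℝ), (∀ q ∈ V, ContDiffAt ℝ ∞ R q) → ∀ x : ℂ, ∀ q ∈ V,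
      ContDiffAt ℝ ∞ (fun z => fderiv ℝ R z x) q := fun R hR x q hq =>
    ((hR q hq).fderiv_right (m := ∞) (by simp)).clm_apply contDiffAt_const
  have cS := c S fun q hq => h.contDiffAt_left hV hq
  have cT := c T fun q hq => h.contDiffAt_right hV hq
  have cJ : ∀ q ∈ V, ContDiffAt ℝ ∞ (fun z => (J z)⁻¹) q := fun q hq =>
    (((cS 1 q hq).mul (cT I q hq)).sub ((cS I q hq).mul (cT 1 q hq))).inv (hJ q hq)
  refine ⟨fun q => (J q)⁻¹ • (fderiv ℝ T q I • (1 : ℂ) - fderiv ℝ T q 1 • I),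
    fun q => (J q)⁻¹ • (fderiv ℝ S q 1 • I - fderiv ℝ S q I • (1 : ℂ)), fun q hq => ⟨?_, ?_⟩,
    fun q hq => ?_⟩
  · exact (cJ q hq).smul (((cT I q hq).smul contDiffAt_const).sub
      ((cT 1 q hq).smul contDiffAt_const))
  · exact (cJ q hq).smul (((cS 1 q hq).smul contDiffAt_const).sub
      ((cS I q hq).smul contDiffAt_const))
  · have := hJ q hq
    simp only [map_smul, map_sub, smul_eq_mul]
    refine ⟨?_, ?_, ?_, ?_⟩
    · rw [inv_mul_eq_one₀ this]; simp only [J]; ring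
    · ring
    · ring
    · rw [inv_mul_eq_one₀ this]

open scoped Classical in
/-- The relation with components `a` with respect to the three standard relations. -/
noncomputable def relation (V : Set ℂ) (S T : ℂ → ℝ) (a : Fin 3 → ℝ) :
    Fin 4 → ℂ → (ℂ →L[ℝ] ℝ) := fun i z =>
  if z ∈ V then (a ⬝ᵥ relationCoeff i (integrals S T i z)) • fderiv ℝ (integrals S T i) z else 0

theorem relation_of_mem {a : Fin 3 → ℝ} {i : Fin 4} {z : ℂ} (hz : z ∈ V) :
    relation V S T a i z =
      (a ⬝ᵥ relationCoeff i (integrals S T i z)) • fderiv ℝ (integrals S T i) z := if_pos hz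

/-- The coefficients of the standard relations are affine functions of the first integrals. -/
theorem dotProduct_relationCoeff (a : Fin 3 → ℝ) (i : Fin 4) (t : ℝ) :
    a ⬝ᵥ relationCoeff i t = a ⬝ᵥ relationCoeff i 0 +
      (![2, 2, -4, -4] : Fin 4 → ℝ) i * a 2 * t := by
  fin_cases i <;> simp [relationCoeff, dotProduct, Fin.sum_univ_three] <;> ring

theorem relation_mem (h : IsParallelCoords V L₁ L₂ N₁ N₂ S T) (hV : IsOpen V) (a : Fin 3 → ℝ) :
    relation V S T a ∈ abelianRelations ![L₁, L₂, N₁, N₂] V := by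
  have hev : ∀ i, ∀ q ∈ V, relation V S T a i =ᶠ[𝓝 q] fun z =>
      (a ⬝ᵥ relationCoeff i (integrals S T i z)) • fderiv ℝ (integrals S T i) z :=
    fun i q hq => by
      filter_upwards [hV.mem_nhds hq] with z hz using relation_of_mem hz
  have hk : ∀ i, ∀ q ∈ V, HasFDerivAt (fun z => a ⬝ᵥ relationCoeff i (integrals S T i z))
      (((![2, 2, -4, -4] : Fin 4 → ℝ) i * a 2) • fderiv ℝ (integrals S T i) q) q := by
    intro i q hq
    have h1 := ((h.contDiffAt_integrals hV hq i).differentiableAt (by simp)).hasFDerivAt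
    simp_rw [dotProduct_relationCoeff a i (integrals S T i _)]
    exact (h1.const_mul _).const_add _
  have hkc : ∀ i, ∀ q ∈ V,
      ContDiffAt ℝ ∞ (fun z => a ⬝ᵥ relationCoeff i (integrals S T i z)) q := by
    intro i q hq
    simp_rw [dotProduct_relationCoeff a i (integrals S T i _)]
    exact contDiffAt_const.add (contDiffAt_const.mul (h.contDiffAt_integrals hV hq i))
  refine ⟨fun i q hq => ?_, fun i q hq u v => ?_, fun i q hq u hu => ?_, fun q hq => ?_,
    fun i q hq => if_neg hq⟩
  · exact ((hkc i q hq).smul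
      ((h.contDiffAt_integrals hV hq i).fderiv_right (m := ∞) (by simp))).congr_of_eventuallyEq
      (hev i q hq)
  · rw [fderiv_smul_fderiv_symm_iff (hk i q hq).differentiableAt (h.contDiffAt_integrals hV hq i)
      (hev i q hq), (hk i q hq).fderiv]
    simp
    ring
  · rw [relation_of_mem hq, smul_apply, (h.mem_iff hV hq i u).1 hu, smul_zero]
  · simp_rw [relation_of_mem hq, h.fderiv_integrals hV hq]
    ext u
    simp [Fin.sum_univ_four, relationCoeff, integrals, dotProduct, Fin.sum_univ_three]
    ring

/-- Every Abelian relation is a combination of the three standard ones. -/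
theorem exists_eq_relation (h : IsParallelCoords V L₁ L₂ N₁ N₂ S T) (hV : IsOpen V)
    (hc : IsPreconnected V) {η : Fin 4 → ℂ → (ℂ →L[ℝ] ℝ)}
    (hη : η ∈ abelianRelations ![L₁, L₂, N₁, N₂] V) : ∃ a, relation V S T a = η := by
  obtain ⟨hsm, hcl, hvan, hsum, hzero⟩ := hη
  obtain ⟨eS, eT, hec, hdual⟩ := h.exists_dual_frame hV
  set H := integrals S T
  have hHc : ∀ i, ∀ q ∈ V, ContDiffAt ℝ ∞ (H i) q := fun i q hq => h.contDiffAt_integrals hV hq i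
  set E : Fin 4 → ℂ → ℂ := ![eT, eT, eT, eS]
  have hEc : ∀ i, ∀ q ∈ V, ContDiffAt ℝ ∞ (E i) q := by
    intro i q hq
    fin_cases i
    · exact (hec q hq).2
    · exact (hec q hq).2
    · exact (hec q hq).2
    · exact (hec q hq).1
  have hHE : ∀ i, ∀ q ∈ V, fderiv ℝ (H i) q (E i q) = 1 := by
    intro i q hq
    obtain ⟨d1, d2, d3, d4⟩ := hdual q hq
    rw [h.fderiv_integrals hV hq]
    fin_cases i <;> simp [E, d1, d3, d4]
  -- `K i` is the coefficient of the `i`-th form with respect to the differential of `H i`.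
  set K : Fin 4 → ℂ → ℝ := fun i q => η i q (E i q)
  have hKc : ∀ i, ∀ q ∈ V, ContDiffAt ℝ ∞ (K i) q := fun i q hq =>
    (hsm i q hq).clm_apply (hEc i q hq)
  have hηK : ∀ i, ∀ q ∈ V, η i q = K i q • fderiv ℝ (H i) q := by
    intro i q hq
    ext u
    have h1 : u - fderiv ℝ (H i) q u • E i q ∈ (![L₁, L₂, N₁, N₂] : Fin 4 → DirField) i q := by
      rw [h.mem_iff hV hq, map_sub, map_smul, hHE i q hq]; simp [H]
    have h2 := hvan i q hq _ h1
    rw [map_sub, map_smul, sub_eq_zero] at h2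
    rw [h2, smul_apply, smul_eq_mul, smul_eq_mul, mul_comm]
  have hdK : ∀ i, ∀ q ∈ V, ∀ u,
      fderiv ℝ (K i) q u = fderiv ℝ (K i) q (E i q) * fderiv ℝ (H i) q u := by
    intro i q hq u
    have hev : η i =ᶠ[𝓝 q] fun z => K i z • fderiv ℝ (H i) z := by
      filter_upwards [hV.mem_nhds hq] with z hz using hηK i z hz
    have := (fderiv_smul_fderiv_symm_iff ((hKc i q hq).differentiableAt (by simp)) (hHc i q hq) hev
      u (E i q)).1 (hcl i q hq u (E i q))
    rw [hHE i q hq, mul_one] at this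
    exact this
  have hrel : ∀ q ∈ V, K 2 q = -(K 0 q + K 1 q) ∧ K 3 q = K 0 q - K 1 q := by
    intro q hq
    obtain ⟨d1, d2, d3, d4⟩ := hdual q hq
    have hs := hsum q hq
    rw [Fin.sum_univ_four, hηK 0 q hq, hηK 1 q hq, hηK 2 q hq, hηK 3 q hq] at hs
    simp only [H, h.fderiv_integrals hV hq] at hs
    have a1 := DFunLike.congr_fun hs (eT q)
    have a2 := DFunLike.congr_fun hs (eS q)
    simp [d1, d2, d3, d4] at a1 a2
    exact ⟨by linarith, by linarith⟩
  have hdiff : ∀ i, ∀ q ∈ V, DifferentiableAt ℝ (K i) q := fun i q hq =>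
    (hKc i q hq).differentiableAt (by simp)
  -- `A i` is the derivative of `K i` as a function of `H i`. `A 0` and `A 1` are equal, since
  -- `K 2 = -(K 0 + K 1)` has vanishing derivative along the level curves of `T`.
  set A : Fin 4 → ℂ → ℝ := fun i q => fderiv ℝ (K i) q (E i q)
  have hA01 : ∀ q ∈ V, A 0 q = A 1 q := by
    intro q hq
    obtain ⟨d1, d2, d3, d4⟩ := hdual q hq
    have hev : K 2 =ᶠ[𝓝 q] fun z => -(K 0 z + K 1 z) := by
      filter_upwards [hV.mem_nhds hq] with z hz using (hrel z hz).1
    have hd : HasFDerivAt (fun z => -(K 0 z + K 1 z)) _ q :=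
      ((hdiff 0 q hq).hasFDerivAt.add (hdiff 1 q hq).hasFDerivAt).neg
    have e := hdK 2 q hq (eS q)
    rw [hev.fderiv_eq, hd.fderiv] at e
    have e0 := hdK 0 q hq (eS q)
    have e1 := hdK 1 q hq (eS q)
    simp only [H, h.fderiv_integrals hV hq] at e e0 e1
    simp [d1, d2] at e e0 e1
    simp only [A]
    linarith
  have hAc : ∀ i, ∀ q ∈ V, DifferentiableAt ℝ (A i) q := fun i q hq =>
    (((hKc i q hq).fderiv_right (m := ∞) (by simp)).clm_apply (hEc i q hq)).differentiableAt
      (by simp)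
  have hsymA : ∀ i, ∀ q ∈ V, ∀ u v, fderiv ℝ (A i) q u * fderiv ℝ (H i) q v =
      fderiv ℝ (A i) q v * fderiv ℝ (H i) q u := by
    intro i q hq u v
    have hev : fderiv ℝ (K i) =ᶠ[𝓝 q] fun z => A i z • fderiv ℝ (H i) z := by
      filter_upwards [hV.mem_nhds hq] with z hz
      ext x
      exact hdK i z hz x
    exact (fderiv_smul_fderiv_symm_iff (hAc i q hq) (hHc i q hq) hev u v).1
      (((hKc i q hq).isSymmSndFDerivAt (by simpa using two_le_infty)) u v)
  -- `A 0 = A 1` is a function of `T - S` and also of `T + S`.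
  have hA0 : ∀ q ∈ V, fderiv ℝ (A 0) q = 0 := by
    intro q hq
    obtain ⟨d1, d2, d3, d4⟩ := hdual q hq
    have hev : A 0 =ᶠ[𝓝 q] A 1 := by
      filter_upwards [hV.mem_nhds hq] with z hz using hA01 z hz
    have s0 := hsymA 0 q hq
    have s1 := hsymA 1 q hq
    rw [← hev.fderiv_eq] at s1
    simp only [H, h.fderiv_integrals hV hq] at s0 s1
    simp at s0 s1
    have a0 := s0 (eS q) (eT q)
    have a1 := s1 (eS q) (eT q)
    simp only [d1, d2, d3, d4] at a0 a1
    have b1 : fderiv ℝ (A 0) q (eT q) = 0 := by linarith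
    ext u
    have b2 := s0 u (eT q)
    simp only [d3, d4, b1] at b2
    simpa using b2
  obtain ⟨c, hcA⟩ := hV.exists_is_const_of_fderiv_eq_zero hc
    (fun q hq => (hAc 0 q hq).differentiableWithinAt) (fun q hq => hA0 q hq)
  have hconst : ∀ i : Fin 4, (∀ q ∈ V, A i q = c) → ∃ a, ∀ q ∈ V, K i q = c * H i q + a := by
    intro i hAi
    have hHd : ∀ q ∈ V, HasFDerivAt (fun z => c * H i z) (c • fderiv ℝ (H i) q) q := fun q hq =>
      (((hHc i q hq).differentiableAt (by simp)).hasFDerivAt).const_mul c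
    obtain ⟨a, ha⟩ := hV.exists_eq_add_of_fderiv_eq hc
      (fun q hq => (hdiff i q hq).differentiableWithinAt)
      (fun q hq => (hHd q hq).differentiableAt.differentiableWithinAt)
      (fun q hq => by
        rw [(hHd q hq).fderiv]
        ext u
        rw [hdK i q hq u, smul_apply, smul_eq_mul]
        congr 1
        exact hAi q hq)
    exact ⟨a, ha⟩
  obtain ⟨a, ha⟩ := hconst 0 hcA
  obtain ⟨b, hb⟩ := hconst 1 (fun q hq => by rw [← hA01 q hq, hcA q hq])
  refine ⟨![a, b, c / 2], ?_⟩
  funext i q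
  by_cases hq : q ∈ V
  · rw [relation_of_mem hq, hηK i q hq]
    congr 1
    have k0 := ha q hq
    have k1 := hb q hq
    obtain ⟨k2, k3⟩ := hrel q hq
    rw [k0, k1] at k2 k3
    fin_cases i
    · change _ = K 0 q
      rw [k0]; simp [relationCoeff, H]; ring
    · change _ = K 1 q
      rw [k1]; simp [relationCoeff, H]; ring
    · change _ = K 2 q
      rw [k2]; simp [relationCoeff, H, integrals]; ring
    · change _ = K 3 q
      rw [k3]; simp [relationCoeff, H, integrals]; ring
  · rw [hzero i q hq]
    exact if_neg hq

theorem fderiv_integrals_ne_zero (h : IsParallelCoords V L₁ L₂ N₁ N₂ S T) (hV : IsOpen V) {q : ℂ}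
    (hq : q ∈ V) (i : Fin 4) : ∃ u, fderiv ℝ (integrals S T i) q u = 1 := by
  obtain ⟨eS, eT, -, hdual⟩ := h.exists_dual_frame hV
  obtain ⟨d1, d2, d3, d4⟩ := hdual q hq
  rw [h.fderiv_integrals hV hq]
  fin_cases i
  · exact ⟨eT q, by simp [d3, d4]⟩
  · exact ⟨eT q, by simp [d3, d4]⟩
  · exact ⟨eT q, by simp [d4]⟩
  · exact ⟨eS q, by simp [d1]⟩

/-- A first integral is not constant. -/
theorem infinite_image (h : IsParallelCoords V L₁ L₂ N₁ N₂ S T) (hV : IsOpen V)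
    (hc : IsPreconnected V) (hne : V.Nonempty) (i : Fin 4) :
    (integrals S T i '' V).Infinite := by
  have hcont : ContinuousOn (integrals S T i) V := fun q hq =>
    (h.contDiffAt_integrals hV hq i).continuousAt.continuousWithinAt
  refine (hc.image _ hcont).infinite_of_nontrivial ?_
  rw [← Set.not_subsingleton_iff]
  intro hs
  obtain ⟨q, hq⟩ := hne
  obtain ⟨u, hu⟩ := h.fderiv_integrals_ne_zero hV hq i
  have hev : integrals S T i =ᶠ[𝓝 q] fun _ => integrals S T i q := by
    filter_upwards [hV.mem_nhds hq] with z hz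
      using hs (Set.mem_image_of_mem _ hz) (Set.mem_image_of_mem _ hq)
  rw [hev.fderiv_eq, fderiv_fun_const] at hu
  simp at hu

theorem relation_injective (h : IsParallelCoords V L₁ L₂ N₁ N₂ S T) (hV : IsOpen V)
    (hc : IsPreconnected V) (hne : V.Nonempty) {a : Fin 3 → ℝ} (ha : relation V S T a = 0) :
    a = 0 := by
  have key : ∀ i, ∀ q ∈ V, a ⬝ᵥ relationCoeff i (integrals S T i q) = 0 := by
    intro i q hq
    obtain ⟨u, hu⟩ := h.fderiv_integrals_ne_zero hV hq i
    have := congrFun (congrFun ha i) q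
    rw [relation_of_mem hq] at this
    have := DFunLike.congr_fun this u
    rw [smul_apply, hu, smul_eq_mul, mul_one] at this
    exact this
  obtain ⟨x, ⟨q, hq, rfl⟩, y, ⟨r, hr, rfl⟩, hxy⟩ := (h.infinite_image hV hc hne 0).nontrivial
  have k1 := key 0 q hq
  have k2 := key 0 r hr
  have k3 := key 1 q hq
  rw [dotProduct_relationCoeff] at k1 k2 k3
  simp only [relationCoeff] at k1 k2 k3
  simp at k1 k2 k3
  have h2 : a 2 = 0 := by
    have : a 2 * (integrals S T 0 q - integrals S T 0 r) = 0 := by linarith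
    exact (mul_eq_zero.1 this).resolve_right (sub_ne_zero.2 hxy)
  rw [h2] at k1 k3
  funext j
  fin_cases j
  · simpa [Matrix.vecHead] using k1
  · simpa [Matrix.vecHead, Matrix.vecTail] using k3
  · exact h2

/-- The Abelian relations on a connected open set with straightening coordinates. -/
noncomputable def relationEquiv (h : IsParallelCoords V L₁ L₂ N₁ N₂ S T) (hV : IsOpen V)
    (hc : IsPreconnected V) (hne : V.Nonempty) :
    (Fin 3 → ℝ) ≃ₗ[ℝ] abelianRelations ![L₁, L₂, N₁, N₂] V :=
  LinearEquiv.ofBijective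
    { toFun := fun a => ⟨relation V S T a, h.relation_mem hV a⟩
      map_add' := fun a b => by
        ext i z
        by_cases hz : z ∈ V <;> simp [relation, hz, add_dotProduct, add_mul]
      map_smul' := fun r a => by
        ext i z
        by_cases hz : z ∈ V <;> simp [relation, hz, mul_assoc] }
    ⟨(injective_iff_map_eq_zero _).2 fun a ha =>
        h.relation_injective hV hc hne (congrArg Subtype.val ha),
      fun η => by
        obtain ⟨a, ha⟩ := h.exists_eq_relation hV hc η.2
        exact ⟨a, Subtype.ext ha⟩⟩

end IsParallelCoords

/-! ### Linear factors of ternary forms -/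

theorem eval_linForm (m x : Fin 3 → ℝ) : MvPolynomial.eval x (linForm m) = m ⬝ᵥ x := by
  simp [linForm, dotProduct]

theorem linForm_ne_zero {m : Fin 3 → ℝ} (hm : m ≠ 0) : linForm m ≠ 0 := fun h => hm <| by
  have := eval_linForm m m
  rw [h, map_zero] at this
  exact dotProduct_self_eq_zero.1 this.symm

theorem isHomogeneous_linForm (m : Fin 3 → ℝ) : (linForm m).IsHomogeneous 1 :=
  MvPolynomial.IsHomogeneous.sum _ _ _ fun j _ => by
    simpa using (MvPolynomial.isHomogeneous_C (Fin 3) (m j)).mul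
      (MvPolynomial.isHomogeneous_X ℝ j)

/-- A polynomial is divisible by a linear form if it vanishes on the plane of the form. -/
theorem linForm_dvd_iff {m : Fin 3 → ℝ} (hm : m ≠ 0) {P : MvPolynomial (Fin 3) ℝ} :
    linForm m ∣ P ↔ ∀ x, m ⬝ᵥ x = 0 → MvPolynomial.eval x P = 0 := by
  constructor
  · rintro ⟨Q, rfl⟩ x hx
    rw [map_mul, eval_linForm, hx, zero_mul]
  · intro h
    obtain ⟨j, hj⟩ : ∃ j, m j ≠ 0 := by
      by_contra! h0
      exact hm (funext h0)
    -- `MvPolynomial.bind₁ g` is the projection onto the plane of `m` along the `j`-th coordinate.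
    set r : Fin 3 → ℝ := Pi.single j (m j)⁻¹
    set g : Fin 3 → MvPolynomial (Fin 3) ℝ := fun k =>
      MvPolynomial.X k - MvPolynomial.C (r k) * linForm m
    have hcongr : ∀ Q, linForm m ∣ Q - MvPolynomial.bind₁ g Q := fun Q => by
      induction Q using MvPolynomial.induction_on with
      | C a => simp
      | add p q hp hq =>
        rw [map_add, add_sub_add_comm]
        exact dvd_add hp hq
      | mul_X p k hp =>
        have : p * MvPolynomial.X k - MvPolynomial.bind₁ g (p * MvPolynomial.X k) =
            (p - MvPolynomial.bind₁ g p) * MvPolynomial.X k +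
              MvPolynomial.bind₁ g p * MvPolynomial.C (r k) * linForm m := by
          rw [map_mul, MvPolynomial.bind₁_X_right]
          simp only [g]
          ring
        rw [this]
        exact dvd_add (hp.mul_right _) (dvd_mul_left _ _)
    have hzero : MvPolynomial.bind₁ g P = 0 := MvPolynomial.funext fun x => by
      have h2 : ∀ k, MvPolynomial.eval x (g k) = (x - (m ⬝ᵥ x) • r) k := fun k => by
        simp [g, eval_linForm, mul_comm]
      have h1 : MvPolynomial.eval x (MvPolynomial.bind₁ g P) =
          MvPolynomial.eval (x - (m ⬝ᵥ x) • r) P :=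
        (MvPolynomial.aeval_bind₁ (R := ℝ) x g P).trans (by
          rw [← funext h2]; rfl)
      rw [map_zero, h1]
      refine h (x - (m ⬝ᵥ x) • r) ?_
      rw [dotProduct_sub, dotProduct_smul, dotProduct_single, mul_inv_cancel₀ hj, smul_eq_mul,
        mul_one, sub_self]
    have := hcongr P
    rwa [hzero, sub_zero] at this

theorem irreducible_linForm {m : Fin 3 → ℝ} (hm : m ≠ 0) : Irreducible (linForm m) := by
  have hl := linForm_ne_zero hm
  have hdeg : ∀ Q : MvPolynomial (Fin 3) ℝ, Q ≠ 0 → Q.totalDegree = 0 → IsUnit Q := by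
    intro Q hQ h0
    rw [MvPolynomial.totalDegree_eq_zero_iff_eq_C] at h0
    rw [h0] at hQ ⊢
    exact (IsUnit.mk0 _ fun h => hQ (by rw [h, map_zero])).map MvPolynomial.C
  refine ⟨fun hu => ?_, fun A B hAB => ?_⟩
  · obtain ⟨c, -, hc⟩ := MvPolynomial.isUnit_iff_eq_C_of_isReduced.1 hu
    have h1 := (isHomogeneous_linForm m).totalDegree hl
    rw [hc, MvPolynomial.totalDegree_C] at h1
    exact zero_ne_one h1
  · have hA : A ≠ 0 := by rintro rfl; exact hl (by rw [hAB, zero_mul])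
    have hB : B ≠ 0 := by rintro rfl; exact hl (by rw [hAB, mul_zero])
    have h1 := (isHomogeneous_linForm m).totalDegree hl
    rw [hAB, MvPolynomial.totalDegree_mul_of_isDomain hA hB] at h1
    rcases Nat.eq_zero_or_pos A.totalDegree with h | h
    · exact Or.inl (hdeg A hA h)
    · exact Or.inr (hdeg B hB (by omega))

/-- A quartic form that vanishes on four distinct planes is the product of their equations. -/
theorem eq_C_mul_prod_linForm {m : Fin 4 → Fin 3 → ℝ}
    (hm : ∀ i j, i ≠ j → ∃ x, m i ⬝ᵥ x = 0 ∧ m j ⬝ᵥ x ≠ 0) {P : MvPolynomial (Fin 3) ℝ}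
    (hP0 : P ≠ 0) (hP : P.IsHomogeneous 4)
    (h : ∀ i, ∀ x, m i ⬝ᵥ x = 0 → MvPolynomial.eval x P = 0) :
    ∃ c : ℝ, c ≠ 0 ∧ P = MvPolynomial.C c * ∏ i, linForm (m i) := by
  have hm0 : ∀ j, m j ≠ 0 := fun j h0 => by
    obtain ⟨i, hi⟩ := exists_ne j
    obtain ⟨x, -, hx⟩ := hm i j hi
    exact hx (by rw [h0, zero_dotProduct])
  obtain ⟨Q, hQ⟩ : ∏ i, linForm (m i) ∣ P := by
    refine Finset.prod_dvd_of_isRelPrime (fun i _ j _ hij => ?_)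
      fun i _ => (linForm_dvd_iff (hm0 i)).2 (h i)
    refine (irreducible_linForm (hm0 i)).isRelPrime_iff_not_dvd.2 fun hd => ?_
    obtain ⟨x, hx, hx'⟩ := hm i j hij
    exact hx' (by rw [← eval_linForm]; exact (linForm_dvd_iff (hm0 i)).1 hd x hx)
  have hprod0 : ∏ i, linForm (m i) ≠ 0 :=
    Finset.prod_ne_zero_iff.2 fun i _ => linForm_ne_zero (hm0 i)
  have hQ0 : Q ≠ 0 := by rintro rfl; exact hP0 (by rw [hQ, mul_zero])
  have hdeg : (∏ i, linForm (m i)).totalDegree = 4 := by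
    have := MvPolynomial.IsHomogeneous.prod Finset.univ (fun i => linForm (m i)) (fun _ => 1)
      fun i _ => isHomogeneous_linForm (m i)
    simpa using this.totalDegree hprod0
  have h4 := hP.totalDegree hP0
  rw [hQ, MvPolynomial.totalDegree_mul_of_isDomain hprod0 hQ0, hdeg] at h4
  have hQC := MvPolynomial.totalDegree_eq_zero_iff_eq_C.1 (by omega : Q.totalDegree = 0)
  refine ⟨Q.coeff 0, fun h0 => hQ0 (by rw [hQC, h0, map_zero]), ?_⟩
  rw [mul_comm, ← hQC]
  exact hQ

theorem eval_smul_of_isHomogeneous {P : MvPolynomial (Fin 3) ℝ} {n : ℕ} (hP : P.IsHomogeneous n)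
    (a : ℝ) (x : Fin 3 → ℝ) : MvPolynomial.eval (a • x) P = a ^ n * MvPolynomial.eval x P := by
  rw [MvPolynomial.eval_eq', MvPolynomial.eval_eq', Finset.mul_sum]
  refine Finset.sum_congr rfl fun d hd => ?_
  have h1 : ∑ i, d i = n := by
    rw [← hP (MvPolynomial.mem_support_iff.1 hd), Finsupp.weight_apply]
    simp [Finsupp.sum_fintype]
  simp only [Pi.smul_apply, smul_eq_mul, mul_pow, Finset.prod_mul_distrib, Finset.prod_pow_eq_pow_sum,
    h1]
  ring

/-- A form that vanishes at the points `y + t • z` for infinitely many `t` vanishes on the span of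
`y` and `z`. -/
theorem eval_eq_zero_of_infinite {P : MvPolynomial (Fin 3) ℝ} {n : ℕ} (hP : P.IsHomogeneous n)
    {y z : Fin 3 → ℝ} {s : Set ℝ} (hs : s.Infinite)
    (h : ∀ t ∈ s, MvPolynomial.eval (y + t • z) P = 0) (a b : ℝ) :
    MvPolynomial.eval (a • y + b • z) P = 0 := by
  have hline : ∀ y z : Fin 3 → ℝ, ∀ s : Set ℝ, s.Infinite →
      (∀ t ∈ s, MvPolynomial.eval (y + t • z) P = 0) →
      ∀ t : ℝ, MvPolynomial.eval (y + t • z) P = 0 := by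
    intro y z s hs h
    set g : Polynomial ℝ := MvPolynomial.aeval
      (fun k => Polynomial.C (y k) + Polynomial.X * Polynomial.C (z k)) P
    have hg : ∀ t, g.eval t = MvPolynomial.eval (y + t • z) P := fun t => by
      change ((Polynomial.aeval t : Polynomial ℝ →ₐ[ℝ] ℝ).comp (MvPolynomial.aeval _)) P =
        (MvPolynomial.aeval (y + t • z) : MvPolynomial (Fin 3) ℝ →ₐ[ℝ] ℝ) P
      congr 1
      refine MvPolynomial.algHom_ext fun k => ?_
      rw [AlgHom.comp_apply, MvPolynomial.aeval_X, MvPolynomial.aeval_X]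
      simp
      ring
    have hg0 : g = 0 := Polynomial.eq_zero_of_infinite_isRoot g
      (hs.mono fun t ht => by
        change g.eval t = 0
        rw [hg, h t ht])
    intro t
    rw [← hg, hg0, Polynomial.eval_zero]
  have h1 := hline y z s hs h
  have hne : ∀ a : ℝ, a ≠ 0 → ∀ b : ℝ, MvPolynomial.eval (a • y + b • z) P = 0 := fun a ha b => by
    have : a • y + b • z = a • (y + (b / a) • z) := by
      rw [smul_add, smul_smul, mul_div_cancel₀ _ ha]
    rw [this, eval_smul_of_isHomogeneous hP, h1, mul_zero]
  rcases eq_or_ne a 0 with rfl | ha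
  · have := hline (b • z) y {t | t ≠ 0} (Set.infinite_of_finite_compl (by simp [Set.compl_def]))
      (fun t ht => by rw [add_comm]; exact hne t ht b) 0
    rw [add_comm]
    exact this
  · exact hne a ha b

/-! ### Rank and rank quartic -/

/-- The lines that contain the four arcs in the coordinates given by the standard relations. -/
def standardLine : Fin 4 → Fin 3 → ℝ := ![![0, 1, 0], ![1, 0, 0], ![1, -1, 0], ![1, 1, 0]]

theorem relationCoeff_eq (i : Fin 4) (t : ℝ) :
    relationCoeff i t = relationCoeff i 0 +
      ((![2, 2, -4, -4] : Fin 4 → ℝ) i * t) • (![0, 0, 1] : Fin 3 → ℝ) := by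
  funext j
  fin_cases i <;> fin_cases j <;> simp [relationCoeff]

theorem standardLine_dotProduct_relationCoeff (i : Fin 4) (t : ℝ) :
    standardLine i ⬝ᵥ relationCoeff i t = 0 := by
  fin_cases i <;> simp [relationCoeff, standardLine]

theorem exists_eq_of_standardLine_dotProduct {i : Fin 4} {x : Fin 3 → ℝ}
    (h : standardLine i ⬝ᵥ x = 0) :
    ∃ a b : ℝ, x = a • relationCoeff i 0 + b • (![0, 0, 1] : Fin 3 → ℝ) := by
  rw [dotProduct, Fin.sum_univ_three] at h
  fin_cases i <;> simp [standardLine] at h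
  · exact ⟨x 0, x 2, by funext j; fin_cases j <;> simp [relationCoeff, h]⟩
  · exact ⟨x 1, x 2, by funext j; fin_cases j <;> simp [relationCoeff, h]⟩
  · exact ⟨-x 0, x 2, by funext j; fin_cases j <;> simp [relationCoeff]; linarith⟩
  · exact ⟨x 0, x 2, by funext j; fin_cases j <;> simp [relationCoeff]; linarith⟩

theorem standardLine_dotProduct_ne_zero {i j : Fin 4} (hij : i ≠ j) :
    standardLine j ⬝ᵥ relationCoeff i 0 ≠ 0 := by
  fin_cases i <;> fin_cases j <;> simp [relationCoeff, standardLine] at hij ⊢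

theorem isHarmonicQuadruple_vecMul_standardLine {A : Matrix (Fin 3) (Fin 3) ℝ} (hA : IsUnit A) :
    IsHarmonicQuadruple fun i => Matrix.vecMul (standardLine i) A⁻¹ := by
  have hdet : IsUnit A.det := (Matrix.isUnit_iff_isUnit_det A).1 hA
  refine ⟨⟨A.mulVec ![0, 0, 1], fun h0 => ?_, fun i => ?_⟩, ?_, -1, 1, 1, 1, by norm_num,
    by norm_num, by norm_num, by norm_num, ?_, ?_, by norm_num⟩
  · have := congrArg (A⁻¹.mulVec) h0
    rw [Matrix.mulVec_mulVec, Matrix.nonsing_inv_mul A hdet, Matrix.one_mulVec,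
      Matrix.mulVec_zero] at this
    simpa using congrFun this 2
  · rw [Matrix.dotProduct_mulVec, Matrix.vecMul_vecMul, Matrix.nonsing_inv_mul A hdet,
      Matrix.vecMul_one]
    fin_cases i <;> simp [standardLine]
  · rw [LinearIndependent.pair_iff]
    intro s t hst
    rw [← Matrix.smul_vecMul, ← Matrix.smul_vecMul, ← Matrix.add_vecMul] at hst
    have := congrArg (fun x => Matrix.vecMul x A) hst
    simp only [Matrix.vecMul_vecMul, Matrix.nonsing_inv_mul A hdet, Matrix.vecMul_one,
      Matrix.zero_vecMul] at this
    exact ⟨by simpa [standardLine] using congrFun this 1,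
      by simpa [standardLine] using congrFun this 0⟩
  · change Matrix.vecMul (standardLine 2) A⁻¹ = -1 • Matrix.vecMul (standardLine 0) A⁻¹ +
      (1 : ℝ) • Matrix.vecMul (standardLine 1) A⁻¹
    rw [← Matrix.smul_vecMul, ← Matrix.smul_vecMul, ← Matrix.add_vecMul]
    congr 1
    funext j
    fin_cases j <;> simp [standardLine]
  · change Matrix.vecMul (standardLine 3) A⁻¹ = (1 : ℝ) • Matrix.vecMul (standardLine 0) A⁻¹ +
      (1 : ℝ) • Matrix.vecMul (standardLine 1) A⁻¹
    rw [← Matrix.smul_vecMul, ← Matrix.smul_vecMul, ← Matrix.add_vecMul]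
    congr 1
    funext j
    fin_cases j <;> simp [standardLine]

namespace IsParallelCoords
variable {V : Set ℂ} {L₁ L₂ N₁ N₂ : DirField} {S T : ℂ → ℝ}

/-- On a connected open set with straightening coordinates the web has rank three, and its rank
curve is contained in a unique quartic, which consists of four concurrent lines. -/
theorem rank_and_quartic (h : IsParallelCoords V L₁ L₂ N₁ N₂ S T) (hV : IsOpen V)
    (hc : IsPreconnected V) (hne : V.Nonempty) :
    Module.finrank ℝ (abelianRelations ![L₁, L₂, N₁, N₂] V) = 3 ∧
      ∀ b : Module.Basis (Fin 3) ℝ (abelianRelations ![L₁, L₂, N₁, N₂] V),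
        ∃ m : Fin 4 → Fin 3 → ℝ, IsHarmonicQuadruple m ∧
          (∀ i, ∀ q ∈ V, ∀ w : ℂ, m i ⬝ᵥ arcPoint b i q w = 0) ∧
          ∀ P : MvPolynomial (Fin 3) ℝ, IsRankQuartic b P ↔
            ∃ c : ℝ, c ≠ 0 ∧ P = MvPolynomial.C c * ∏ i, linForm (m i) := by
  obtain ⟨e, he⟩ : ∃ e : (Fin 3 → ℝ) ≃ₗ[ℝ] abelianRelations ![L₁, L₂, N₁, N₂] V,
      ∀ a, (e a : Fin 4 → ℂ → (ℂ →L[ℝ] ℝ)) = relation V S T a :=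
    ⟨h.relationEquiv hV hc hne, fun _ => rfl⟩
  refine ⟨by rw [← e.finrank_eq]; simp, fun b => ?_⟩
  set A : Matrix (Fin 3) (Fin 3) ℝ := Matrix.of fun α k => e.symm (b α) k
  have hA : IsUnit A := by
    rw [← Matrix.linearIndependent_rows_iff_isUnit]
    have h1 : A.row = b.map e.symm := funext fun α => (b.map_apply e.symm α).symm
    rw [h1]
    exact (b.map e.symm).linearIndependent
  have hdet : IsUnit A.det := (Matrix.isUnit_iff_isUnit_det A).1 hA
  have harc : ∀ i, ∀ q ∈ V, ∀ w, arcPoint b i q w = fderiv ℝ (integrals S T i) q w •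
      A.mulVec (relationCoeff i (integrals S T i q)) := by
    intro i q hq w
    funext α
    have h1 : (b α : Fin 4 → ℂ → (ℂ →L[ℝ] ℝ)) = relation V S T (A α) := by
      rw [← he]
      exact congrArg Subtype.val (e.apply_symm_apply (b α)).symm
    change (b α : Fin 4 → ℂ → (ℂ →L[ℝ] ℝ)) i q w = _
    rw [h1, relation_of_mem hq, smul_apply, smul_eq_mul, mul_comm]
    rfl
  set m : Fin 4 → Fin 3 → ℝ := fun i => Matrix.vecMul (standardLine i) A⁻¹
  have hmA : ∀ i x, m i ⬝ᵥ A.mulVec x = standardLine i ⬝ᵥ x := fun i x => by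
    rw [Matrix.dotProduct_mulVec, Matrix.vecMul_vecMul, Matrix.nonsing_inv_mul A hdet,
      Matrix.vecMul_one]
  have hline : ∀ i, ∀ q ∈ V, ∀ w : ℂ, m i ⬝ᵥ arcPoint b i q w = 0 := by
    intro i q hq w
    rw [harc i q hq, dotProduct_smul, hmA, standardLine_dotProduct_relationCoeff, smul_zero]
  refine ⟨m, isHarmonicQuadruple_vecMul_standardLine hA, hline, fun P => ⟨?_, ?_⟩⟩
  · rintro ⟨hP0, hP, hvan⟩
    refine eq_C_mul_prod_linForm (fun i j hij => ⟨A.mulVec (relationCoeff i 0), ?_, ?_⟩) hP0 hP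
      fun i x hx => ?_
    · rw [hmA, standardLine_dotProduct_relationCoeff]
    · rw [hmA]
      exact standardLine_dotProduct_ne_zero hij
    · have hx' : x = A.mulVec (A⁻¹.mulVec x) := by
        rw [Matrix.mulVec_mulVec, Matrix.mul_nonsing_inv A hdet, Matrix.one_mulVec]
      rw [hx', hmA] at hx
      obtain ⟨a, t, hat⟩ := exists_eq_of_standardLine_dotProduct hx
      rw [hx', hat, Matrix.mulVec_add, Matrix.mulVec_smul, Matrix.mulVec_smul]
      have hγ : (![2, 2, -4, -4] : Fin 4 → ℝ) i ≠ 0 := by fin_cases i <;> simp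
      refine eval_eq_zero_of_infinite hP
        ((h.infinite_image hV hc hne i).image (mul_right_injective₀ hγ).injOn) ?_ a t
      rintro _ ⟨_, ⟨q, hq, rfl⟩, rfl⟩
      obtain ⟨w, hw⟩ := h.fderiv_integrals_ne_zero hV hq i
      have := hvan i q hq w
      rw [harc i q hq, hw, one_smul, relationCoeff_eq, Matrix.mulVec_add,
        Matrix.mulVec_smul] at this
      exact this
  · rintro ⟨c, hc0, rfl⟩
    have hm0 : ∀ i, m i ≠ 0 := fun i h0 => by
      obtain ⟨j, hj⟩ := exists_ne i
      have h1 := hmA i (relationCoeff j 0)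
      rw [h0, zero_dotProduct] at h1
      exact standardLine_dotProduct_ne_zero hj h1.symm
    refine ⟨mul_ne_zero (MvPolynomial.C_ne_zero.2 hc0)
      (Finset.prod_ne_zero_iff.2 fun i _ => linForm_ne_zero (hm0 i)), ?_, fun i q hq w => ?_⟩
    · have h1 := MvPolynomial.IsHomogeneous.prod Finset.univ (fun i => linForm (m i)) (fun _ => 1)
        fun i _ => isHomogeneous_linForm (m i)
      simpa using (MvPolynomial.isHomogeneous_C (Fin 3) c).mul h1
    · rw [map_mul, map_prod]
      rw [Finset.prod_eq_zero (Finset.mem_univ i) (by rw [eval_linForm, hline i q hq w]), mul_zero]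

end IsParallelCoords

/-! ### Trajectories of the bisector net -/

/-- On `U`, the foliation `F` is the horizontal or the vertical foliation of `dz² / P`. -/
def IsTrajectory (U : Set ℂ) (F : DirField) (P : ℂ → ℂ) : Prop :=
  (∀ q ∈ U, ∀ u ∈ F q, ∃ r : ℝ, 0 ≤ r ∧ u ^ 2 = r * P q) ∨
    ∀ q ∈ U, ∀ u ∈ F q, ∃ r : ℝ, r ≤ 0 ∧ u ^ 2 = r * P q

theorem IsTrajectory.of_eq_smul {U : Set ℂ} {F : DirField} {P Φ : ℂ → ℂ} (h : IsTrajectory U F P)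
    (c : ℝ) (hc : ∀ q ∈ U, P q = c * Φ q) : IsTrajectory U F Φ := by
  rcases le_total 0 c with hc0 | hc0 <;> rcases h with h | h
  · refine Or.inl fun q hq u hu => ?_
    obtain ⟨r, hr, e⟩ := h q hq u hu
    exact ⟨r * c, mul_nonneg hr hc0, by rw [e, hc q hq]; push_cast; ring⟩
  · refine Or.inr fun q hq u hu => ?_
    obtain ⟨r, hr, e⟩ := h q hq u hu
    exact ⟨r * c, mul_nonpos_of_nonpos_of_nonneg hr hc0, by rw [e, hc q hq]; push_cast; ring⟩
  · refine Or.inr fun q hq u hu => ?_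
    obtain ⟨r, hr, e⟩ := h q hq u hu
    exact ⟨r * c, mul_nonpos_of_nonneg_of_nonpos hr hc0, by rw [e, hc q hq]; push_cast; ring⟩
  · refine Or.inl fun q hq u hu => ?_
    obtain ⟨r, hr, e⟩ := h q hq u hu
    exact ⟨r * c, mul_nonneg_of_nonpos_of_nonpos hr hc0, by rw [e, hc q hq]; push_cast; ring⟩

/-- A vector whose square is a positive multiple of `e₁ * e₂` bisects the unit vectors `e₁`, `e₂`. -/
theorem mul_conj_eq_of_sq_eq {u e₁ e₂ : ℂ} (h₁ : ‖e₁‖ = 1) (h₂ : ‖e₂‖ = 1) {r : ℝ} (hr : 0 ≤ r)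
    (h : u ^ 2 = r * (e₁ * e₂)) : u * conj e₁ = conj (u * conj e₂) := by
  rcases eq_or_ne u 0 with rfl | hu
  · simp
  have hn : r = normSq u := by
    have := congrArg norm h
    rw [norm_pow, norm_mul, norm_mul, h₁, h₂, norm_real, Real.norm_of_nonneg hr, Complex.sq_norm]
      at this
    linarith
  apply mul_left_cancel₀ hu
  have e1 := mul_conj_self_of_norm_eq_one h₁
  have e2 := mul_conj u
  rw [map_mul, conj_conj]
  rw [hn] at h
  linear_combination conj e₁ * h + normSq u * e₂ * e1 - e₂ * e2

/-- A vector whose square is a negative multiple of `e₁ * e₂` bisects the unit vectors `e₁`,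
`-e₂`. -/
theorem mul_conj_eq_neg_of_sq_eq {u e₁ e₂ : ℂ} (h₁ : ‖e₁‖ = 1) (h₂ : ‖e₂‖ = 1) {r : ℝ} (hr : r ≤ 0)
    (h : u ^ 2 = r * (e₁ * e₂)) : u * conj e₁ = -conj (u * conj e₂) := by
  have := mul_conj_eq_of_sq_eq (u := u) (e₁ := e₁) (e₂ := -e₂) h₁ (by rwa [norm_neg])
    (neg_nonneg.2 hr) (by rw [h]; push_cast; ring)
  rw [this]
  simp

/-- The unit vector pointing from `f` to `z`. -/
noncomputable def ray (f z : ℂ) : ℂ := (z - f) / ‖z - f‖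

theorem norm_ray {f z : ℂ} (h : z ≠ f) : ‖ray f z‖ = 1 := by
  rw [ray, norm_div, norm_real, norm_norm, div_self (norm_ne_zero_iff.2 (sub_ne_zero.2 h))]

theorem norm_mul_ray {f z : ℂ} (h : z ≠ f) : (‖z - f‖ : ℂ) * ray f z = z - f :=
  mul_div_cancel₀ _ (ofReal_ne_zero.2 (norm_ne_zero_iff.2 (sub_ne_zero.2 h)))

theorem hasDerivAt_dist {γ : ℝ → ℂ} {t : ℝ} {f : ℂ} (hγ : DifferentiableAt ℝ γ t) (h : γ t ≠ f) :
    HasDerivAt (fun s => dist (γ s) f) (deriv γ t * conj (ray f (γ t))).re t := by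
  have hne : γ t - f ≠ 0 := sub_ne_zero.2 h
  have h1 : HasDerivAt (fun s => γ s - f) (deriv γ t) t := hγ.hasDerivAt.sub_const f
  have h2 := h1.norm_sq.sqrt (by simpa using hne)
  simp only [Real.sqrt_sq (norm_nonneg _)] at h2
  simp only [dist_eq_norm]
  refine h2.congr_deriv ?_
  rw [Complex.inner, ray, map_div₀, conj_ofReal, ← mul_div_assoc, div_ofReal_re]
  field_simp

/-- A function with vanishing derivative along a leaf is constant along it. -/
theorem exists_eq_const_of_hasDerivAt {a b : ℝ} {E : Type*} [NormedAddCommGroup E]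
    [NormedSpace ℝ E] {φ : ℝ → E} (h : ∀ t ∈ Set.Ioo a b, HasDerivAt φ 0 t) :
    ∃ k, ∀ t ∈ Set.Ioo a b, φ t = k :=
  isOpen_Ioo.exists_is_const_of_deriv_eq_zero isPreconnected_Ioo
    (fun t ht => (h t ht).differentiableAt.differentiableWithinAt) fun t ht => (h t ht).deriv

theorem differentiableAt_of_contDiffOn_Ioo {a b : ℝ} {γ : ℝ → ℂ}
    (h : ContDiffOn ℝ ∞ γ (Set.Ioo a b)) {t : ℝ} (ht : t ∈ Set.Ioo a b) :
    DifferentiableAt ℝ γ t :=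
  (h.contDiffAt (Ioo_mem_nhds ht.1 ht.2)).differentiableAt (by simp)

/-- One of `dist z f ± dist z g` is constant along a trajectory of `dz² / ((z - f) (z - g))`, since its
tangent bisects the directions to the foci. -/
theorem leavesAreArcsOf_centralConfocal {U : Set ℂ} {F : DirField} {f g : ℂ}
    (hF : IsTrajectory U F fun z => (z - f) * (z - g)) (hf : f ∉ U) (hg : g ∉ U) :
    LeavesAreArcsOf U F (centralConfocal f g) := by
  intro a b γ hab hγ hleaf
  have hne : ∀ t ∈ Set.Ioo a b, γ t ≠ f ∧ γ t ≠ g := fun t ht =>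
    ⟨fun h => hf (h ▸ (hleaf t ht).1), fun h => hg (h ▸ (hleaf t ht).1)⟩
  have hd : ∀ t ∈ Set.Ioo a b, DifferentiableAt ℝ γ t := fun t ht =>
    differentiableAt_of_contDiffOn_Ioo hγ ht
  have hsq : ∀ t ∈ Set.Ioo a b, (γ t - f) * (γ t - g) =
      ((‖γ t - f‖ * ‖γ t - g‖ : ℝ) : ℂ) * (ray f (γ t) * ray g (γ t)) := fun t ht => by
    conv_lhs => rw [← norm_mul_ray (hne t ht).1, ← norm_mul_ray (hne t ht).2]
    push_cast
    ring
  obtain ⟨t₀, ht₀⟩ := Set.nonempty_Ioo.2 hab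
  rcases hF with hF | hF
  · obtain ⟨k, hk⟩ := exists_eq_const_of_hasDerivAt (a := a) (b := b)
      (φ := fun t => dist (γ t) f - dist (γ t) g) fun t ht => by
        have h := (hasDerivAt_dist (hd t ht) (hne t ht).1).sub
          (hasDerivAt_dist (hd t ht) (hne t ht).2)
        obtain ⟨r, hr, e⟩ := hF _ (hleaf t ht).1 _ (hleaf t ht).2.2
        beta_reduce at e
        rw [hsq t ht, ← mul_assoc, ← ofReal_mul] at e
        have := mul_conj_eq_of_sq_eq (norm_ray (hne t ht).1) (norm_ray (hne t ht).2)
          (by positivity) e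
        rwa [this, conj_re, sub_self] at h
    refine ⟨_, Or.inr ⟨|k|, abs_nonneg k, ?_, rfl⟩, fun t ht => congrArg abs (hk t ht)⟩
    rw [← hk t₀ ht₀]
    have := abs_dist_sub_le f g (γ t₀)
    rwa [dist_comm f (γ t₀), dist_comm g (γ t₀)] at this
  · obtain ⟨k, hk⟩ := exists_eq_const_of_hasDerivAt (a := a) (b := b)
      (φ := fun t => dist (γ t) f + dist (γ t) g) fun t ht => by
        have h := (hasDerivAt_dist (hd t ht) (hne t ht).1).add
          (hasDerivAt_dist (hd t ht) (hne t ht).2)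
        obtain ⟨r, hr, e⟩ := hF _ (hleaf t ht).1 _ (hleaf t ht).2.2
        beta_reduce at e
        rw [hsq t ht, ← mul_assoc, ← ofReal_mul] at e
        have := mul_conj_eq_neg_of_sq_eq (norm_ray (hne t ht).1) (norm_ray (hne t ht).2)
          (mul_nonpos_of_nonpos_of_nonneg hr (by positivity)) e
        rwa [this, neg_re, conj_re, neg_add_cancel] at h
    refine ⟨_, Or.inl ⟨k, ?_, rfl⟩, hk⟩
    rw [← hk t₀ ht₀, dist_comm (γ t₀) f]
    exact dist_triangle f (γ t₀) g

theorem hasDerivAt_inner {γ : ℝ → ℂ} {t : ℝ} {f d : ℂ} (hγ : DifferentiableAt ℝ γ t) :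
    HasDerivAt (fun s => inner ℝ (γ s - f) d) (deriv γ t * conj d).re t := by
  have h1 : HasDerivAt (fun s => γ s - f) (deriv γ t) t := hγ.hasDerivAt.sub_const f
  refine (h1.inner ℝ (hasDerivAt_const t d)).congr_deriv ?_
  rw [inner_zero_right, zero_add, Complex.inner, ← conj_re, map_mul, conj_conj, mul_comm]

/-- One of `dist z f ± inner (z - f) d` is constant along a trajectory of `dz² / ((z - f) d)`, since
its tangent bisects the direction to the focus and that of the axis. -/
theorem leavesAreArcsOf_parabolicConfocal {U : Set ℂ} {F : DirField} {f d : ℂ} (hd1 : ‖d‖ = 1)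
    (hF : IsTrajectory U F fun z => (z - f) * d) (hf : f ∉ U) :
    LeavesAreArcsOf U F (parabolicConfocal f d) := by
  intro a b γ hab hγ hleaf
  have hne : ∀ t ∈ Set.Ioo a b, γ t ≠ f := fun t ht h => hf (h ▸ (hleaf t ht).1)
  have hd : ∀ t ∈ Set.Ioo a b, DifferentiableAt ℝ γ t := fun t ht =>
    differentiableAt_of_contDiffOn_Ioo hγ ht
  have hsq : ∀ t ∈ Set.Ioo a b, (γ t - f) * d = (‖γ t - f‖ : ℂ) * (ray f (γ t) * d) :=
    fun t ht => by rw [← mul_assoc, norm_mul_ray (hne t ht)]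
  rcases hF with hF | hF
  · obtain ⟨k, hk⟩ := exists_eq_const_of_hasDerivAt (a := a) (b := b)
      (φ := fun t => dist (γ t) f - inner ℝ (γ t - f) d) fun t ht => by
        have h := (hasDerivAt_dist (hd t ht) (hne t ht)).sub (hasDerivAt_inner (f := f) (d := d)
          (hd t ht))
        obtain ⟨r, hr, e⟩ := hF _ (hleaf t ht).1 _ (hleaf t ht).2.2
        beta_reduce at e
        rw [hsq t ht, ← mul_assoc, ← ofReal_mul] at e
        have := mul_conj_eq_of_sq_eq (norm_ray (hne t ht)) hd1 (by positivity) e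
        rwa [this, conj_re, sub_self] at h
    refine ⟨_, ⟨-k, rfl⟩, fun t ht => ?_⟩
    have := hk t ht
    rw [Set.mem_ofPred_eq, sub_neg_eq_add, ← this, add_sub_cancel, abs_of_nonneg dist_nonneg]
  · obtain ⟨k, hk⟩ := exists_eq_const_of_hasDerivAt (a := a) (b := b)
      (φ := fun t => dist (γ t) f + inner ℝ (γ t - f) d) fun t ht => by
        have h := (hasDerivAt_dist (hd t ht) (hne t ht)).add (hasDerivAt_inner (f := f) (d := d)
          (hd t ht))
        obtain ⟨r, hr, e⟩ := hF _ (hleaf t ht).1 _ (hleaf t ht).2.2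
        beta_reduce at e
        rw [hsq t ht, ← mul_assoc, ← ofReal_mul] at e
        have := mul_conj_eq_neg_of_sq_eq (norm_ray (hne t ht)) hd1
          (mul_nonpos_of_nonpos_of_nonneg hr (by positivity)) e
        rwa [this, neg_re, conj_re, neg_add_cancel] at h
    refine ⟨_, ⟨k, rfl⟩, fun t ht => ?_⟩
    have := hk t ht
    rw [Set.mem_ofPred_eq, ← this, sub_add_cancel_right, abs_neg, abs_of_nonneg dist_nonneg]

theorem leavesAreArcsOf_polarLines {U : Set ℂ} {F : DirField} {f : ℂ}
    (hF : IsTrajectory U F fun z => (z - f) * (z - f)) (hf : f ∉ U) :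
    LeavesAreArcsOf U F (polarLines f) := by
  intro a b γ hab hγ hleaf
  have hne : ∀ t ∈ Set.Ioo a b, γ t ≠ f := fun t ht h => hf (h ▸ (hleaf t ht).1)
  have hd : ∀ t ∈ Set.Ioo a b, DifferentiableAt ℝ γ t := fun t ht =>
    differentiableAt_of_contDiffOn_Ioo hγ ht
  have hsq : ∀ t ∈ Set.Ioo a b, (γ t - f) * (γ t - f) =
      ((‖γ t - f‖ * ‖γ t - f‖ : ℝ) : ℂ) * (ray f (γ t) * ray f (γ t)) := fun t ht => by
    conv_lhs => rw [← norm_mul_ray (hne t ht)]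
    push_cast
    ring
  obtain ⟨t₀, ht₀⟩ := Set.nonempty_Ioo.2 hab
  rcases hF with hF | hF
  · obtain ⟨k, hk⟩ := exists_eq_const_of_hasDerivAt (a := a) (b := b)
      (φ := fun t => ray f (γ t)) fun t ht => by
        have hr := hasDerivAt_dist (hd t ht) (hne t ht)
        obtain ⟨r, hr0, e⟩ := hF _ (hleaf t ht).1 _ (hleaf t ht).2.2
        beta_reduce at e
        rw [hsq t ht, ← mul_assoc, ← ofReal_mul] at e
        have hreal := mul_conj_eq_of_sq_eq (norm_ray (hne t ht)) (norm_ray (hne t ht))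
          (by positivity) e
        simp only [dist_eq_norm] at hr
        have hn0 : ‖γ t - f‖ ≠ 0 := norm_ne_zero_iff.2 (sub_ne_zero.2 (hne t ht))
        have h1 := ((hd t ht).hasDerivAt.sub_const f).div hr.ofReal_comp (ofReal_ne_zero.2 hn0)
        refine h1.congr_deriv ?_
        rw [conj_eq_iff_re.1 hreal.symm, ← norm_mul_ray (hne t ht)]
        have h2 := conj_mul_self_of_norm_eq_one (norm_ray (hne t ht))
        have hn0' : (‖γ t - f‖ : ℂ) ≠ 0 := ofReal_ne_zero.2 hn0
        rw [norm_mul, norm_ray (hne t ht), norm_real, norm_norm, mul_one, div_eq_zero_iff]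
        left
        linear_combination -(deriv γ t * ‖γ t - f‖) * h2
    refine ⟨_, Or.inr ⟨k, ?_, rfl⟩, fun t ht => ⟨‖γ t - f‖, ?_, ?_⟩⟩
    · rw [← hk t₀ ht₀, norm_ray (hne t₀ ht₀)]
    · exact norm_pos_iff.2 (sub_ne_zero.2 (hne t ht))
    · rw [← hk t ht, norm_mul_ray (hne t ht)]; ring
  · obtain ⟨k, hk⟩ := exists_eq_const_of_hasDerivAt (a := a) (b := b)
      (φ := fun t => dist (γ t) f) fun t ht => by
        have h := hasDerivAt_dist (hd t ht) (hne t ht)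
        obtain ⟨r, hr, e⟩ := hF _ (hleaf t ht).1 _ (hleaf t ht).2.2
        beta_reduce at e
        rw [hsq t ht, ← mul_assoc, ← ofReal_mul] at e
        have := mul_conj_eq_neg_of_sq_eq (norm_ray (hne t ht)) (norm_ray (hne t ht))
          (mul_nonpos_of_nonpos_of_nonneg hr (by positivity)) e
        have h0 := congrArg re this
        rw [neg_re, conj_re] at h0
        rwa [show (deriv γ t * conj (ray f (γ t))).re = 0 by linarith] at h
    refine ⟨_, Or.inl ⟨k, ?_, rfl⟩, hk⟩
    rw [← hk t₀ ht₀]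
    exact dist_pos.2 (hne t₀ ht₀)

theorem leavesAreArcsOf_cartesianLines {U : Set ℂ} {F : DirField} {d : ℂ} (hd1 : ‖d‖ = 1)
    (hF : IsTrajectory U F fun _ => d ^ 2) : LeavesAreArcsOf U F (cartesianLines d) := by
  intro a b γ hab hγ hleaf
  have hd : ∀ t ∈ Set.Ioo a b, DifferentiableAt ℝ γ t := fun t ht =>
    differentiableAt_of_contDiffOn_Ioo hγ ht
  have hsq : ∀ u : ℂ, ∀ r : ℝ, u ^ 2 = r * d ^ 2 → (u * conj d) ^ 2 = r := fun u r h => by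
    have := mul_conj_self_of_norm_eq_one hd1
    rw [mul_pow, h, mul_assoc, ← mul_pow, this, one_pow, mul_one]
  rcases hF with hF | hF
  · obtain ⟨k, hk⟩ := exists_eq_const_of_hasDerivAt (a := a) (b := b)
      (φ := fun t => inner ℝ (γ t - 0) (I * d)) fun t ht => by
        refine (hasDerivAt_inner (hd t ht)).congr_deriv ?_
        obtain ⟨r, hr, e⟩ := hF _ (hleaf t ht).1 _ (hleaf t ht).2.2
        have := im_eq_zero_of_sq_eq hr (hsq _ _ e)
        rw [map_mul, conj_I, mul_left_comm, neg_mul, neg_re, I_mul_re, this]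
        simp
    simp only [sub_zero] at hk
    exact ⟨_, ⟨k, Or.inr rfl⟩, hk⟩
  · obtain ⟨k, hk⟩ := exists_eq_const_of_hasDerivAt (a := a) (b := b)
      (φ := fun t => inner ℝ (γ t - 0) d) fun t ht => by
        refine (hasDerivAt_inner (hd t ht)).congr_deriv ?_
        obtain ⟨r, hr, e⟩ := hF _ (hleaf t ht).1 _ (hleaf t ht).2.2
        exact re_eq_zero_of_sq_eq hr (hsq _ _ e)
    simp only [sub_zero] at hk
    exact ⟨_, ⟨k, Or.inl rfl⟩, hk⟩

/-! ### Conics given by their tangents -/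

/-- The adjugate of the symmetric matrix with rows `(a, b, d)`, `(b, c, e)`, `(d, e, f)`: if that
matrix is the equation of a conic in line coordinates, this one is its equation in point
coordinates. -/
def pointConic (a b c d e f : ℝ) : Matrix (Fin 3) (Fin 3) ℝ :=
  !![c * f - e ^ 2, d * e - b * f, b * e - c * d;
    d * e - b * f, a * f - d ^ 2, b * d - a * e;
    b * e - c * d, b * d - a * e, a * c - b ^ 2]

/-- The determinant of the symmetric matrix with rows `(a, b, d)`, `(b, c, e)`, `(d, e, f)`. -/
def dualDet (a b c d e f : ℝ) : ℝ :=
  a * (c * f - e ^ 2) - b * (b * f - d * e) + d * (b * e - c * d)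

/-- The quadratic form of the symmetric matrix with rows `(a, b, d)`, `(b, c, e)`, `(d, e, f)`,
evaluated at the line `(-v₂, v₁, p₁ v₂ - p₂ v₁)` through `p` with direction `v`. -/
def dualForm (a b c d e f : ℝ) (p v : ℂ) : ℝ :=
  a * v.im ^ 2 + c * v.re ^ 2 + f * (p.re * v.im - p.im * v.re) ^ 2 - 2 * b * (v.im * v.re) -
    2 * d * (v.im * (p.re * v.im - p.im * v.re)) + 2 * e * (v.re * (p.re * v.im - p.im * v.re))

section pointConic

variable {a b c d e f : ℝ}

/-- The discriminant of the conic on a line is a multiple of the dual form of the line. -/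
theorem pointConic_discr (p v : ℂ) :
    (hpt p ⬝ᵥ (pointConic a b c d e f).mulVec (hdir v)) ^ 2 -
      (hpt p ⬝ᵥ (pointConic a b c d e f).mulVec (hpt p)) *
        (hdir v ⬝ᵥ (pointConic a b c d e f).mulVec (hdir v)) =
      -(dualDet a b c d e f * dualForm a b c d e f p v) := by
  simp only [pointConic, hpt, hdir, dualDet, dualForm, Matrix.mulVec, dotProduct,
    Fin.sum_univ_three, Matrix.of_apply, Matrix.cons_val]
  ring

theorem isTangentLine_pointConic {p : ℂ} {ℓ : Submodule ℝ ℂ}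
    (h : ∀ v ∈ ℓ, dualForm a b c d e f p v = 0) : IsTangentLine (pointConic a b c d e f) p ℓ := by
  intro v hv
  have := pointConic_discr (a := a) (b := b) (c := c) (d := d) (e := e) (f := f) p v
  rw [h v hv, mul_zero, neg_zero] at this
  exact sub_eq_zero.1 this

theorem pointConic_isSymm : (pointConic a b c d e f).IsSymm := by
  ext i j
  fin_cases i <;> fin_cases j <;> rfl

theorem isSmoothConic_pointConic (hΔ : dualDet a b c d e f ≠ 0) {p v : ℂ} (hv : v ≠ 0)
    (h : dualForm a b c d e f p v = 0) : IsSmoothConic (pointConic a b c d e f) := by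
  refine ⟨pointConic_isSymm, ?_, ?_⟩
  · have : (pointConic a b c d e f).det = dualDet a b c d e f ^ 2 := by
      simp only [pointConic, dualDet, Matrix.det_fin_three, Matrix.of_apply, Matrix.cons_val]
      ring
    rw [this]
    exact pow_ne_zero 2 hΔ
  -- the isotropic vector is the contact point of the tangent line
  set l := p.re * v.im - p.im * v.re with hl
  set x : Fin 3 → ℝ := ![-(a * v.im) + b * v.re + d * l, -(b * v.im) + c * v.re + e * l,
    -(d * v.im) + e * v.re + f * l] with hx
  have e0 : (pointConic a b c d e f).mulVec x 0 = -(dualDet a b c d e f * v.im) := by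
    simp only [pointConic, hx, dualDet, Matrix.mulVec, dotProduct, Fin.sum_univ_three,
      Matrix.of_apply, Matrix.cons_val]
    ring
  have e1 : (pointConic a b c d e f).mulVec x 1 = dualDet a b c d e f * v.re := by
    simp only [pointConic, hx, dualDet, Matrix.mulVec, dotProduct, Fin.sum_univ_three,
      Matrix.of_apply, Matrix.cons_val]
    ring
  have e2 : (pointConic a b c d e f).mulVec x 2 = dualDet a b c d e f * l := by
    simp only [pointConic, hx, dualDet, Matrix.mulVec, dotProduct, Fin.sum_univ_three,
      Matrix.of_apply, Matrix.cons_val]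
    ring
  refine ⟨x, fun h0 => hv ?_, ?_⟩
  · rw [h0, Matrix.mulVec_zero] at e0 e1
    apply Complex.ext
    · simpa [hΔ] using e1.symm
    · simpa [hΔ] using e0.symm
  · rw [dotProduct, Fin.sum_univ_three, e0, e1, e2]
    simp only [hx, Matrix.cons_val]
    rw [dualForm, ← hl] at h
    linear_combination dualDet a b c d e f * h

end pointConic

/-- The quadratic part of the equation of a circle is a multiple of the Euclidean metric. -/
theorem coeff_of_locus_eq_sphere {A : Matrix (Fin 3) (Fin 3) ℝ} (hA : A.IsSymm) {o : ℂ} {r : ℝ}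
    (hr : 0 < r) (h : locus A = Metric.sphere o r) : A 0 0 = A 1 1 ∧ A 0 1 = 0 := by
  have key : ∀ u : ℂ, ‖u‖ = 1 → hpt (o + r * u) ⬝ᵥ A.mulVec (hpt (o + r * u)) = 0 := by
    intro u hu
    have : o + r * u ∈ locus A := by
      rw [h, mem_sphere_iff_norm, add_sub_cancel_left, norm_mul, hu, mul_one, norm_real,
        Real.norm_of_nonneg hr.le]
    exact this
  have n1 : ‖(3 / 5 + 4 / 5 * I : ℂ)‖ = 1 := by
    rw [← sq_eq_sq₀ (norm_nonneg _) zero_le_one, Complex.sq_norm, normSq_apply]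
    simp
    norm_num
  have h1 := key 1 (by simp)
  have h2 := key (-1) (by simp)
  have h3 := key I (by simp)
  have h4 := key (-I) (by simp)
  have h5 := key _ n1
  have h6 := key (-(3 / 5 + 4 / 5 * I)) (by rw [norm_neg, n1])
  have s10 : A 1 0 = A 0 1 := hA.apply 0 1
  simp [hpt, Matrix.mulVec, dotProduct, Fin.sum_univ_three, s10] at h1 h2 h3 h4 h5 h6
  have hr2 : r ^ 2 ≠ 0 := by positivity
  have e1 : A 0 0 = A 1 1 := by
    apply mul_left_cancel₀ hr2
    linear_combination (h1 + h2 - h3 - h4) / 2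
  refine ⟨e1, ?_⟩
  apply mul_left_cancel₀ hr2
  rw [e1] at h1 h2 h5 h6
  linear_combination (25 / 48) * (h5 + h6 - h1 - h2)

/-- The central conic with foci `f`, `g` for which the product of the signed distances of a tangent
from the foci is `B`. -/
noncomputable def centralConic (f g : ℂ) (B : ℝ) : Matrix (Fin 3) (Fin 3) ℝ :=
  pointConic (f.re * g.re - B) ((f.re * g.im + f.im * g.re) / 2) (f.im * g.im - B)
    ((f.re + g.re) / 2) ((f.im + g.im) / 2) 1

/-- The parabola with focus `f` and axis direction `d` (a unit vector) for which the product of the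
signed distance of a tangent from the focus and of the sine of its angle with the axis is `B`, in the
sign convention of `isTangentLine_parabolicConic`. -/
noncomputable def parabolicConic (f d : ℂ) (B : ℝ) : Matrix (Fin 3) (Fin 3) ℝ :=
  pointConic (f.re * d.re + B) ((f.re * d.im + f.im * d.re) / 2) (f.im * d.im + B)
    (d.re / 2) (d.im / 2) 0

theorem isTangentLine_centralConic {f g p : ℂ} {B : ℝ} {ℓ : Submodule ℝ ℂ}
    (h : ∀ v ∈ ℓ, (conj v * (p - f)).im * (conj v * (p - g)).im = B * normSq v) :
    IsTangentLine (centralConic f g B) p ℓ := by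
  refine isTangentLine_pointConic fun v hv => ?_
  have := h v hv
  simp only [mul_im, conj_re, conj_im, sub_re, sub_im, normSq_apply] at this
  rw [dualForm]
  linear_combination this

theorem isTangentLine_parabolicConic {f d p : ℂ} {B : ℝ} {ℓ : Submodule ℝ ℂ}
    (h : ∀ v ∈ ℓ, (conj v * (p - f)).im * (conj v * d).im = B * normSq v) :
    IsTangentLine (parabolicConic f d B) p ℓ := by
  refine isTangentLine_pointConic fun v hv => ?_
  have := h v hv
  simp only [mul_im, conj_re, conj_im, sub_re, sub_im, normSq_apply] at this
  rw [dualForm]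
  linear_combination -this

theorem isSmoothConic_centralConic {f g p v : ℂ} {B : ℝ} (hB : B ≠ 0)
    (hs : 4 * B + normSq (f - g) ≠ 0) (hv : v ≠ 0)
    (h : (conj v * (p - f)).im * (conj v * (p - g)).im = B * normSq v) :
    IsSmoothConic (centralConic f g B) := by
  refine isSmoothConic_pointConic (p := p) (v := v) ?_ hv ?_
  · have : dualDet (f.re * g.re - B) ((f.re * g.im + f.im * g.re) / 2) (f.im * g.im - B)
        ((f.re + g.re) / 2) ((f.im + g.im) / 2) 1 = B * (4 * B + normSq (f - g)) / 4 := by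
      rw [dualDet, normSq_apply, sub_re, sub_im]
      ring
    rw [this]
    exact div_ne_zero (mul_ne_zero hB hs) four_ne_zero
  · simp only [mul_im, conj_re, conj_im, sub_re, sub_im, normSq_apply] at h
    rw [dualForm]
    linear_combination h

theorem isSmoothConic_parabolicConic {f d p v : ℂ} {B : ℝ} (hB : B ≠ 0) (hd : ‖d‖ = 1)
    (hv : v ≠ 0) (h : (conj v * (p - f)).im * (conj v * d).im = B * normSq v) :
    IsSmoothConic (parabolicConic f d B) := by
  refine isSmoothConic_pointConic (p := p) (v := v) ?_ hv ?_
  · have hd' : d.re * d.re + d.im * d.im = 1 := by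
      rw [← normSq_apply, ← Complex.sq_norm, hd, one_pow]
    have : dualDet (f.re * d.re + B) ((f.re * d.im + f.im * d.re) / 2) (f.im * d.im + B)
        (d.re / 2) (d.im / 2) 0 = -B / 4 := by
      rw [dualDet]
      linear_combination (-B / 4) * hd'
    rw [this]
    exact div_ne_zero (neg_ne_zero.2 hB) four_ne_zero
  · simp only [mul_im, conj_re, conj_im, sub_re, sub_im, normSq_apply] at h
    rw [dualForm]
    linear_combination -h

/-- A version of Heron's formula: the equation of a central conic factors into the four focal
equations `± r₁ ± r₂ = s`. -/
theorem centralConic_apply {f g : ℂ} {B s : ℝ} (hs : s ^ 2 = 4 * B + normSq (f - g)) (z : ℂ) :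
    16 * (hpt z ⬝ᵥ (centralConic f g B).mulVec (hpt z)) =
      (s - dist z f - dist z g) * (s + dist z f + dist z g) *
        ((s - dist z f + dist z g) * (s + dist z f - dist z g)) := by
  have h1 : dist z f ^ 2 = (z.re - f.re) ^ 2 + (z.im - f.im) ^ 2 := by
    rw [dist_eq_norm, Complex.sq_norm, normSq_apply, sub_re, sub_im]; ring
  have h2 : dist z g ^ 2 = (z.re - g.re) ^ 2 + (z.im - g.im) ^ 2 := by
    rw [dist_eq_norm, Complex.sq_norm, normSq_apply, sub_re, sub_im]; ring
  have e : ∀ x y : ℝ, (s - x - y) * (s + x + y) * ((s - x + y) * (s + x - y)) =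
      (s ^ 2) ^ 2 - 2 * s ^ 2 * (x ^ 2 + y ^ 2) + (x ^ 2 - y ^ 2) ^ 2 := fun x y => by ring
  rw [e, h1, h2, hs]
  simp only [centralConic, pointConic, hpt, Matrix.mulVec, dotProduct, Fin.sum_univ_three,
    Matrix.of_apply, Matrix.cons_val, normSq_apply, sub_re, sub_im]
  ring

theorem parabolicConic_apply {f d : ℂ} (hd : ‖d‖ = 1) (B : ℝ) (z : ℂ) :
    4 * (hpt z ⬝ᵥ (parabolicConic f d B).mulVec (hpt z)) =
      (inner ℝ (z - f) d - 2 * B) ^ 2 - dist z f ^ 2 := by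
  have h1 : dist z f ^ 2 = (z.re - f.re) ^ 2 + (z.im - f.im) ^ 2 := by
    rw [dist_eq_norm, Complex.sq_norm, normSq_apply, sub_re, sub_im]; ring
  have hd' : d.re * d.re + d.im * d.im = 1 := by
    rw [← normSq_apply, ← Complex.sq_norm, hd, one_pow]
  rw [h1, Complex.inner]
  simp only [parabolicConic, pointConic, hpt, Matrix.mulVec, dotProduct, Fin.sum_univ_three,
    Matrix.of_apply, Matrix.cons_val, mul_re, conj_re, conj_im, sub_re, sub_im]
  linear_combination -((z.re - f.re) ^ 2 + (z.im - f.im) ^ 2) * hd'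

/-- The conic is a hyperbola if `s < dist f g` and an ellipse if `dist f g < s`. -/
theorem locus_centralConic_mem {f g : ℂ} {B s : ℝ} (hB : B ≠ 0) (hs0 : 0 < s)
    (hs : s ^ 2 = 4 * B + normSq (f - g)) : locus (centralConic f g B) ∈ centralConfocal f g := by
  have hl : ∀ z, z ∈ locus (centralConic f g B) ↔
      (s - dist z f - dist z g) * (s + dist z f + dist z g) *
        ((s - dist z f + dist z g) * (s + dist z f - dist z g)) = 0 := fun z => by
    rw [← centralConic_apply hs z, locus, Set.mem_ofPred_eq]
    simp
  have hsd : s ≠ dist f g := by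
    rintro rfl
    rw [dist_eq_norm, Complex.sq_norm] at hs
    exact hB (by linarith)
  rcases hsd.lt_or_gt with h | h
  · refine Or.inr ⟨s, hs0.le, h.le, Set.ext fun z => ?_⟩
    have h1 := dist_triangle_left f g z
    have h2 : s - dist z f - dist z g ≠ 0 := by linarith
    have h3 : s + dist z f + dist z g ≠ 0 := by positivity
    rw [hl, mul_eq_zero_iff_left (mul_ne_zero h2 h3), Set.mem_ofPred_eq, abs_eq hs0.le,
      mul_eq_zero]
    constructor <;> rintro (h | h)
    · left; linarith
    · right; linarith
    · left; linarith
    · right; linarith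
  · refine Or.inl ⟨s, h.le, Set.ext fun z => ?_⟩
    have h1 := abs_le.1 (abs_dist_sub_le f g z)
    rw [dist_comm f z, dist_comm g z] at h1
    have h2 : s - dist z f + dist z g ≠ 0 := by linarith
    have h2' : s + dist z f - dist z g ≠ 0 := by linarith
    have h3 : s + dist z f + dist z g ≠ 0 := by positivity
    rw [hl, mul_eq_zero_iff_right (mul_ne_zero h2 h2'), mul_eq_zero_iff_right h3,
      Set.mem_ofPred_eq]
    constructor <;> intro h <;> linarith

theorem locus_centralConic_self {f : ℂ} {B s : ℝ} (hs0 : 0 < s) (hs : s ^ 2 = 4 * B) :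
    locus (centralConic f f B) = Metric.sphere f (s / 2) := by
  ext z
  have h := centralConic_apply (f := f) (g := f) (B := B) (s := s) (by simpa using hs) z
  have h3 : s + dist z f + dist z f ≠ 0 := by positivity
  rw [show s - dist z f + dist z f = s by ring, show s + dist z f - dist z f = s by ring] at h
  rw [Metric.mem_sphere, locus, Set.mem_ofPred_eq]
  constructor <;> intro h'
  · rw [h', mul_zero, zero_eq_mul, mul_eq_zero, or_iff_left h3,
      or_iff_left (mul_ne_zero hs0.ne' hs0.ne')] at h
    linarith
  · rw [h', show s - s / 2 - s / 2 = 0 by ring, zero_mul, zero_mul] at h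
    linarith

theorem locus_parabolicConic_mem {f d : ℂ} (hd : ‖d‖ = 1) (B : ℝ) :
    locus (parabolicConic f d B) ∈ parabolicConfocal f d := by
  refine ⟨2 * B, Set.ext fun z => ?_⟩
  have h := parabolicConic_apply (f := f) hd B z
  rw [locus, Set.mem_ofPred_eq, Set.mem_ofPred_eq, ← abs_of_nonneg (dist_nonneg (x := z) (y := f)),
    eq_comm (a := |dist z f|), ← sq_eq_sq_iff_abs_eq_abs]
  constructor <;> intro h' <;> linarith

/-- A central conic that is a circle has coinciding foci. -/
theorem eq_of_locus_centralConic_eq_sphere {f g o : ℂ} {B r : ℝ} (hr : 0 < r)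
    (h : locus (centralConic f g B) = Metric.sphere o r) : f = g := by
  obtain ⟨h1, h2⟩ := coeff_of_locus_eq_sphere pointConic_isSymm hr h
  simp only [pointConic, Matrix.of_apply, Matrix.cons_val] at h1 h2
  -- `(f - g) ^ 2 = 0`
  have : (f - g) ^ 2 = 0 := by
    apply Complex.ext
    · simp only [sq, mul_re, sub_re, sub_im, zero_re]
      linear_combination 4 * h1
    · simp only [sq, mul_im, sub_re, sub_im, zero_im]
      linear_combination 8 * h2
  exact sub_eq_zero.1 (pow_eq_zero_iff two_ne_zero |>.1 this)

theorem locus_parabolicConic_ne_sphere {f d o : ℂ} {B r : ℝ} (hd : ‖d‖ = 1) (hr : 0 < r) :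
    locus (parabolicConic f d B) ≠ Metric.sphere o r := by
  intro h
  obtain ⟨h1, h2⟩ := coeff_of_locus_eq_sphere pointConic_isSymm hr h
  simp only [pointConic, Matrix.of_apply, Matrix.cons_val] at h1 h2
  -- `d ^ 2 = 0`
  have : d ^ 2 = 0 := by
    apply Complex.ext
    · simp only [sq, mul_re, zero_re]
      linear_combination 4 * h1
    · simp only [sq, mul_im, zero_im]
      linear_combination 8 * h2
  rw [pow_eq_zero_iff two_ne_zero] at this
  rw [this, norm_zero] at hd
  exact zero_ne_one hd

/-! ### Classification of the nets -/

theorem eq_span_singleton_of_mem {F : Submodule ℝ ℂ} {v x : ℂ} (hF : F = Submodule.span ℝ {v})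
    (hx : x ∈ F) (hx0 : x ≠ 0) : F = Submodule.span ℝ {x} := by
  rw [hF] at hx ⊢
  obtain ⟨r, rfl⟩ := Submodule.mem_span_singleton.1 hx
  have hr : r ≠ 0 := by rintro rfl; simp at hx0
  rw [Submodule.span_singleton_smul_eq (IsUnit.mk0 r hr)]

theorem IsFoliation.isOpen_notMem {U : Set ℂ} (hU : IsOpen U) {F : DirField}
    (hF : IsFoliation U F) {x : ℂ → ℂ} (hx : ContinuousOn x U) :
    IsOpen {q ∈ U | x q ∉ F q} := by
  rw [isOpen_iff_mem_nhds]
  rintro p ⟨hp, hxp⟩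
  obtain ⟨V, hV, hpV, v, hv, hspan⟩ := hF p hp
  have hcont : ContinuousAt (fun q => (conj (v q) * x q).im) p :=
    continuous_im.continuousAt.comp ((continuous_conj.continuousAt.comp
      (hv.continuousOn.continuousAt (hV.mem_nhds hpV))).mul (hx.continuousAt (hU.mem_nhds hp)))
  have hmem : ∀ q ∈ V, (conj (v q) * x q).im ≠ 0 ↔ x q ∉ F q := fun q hq => by
    rw [(hspan q hq).2, not_iff_not]
    constructor
    · intro h
      obtain ⟨r, hr⟩ := exists_real_smul_of_im_eq_zero (hspan q hq).1 h
      exact Submodule.mem_span_singleton.2 ⟨r, hr.symm⟩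
    · intro h
      obtain ⟨r, hr⟩ := Submodule.mem_span_singleton.1 h
      rw [← hr, mul_smul_comm, ← normSq_eq_conj_mul_self, smul_im, ofReal_im, smul_zero]
  filter_upwards [hcont.eventually_ne ((hmem p hpV).2 hxp), hU.mem_nhds hp, hV.mem_nhds hpV]
    with q h1 h2 h3
  exact ⟨h2, (hmem q h3).1 h1⟩

/-- If the two lines of a net at each point have the directions of two continuous vector fields,
then by connectedness each foliation is spanned by one of the two. -/
theorem IsLinearNet.span_dichotomy {U : Set ℂ} (hU : IsOpen U) (hc : IsPreconnected U)
    {L₁ L₂ : DirField} (hL : IsLinearNet U L₁ L₂) {x y : ℂ → ℂ} (hx : ContinuousOn x U)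
    (hy : ContinuousOn y U) (hx0 : ∀ q ∈ U, x q ≠ 0) (hy0 : ∀ q ∈ U, y q ≠ 0)
    (h : ∀ q ∈ U, ∀ u, u ∈ L₁ q ∨ u ∈ L₂ q → (conj u * x q).im * (conj u * y q).im = 0) :
    (∀ q ∈ U, x q ∈ L₁ q ∧ y q ∈ L₂ q) ∨ ∀ q ∈ U, y q ∈ L₁ q ∧ x q ∈ L₂ q := by
  have hor : ∀ F : DirField, IsFoliation U F →
      (∀ q ∈ U, ∀ u ∈ F q, (conj u * x q).im * (conj u * y q).im = 0) →
      ∀ q ∈ U, x q ∈ F q ∨ y q ∈ F q := by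
    intro F hF h q hq
    obtain ⟨V, hV, hqV, v, -, hspan⟩ := hF q hq
    have hvF : v q ∈ F q := by
      rw [(hspan q hqV).2]; exact Submodule.mem_span_singleton_self _
    refine (mul_eq_zero.1 (h q hq _ hvF)).imp (fun h => ?_) fun h => ?_ <;>
    · obtain ⟨r, hr⟩ := exists_real_smul_of_im_eq_zero (hspan q hqV).1 h
      rw [hr]
      exact Submodule.smul_mem _ _ hvF
  have h1 := hor L₁ hL.foliation₁ fun q hq u hu => h q hq u (Or.inl hu)
  have h2 := hor L₂ hL.foliation₂ fun q hq u hu => h q hq u (Or.inr hu)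
  have hne : ∀ z : ℂ → ℂ, (∀ q ∈ U, z q ≠ 0) → ∀ q ∈ U, z q ∈ L₁ q → z q ∉ L₂ q := by
    intro z hz q hq hz1 hz2
    obtain ⟨_, -, hq1, _, -, hs1⟩ := hL.foliation₁ q hq
    obtain ⟨_, -, hq2, _, -, hs2⟩ := hL.foliation₂ q hq
    exact hL.transverse q hq <| (eq_span_singleton_of_mem (hs1 q hq1).2 hz1 (hz q hq)).trans
      (eq_span_singleton_of_mem (hs2 q hq2).2 hz2 (hz q hq)).symm
  have hcover : ∀ q ∈ U, y q ∉ L₁ q ∨ x q ∉ L₁ q := by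
    intro q hq
    by_contra! hcon
    exact (h2 q hq).elim (hne x hx0 q hq hcon.2) (hne y hy0 q hq hcon.1)
  rcases hc.subset_or_subset (hL.foliation₁.isOpen_notMem hU hy)
      (hL.foliation₁.isOpen_notMem hU hx)
      (Set.disjoint_left.2 fun q hqy hqx => (h1 q hqy.1).elim hqx.2 hqy.2)
      (fun q hq => (hcover q hq).imp (fun h => ⟨hq, h⟩) fun h => ⟨hq, h⟩) with hs | hs
  · refine Or.inl fun q hq => ?_
    have hxL := (h1 q hq).resolve_right (hs hq).2
    exact ⟨hxL, (h2 q hq).resolve_left (hne x hx0 q hq hxL)⟩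
  · refine Or.inr fun q hq => ?_
    have hyL := (h1 q hq).resolve_left (hs hq).2
    exact ⟨hyL, (h2 q hq).resolve_right (hne y hy0 q hq hyL)⟩

/-- The product of the signed distances (or sines) that a line of the net has to two fixed points
is constant. -/
theorem IsModelAt.im_mul_im_eq {L₁ L₂ N₁ N₂ : DirField} {P : ℂ → ℂ} {D : ℂ → ℝ} {q : ℂ}
    (h : IsModelAt L₁ L₂ N₁ N₂ P D q) {β B : ℝ} (hβ : β ≠ 0) {x y : ℂ} (hP : P q = β * (x * y))
    (hD : D q = β * ((x * conj y).re - 2 * B)) {u : ℂ} (hu : u ∈ L₁ q ∨ u ∈ L₂ q) :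
    (conj u * x).im * (conj u * y).im = B * normSq u := by
  rcases eq_or_ne u 0 with rfl | hu0
  · simp
  have h1 : (conj u * P q / u).re = D q := hu.elim (fun h' => h.re_left h' hu0) fun h' =>
    h.re_right h' hu0
  have h2 : (conj u ^ 2 * P q).re = D q * normSq u := by
    rw [← h1, ← re_mul_ofReal, ← mul_conj]
    congr 1
    field_simp
  rw [hP, hD] at h2
  have h3 : β * (((conj u * x) * (conj u * y)).re - ((x * conj y).re - 2 * B) * normSq u) = 0 := by
    have : conj u ^ 2 * (β * (x * y)) = β * ((conj u * x) * (conj u * y)) := by ring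
    rw [this, re_ofReal_mul] at h2
    linear_combination h2
  have h4 := (mul_eq_zero.1 h3).resolve_left hβ
  simp only [mul_re, mul_im, conj_re, conj_im, normSq_apply] at h4 ⊢
  linear_combination (-1 / 2) * h4

section Classification

variable {U : Set ℂ} {L₁ L₂ N₁ N₂ : DirField} {P : ℂ → ℂ} {D : ℂ → ℝ}

theorem isTrajectory_of_isModelAt (hmod : ∀ q ∈ U, IsModelAt L₁ L₂ N₁ N₂ P D q) :
    IsTrajectory U N₁ P ∧ IsTrajectory U N₂ P :=
  ⟨Or.inl fun q hq _ hu => (hmod q hq).exists_sq_eq_of_mem_N₁ hu,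
    Or.inr fun q hq _ hu => (hmod q hq).exists_sq_eq_of_mem_N₂ hu⟩

theorem IsLinearNet.exists_mem_ne_zero_left (hL : IsLinearNet U L₁ L₂) {p : ℂ} (hp : p ∈ U) :
    ∃ u ∈ L₁ p, u ≠ 0 := by
  obtain ⟨V, -, hpV, v, -, hspan⟩ := hL.foliation₁ p hp
  exact ⟨v p, by rw [(hspan p hpV).2]; exact Submodule.mem_span_singleton_self _, (hspan p hpV).1⟩

/-- If `P` has two finite zeros `f`, `g`, possibly equal, the lines touch a central conic with these
foci (a circle if `f = g`), or belong to the pencils through them. -/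
theorem tangentCase_or_pencilCase_of_central (hU : IsOpen U) (hc : IsConnected U)
    (hL : IsLinearNet U L₁ L₂) (hmod : ∀ q ∈ U, IsModelAt L₁ L₂ N₁ N₂ P D q) {β B : ℝ} {f g : ℂ}
    (hβ : β ≠ 0) (hP : ∀ q, P q = β * ((q - f) * (q - g)))
    (hD : ∀ q, D q = β * (((q - f) * conj (q - g)).re - 2 * B)) :
    TangentCase U L₁ L₂ N₁ N₂ ∨ PencilCase U L₁ L₂ N₁ N₂ := by
  have hf : f ∉ U := fun h => (hmod f h).1 (by rw [hP]; simp)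
  have hg : g ∉ U := fun h => (hmod g h).1 (by rw [hP]; simp)
  have hrel : ∀ q ∈ U, ∀ u, u ∈ L₁ q ∨ u ∈ L₂ q →
      (conj u * (q - f)).im * (conj u * (q - g)).im = B * normSq u := fun q hq u hu =>
    (hmod q hq).im_mul_im_eq hβ (hP q) (hD q) hu
  have htraj := isTrajectory_of_isModelAt hmod
  have ht1 : IsTrajectory U N₁ fun z => (z - f) * (z - g) := htraj.1.of_eq_smul β fun q _ => hP q
  have ht2 : IsTrajectory U N₂ fun z => (z - f) * (z - g) := htraj.2.of_eq_smul β fun q _ => hP q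
  obtain ⟨p, hp⟩ := hc.nonempty
  -- the focal distances of a point of `U` satisfy `(r₁ - r₂) ^ 2 < s ^ 2 = 4 B + |f - g| ^ 2`
  have hs : 0 < 4 * B + normSq (f - g) := by
    have h := (hmod p hp).abs_lt
    rw [hP, hD, abs_mul, norm_mul, norm_real, Real.norm_eq_abs,
      mul_lt_mul_iff_right₀ (abs_pos.2 hβ), norm_mul] at h
    have h1 := (_root_.abs_lt.1 h).1
    have e1 : normSq (f - g) = ‖p - f‖ ^ 2 + ‖p - g‖ ^ 2 - 2 * ((p - f) * conj (p - g)).re := by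
      rw [show f - g = (p - g) - (p - f) by ring, normSq_sub, Complex.sq_norm, Complex.sq_norm,
        ← conj_re, map_mul, conj_conj, mul_comm (conj (p - g))]
      ring
    have h2 := (_root_.abs_lt.1 h).2
    nlinarith [sq_nonneg (‖p - f‖ - ‖p - g‖)]
  rcases eq_or_ne B 0 with rfl | hB
  · have hfg : f ≠ g := by
      rintro rfl
      simp at hs
    right
    left
    rcases hL.span_dichotomy hU hc.isPreconnected (x := fun q => q - f) (y := fun q => q - g)
      (by fun_prop) (by fun_prop) (fun q hq h => hf (sub_eq_zero.1 h ▸ hq))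
      (fun q hq h => hg (sub_eq_zero.1 h ▸ hq))
      (fun q hq u hu => by rw [hrel q hq u hu, zero_mul]) with h | h
    · refine ⟨f, g, hfg, fun q hq => ?_, fun q hq => ?_, leavesAreArcsOf_centralConfocal ht1 hf hg,
        leavesAreArcsOf_centralConfocal ht2 hf hg⟩
      · rw [← neg_sub]; exact neg_mem (h q hq).1
      · rw [← neg_sub]; exact neg_mem (h q hq).2
    · have hcomm : ∀ q ∈ U, (q - f) * (q - g) = ((1 : ℝ) : ℂ) * ((q - g) * (q - f)) :=
        fun q _ => by push_cast; ring
      refine ⟨g, f, hfg.symm, fun q hq => ?_, fun q hq => ?_,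
        leavesAreArcsOf_centralConfocal (ht1.of_eq_smul 1 hcomm) hg hf,
        leavesAreArcsOf_centralConfocal (ht2.of_eq_smul 1 hcomm) hg hf⟩
      · rw [← neg_sub]; exact neg_mem (h q hq).1
      · rw [← neg_sub]; exact neg_mem (h q hq).2
  left
  obtain ⟨u, hu, hu0⟩ := hL.exists_mem_ne_zero_left hp
  refine ⟨centralConic f g B, isSmoothConic_centralConic hB hs.ne' hu0 (hrel p hp u (Or.inl hu)),
    fun q hq => ⟨isTangentLine_centralConic fun v hv => hrel q hq v (Or.inl hv),
      isTangentLine_centralConic fun v hv => hrel q hq v (Or.inr hv)⟩, ?_, ?_⟩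
  · intro hcirc
    have hfg : f ≠ g := by
      rintro rfl
      have h4 : 0 < 4 * B := by simpa using hs
      have hs' := Real.sqrt_pos.2 h4
      exact hcirc ⟨f, _, half_pos hs', locus_centralConic_self hs' (Real.sq_sqrt h4.le)⟩
    exact ⟨centralConfocal f g, Or.inl ⟨f, g, hfg, rfl⟩,
      locus_centralConic_mem hB (Real.sqrt_pos.2 hs) (Real.sq_sqrt hs.le),
      leavesAreArcsOf_centralConfocal ht1 hf hg, leavesAreArcsOf_centralConfocal ht2 hf hg⟩
  · rintro ⟨o, r, hr, hloc⟩
    obtain rfl := eq_of_locus_centralConic_eq_sphere hr hloc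
    have h4 : 0 < 4 * B := by simpa using hs
    have hs' := Real.sqrt_pos.2 h4
    exact ⟨f, Or.inl ⟨_, half_pos hs', locus_centralConic_self hs' (Real.sq_sqrt h4.le)⟩,
      leavesAreArcsOf_polarLines ht1 hf, leavesAreArcsOf_polarLines ht2 hf⟩

/-- If `P` has one finite zero `f`, the lines touch a parabola with focus `f`, or belong to the pencil
through `f` and a pencil of parallel lines. -/
theorem tangentCase_or_pencilCase_of_parabolic (hU : IsOpen U) (hc : IsConnected U)
    (hL : IsLinearNet U L₁ L₂) (hmod : ∀ q ∈ U, IsModelAt L₁ L₂ N₁ N₂ P D q) {β B : ℝ} {f d : ℂ}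
    (hβ : β ≠ 0) (hd : ‖d‖ = 1) (hP : ∀ q, P q = β * ((q - f) * d))
    (hD : ∀ q, D q = β * (((q - f) * conj d).re - 2 * B)) :
    TangentCase U L₁ L₂ N₁ N₂ ∨ PencilCase U L₁ L₂ N₁ N₂ := by
  have hd0 : d ≠ 0 := by
    rintro rfl
    simp at hd
  have hf : f ∉ U := fun h => (hmod f h).1 (by rw [hP]; simp)
  have hrel : ∀ q ∈ U, ∀ u, u ∈ L₁ q ∨ u ∈ L₂ q →
      (conj u * (q - f)).im * (conj u * d).im = B * normSq u := fun q hq u hu =>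
    (hmod q hq).im_mul_im_eq hβ (hP q) (hD q) hu
  have htraj := isTrajectory_of_isModelAt hmod
  have hl1 := leavesAreArcsOf_parabolicConfocal hd (htraj.1.of_eq_smul β fun q _ => hP q) hf
  have hl2 := leavesAreArcsOf_parabolicConfocal hd (htraj.2.of_eq_smul β fun q _ => hP q) hf
  rcases eq_or_ne B 0 with rfl | hB
  · right
    right
    left
    refine ⟨f, d, hd, ?_, hl1, hl2⟩
    rcases hL.span_dichotomy hU hc.isPreconnected (x := fun q => q - f) (y := fun _ => d)
      (by fun_prop) (by fun_prop) (fun q hq h => hf (sub_eq_zero.1 h ▸ hq)) (fun _ _ => hd0)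
      (fun q hq u hu => by rw [hrel q hq u hu, zero_mul]) with h | h
    · refine Or.inl ⟨fun q hq => ?_, fun q hq => (h q hq).2⟩
      rw [← neg_sub]; exact neg_mem (h q hq).1
    · refine Or.inr ⟨fun q hq => (h q hq).1, fun q hq => ?_⟩
      rw [← neg_sub]; exact neg_mem (h q hq).2
  left
  obtain ⟨p, hp⟩ := hc.nonempty
  obtain ⟨u, hu, hu0⟩ := hL.exists_mem_ne_zero_left hp
  refine ⟨parabolicConic f d B, isSmoothConic_parabolicConic hB hd hu0 (hrel p hp u (Or.inl hu)),
    fun q hq => ⟨isTangentLine_parabolicConic fun v hv => hrel q hq v (Or.inl hv),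
      isTangentLine_parabolicConic fun v hv => hrel q hq v (Or.inr hv)⟩, fun _ => ?_, ?_⟩
  · exact ⟨parabolicConfocal f d, Or.inr ⟨f, d, hd, rfl⟩, locus_parabolicConic_mem hd B, hl1, hl2⟩
  · rintro ⟨o, r, hr, hloc⟩
    exact absurd hloc (locus_parabolicConic_ne_sphere hd hr)

/-- If `P` has no zeros, the lines belong to two pencils of parallel lines. -/
theorem pencilCase_of_const (hU : IsOpen U) (hc : IsConnected U)
    (hL : IsLinearNet U L₁ L₂) (hmod : ∀ q ∈ U, IsModelAt L₁ L₂ N₁ N₂ P D q) {a : ℂ} {k : ℝ}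
    (hP : ∀ q, P q = a) (hD : ∀ q, D q = k) : PencilCase U L₁ L₂ N₁ N₂ := by
  obtain ⟨p, hp⟩ := hc.nonempty
  obtain ⟨hP0, v, w, hvw, hPp, hDp⟩ := hmod p hp
  rw [hP] at hP0 hPp hDp
  rw [hD] at hDp
  have hβ : ‖a‖ ≠ 0 := norm_ne_zero_iff.2 hP0
  have hrel : ∀ q ∈ U, ∀ u, u ∈ L₁ q ∨ u ∈ L₂ q →
      (conj u * v).im * (conj u * w).im = 0 := fun q hq u hu => by
    have := (hmod q hq).im_mul_im_eq (B := 0) hβ (x := v) (y := w) (by rw [hP, ← hPp])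
      (by rw [hD, hDp, ← conj_re (v * conj w), map_mul, conj_conj, mul_zero, sub_zero]) hu
    rw [this, zero_mul]
  obtain ⟨d, hd⟩ := IsAlgClosed.exists_pow_nat_eq (v * w) two_pos
  have hd1 : ‖d‖ = 1 := by
    have := congrArg norm hd
    rw [norm_pow, norm_mul, hvw.norm_left, hvw.norm_right, mul_one] at this
    exact (pow_eq_one_iff_of_nonneg (norm_nonneg d) two_ne_zero).1 this
  have htraj := isTrajectory_of_isModelAt hmod
  have hPd : ∀ q ∈ U, P q = (‖a‖ : ℂ) * d ^ 2 := fun q _ => by rw [hP, hd, ← hPp]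
  have hl1 := leavesAreArcsOf_cartesianLines hd1 (htraj.1.of_eq_smul ‖a‖ hPd)
  have hl2 := leavesAreArcsOf_cartesianLines hd1 (htraj.2.of_eq_smul ‖a‖ hPd)
  right
  right
  rcases hL.span_dichotomy hU hc.isPreconnected (x := fun _ => v) (y := fun _ => w)
    (by fun_prop) (by fun_prop) (fun _ _ => hvw.left_ne_zero) (fun _ _ => hvw.right_ne_zero)
    hrel with h | h
  · exact ⟨v, w, d, hvw.norm_left, hvw.norm_right, hd1, fun q hq => (h q hq).1,
      fun q hq => (h q hq).2, hl1, hl2⟩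
  · exact ⟨w, v, d, hvw.norm_right, hvw.norm_left, hd1, fun q hq => (h q hq).1,
      fun q hq => (h q hq).2, hl1, hl2⟩

theorem tangentCase_or_pencilCase (hU : IsOpen U) (hconn : IsConnected U)
    (hL : IsLinearNet U L₁ L₂) {c : ℝ} {b a : ℂ} {k : ℝ}
    (hmod : ∀ q ∈ U, IsModelAt L₁ L₂ N₁ N₂ (quadPoly c b a) (quadPot c b k) q) :
    TangentCase U L₁ L₂ N₁ N₂ ∨ PencilCase U L₁ L₂ N₁ N₂ := by
  rcases eq_or_ne c 0 with rfl | hc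
  · rcases eq_or_ne b 0 with rfl | hb
    · exact Or.inr (pencilCase_of_const hU hconn hL hmod (a := a) (k := k)
        (fun q => by simp [quadPoly]) fun q => by simp [quadPot])
    · have hbn : ‖b‖ ≠ 0 := norm_ne_zero_iff.2 hb
      have hbn' : (‖b‖ : ℂ) ≠ 0 := ofReal_ne_zero.2 hbn
      have hbd : (‖b‖ : ℂ) * (b / ‖b‖) = b := mul_div_cancel₀ _ hbn'
      refine tangentCase_or_pencilCase_of_parabolic hU hconn hL hmod (β := ‖b‖) (f := -a / b)
        (d := b / ‖b‖) (B := -(k / ‖b‖ + (-a / b * conj (b / ‖b‖)).re) / 2) hbn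
        (by rw [norm_div, norm_real, norm_norm, div_self hbn]) (fun q => ?_) fun q => ?_
      · rw [quadPoly, mul_left_comm, hbd]
        field_simp
        push_cast
        ring
      · have e1 : (conj b * q).re = ‖b‖ * (q * conj (b / ‖b‖)).re := by
          rw [← re_ofReal_mul, mul_left_comm, ← conj_ofReal ‖b‖, ← map_mul, conj_ofReal, hbd,
            mul_comm]
        rw [quadPot, e1, sub_mul, sub_re]
        field_simp
        ring
  · have hc' : (c : ℂ) ≠ 0 := ofReal_ne_zero.2 hc
    obtain ⟨s, hs⟩ := IsAlgClosed.exists_pow_nat_eq (b ^ 2 - 4 * c * a) two_pos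
    set f : ℂ := (-b + s) / (2 * c) with hf
    set g : ℂ := (-b - s) / (2 * c) with hg
    have hsum : b = -(c * (f + g)) := by rw [hf, hg]; field_simp; ring
    have hprod : a = c * (f * g) := by
      rw [hf, hg]; field_simp
      linear_combination hs
    refine tangentCase_or_pencilCase_of_central hU hconn hL hmod (β := c) (f := f) (g := g)
      (B := ((f * conj g).re - k / c) / 2) hc (fun q => ?_) fun q => ?_
    · rw [quadPoly, hprod, hsum]
      ring
    · rw [quadPot, hsum]
      simp only [map_neg, map_mul, map_add, map_sub, conj_ofReal, neg_re, neg_mul, mul_re, mul_im,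
        add_re, add_im, sub_re, sub_im, ofReal_re, ofReal_im, conj_re, conj_im, normSq_apply]
      field_simp
      ring

end Classification

/-! ### Consequences of the quadratic model -/

section Model

variable {U : Set ℂ} {L₁ L₂ N₁ N₂ : DirField}

theorem exists_quad_model (hU : IsOpen U) (hconn : IsConnected U) (hL : IsLinearNet U L₁ L₂)
    (hN : IsBisectorNet U L₁ L₂ N₁ N₂)
    (h : ∀ p ∈ U, ∃ P : ℂ → ℂ, ∀ᶠ q in 𝓝 p, DifferentiableAt ℂ P q ∧ IsHorizontal P N₁ q) :
    ∃ (c : ℝ) (b a : ℂ) (k : ℝ), ∀ q ∈ U,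
      IsModelAt L₁ L₂ N₁ N₂ (quadPoly c b a) (quadPot c b k) q :=
  exists_global_quad_model hconn fun p hp => by
    obtain ⟨P, hP⟩ := h p hp
    exact exists_quad_modelAt hU hL hN hp hP

variable {c : ℝ} {b a : ℂ} {k : ℝ}

theorem differentiable_quadPoly : Differentiable ℂ (quadPoly c b a) :=
  fun z => (hasDerivAt_quadPoly c b a z).differentiableAt

theorem contDiff_quadPot : ContDiff ℝ ∞ (quadPot c b k) := by
  have h1 : ContDiff ℝ ∞ fun z : ℂ => z.re := reCLM.contDiff
  have h2 : ContDiff ℝ ∞ fun z : ℂ => z.im := imCLM.contDiff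
  have : quadPot c b k =
      fun z => c * (z.re * z.re + z.im * z.im) + (b.re * z.re + b.im * z.im) + k := by
    funext z
    simp [quadPot, normSq_apply]
  rw [this]
  fun_prop

theorem exists_parallelCoords_of_quad_model
    (hL : IsLinearNet U L₁ L₂)
    (hmod : ∀ q ∈ U, IsModelAt L₁ L₂ N₁ N₂ (quadPoly c b a) (quadPot c b k) q)
    {V : Set ℂ} (hVU : V ⊆ U) (hV : IsOpen V) (hc : Convex ℝ V) :
    ∃ S T : ℂ → ℝ, IsParallelCoords V L₁ L₂ N₁ N₂ S T :=
  exists_parallelCoords hL hVU hV hc differentiable_quadPoly.differentiableOn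
    contDiff_quadPot.contDiffOn
    (fun q _ => by rw [(hasDerivAt_quadPoly c b a q).deriv]; exact hasFDerivAt_quadPot c b k q)
    fun q hq => hmod q (hVU hq)

theorem isHexagonal_of_quad_model (hU : IsOpen U) (hL : IsLinearNet U L₁ L₂)
    (hmod : ∀ q ∈ U, IsModelAt L₁ L₂ N₁ N₂ (quadPoly c b a) (quadPot c b k) q) :
    IsHexagonal U L₁ L₂ N₁ ∧ IsHexagonal U L₁ L₂ N₂ :=
  isHexagonal_of_coords fun p hp => by
    obtain ⟨ε, hε, hball⟩ := Metric.isOpen_iff.1 hU p hp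
    exact ⟨Metric.ball p ε, hball, Metric.isOpen_ball, Metric.mem_ball_self hε,
      exists_parallelCoords_of_quad_model hL hmod hball Metric.isOpen_ball (convex_ball p ε)⟩

end Model

end PlanarWeb

theorem theorem3 (U : Set ℂ) (hU : IsOpen U) (hconn : IsConnected U)
    (L₁ L₂ N₁ N₂ : DirField) (hL : IsLinearNet U L₁ L₂) (hN : IsBisectorNet U L₁ L₂ N₁ N₂) :
    (IsHexagonal U L₁ L₂ N₁ ↔ IsConformallyFlat U N₁ N₂) ∧
    (IsHexagonal U L₁ L₂ N₂ ↔ IsConformallyFlat U N₁ N₂) ∧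
    (IsConformallyFlat U N₁ N₂ →
      (∀ V ⊆ U, IsOpen V → Convex ℝ V → V.Nonempty →
        Module.finrank ℝ (abelianRelations ![L₁, L₂, N₁, N₂] V) = 3 ∧
        ∀ b : Module.Basis (Fin 3) ℝ (abelianRelations ![L₁, L₂, N₁, N₂] V),
          ∃ m : Fin 4 → Fin 3 → ℝ, IsHarmonicQuadruple m ∧
            (∀ i, ∀ q ∈ V, ∀ w : ℂ, m i ⬝ᵥ arcPoint b i q w = 0) ∧
            ∀ P : MvPolynomial (Fin 3) ℝ, IsRankQuartic b P ↔
              ∃ c : ℝ, c ≠ 0 ∧ P = MvPolynomial.C c * ∏ i, linForm (m i)) ∧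
      (TangentCase U L₁ L₂ N₁ N₂ ∨ PencilCase U L₁ L₂ N₁ N₂)) := by
  have hflat := fun h : IsConformallyFlat U N₁ N₂ =>
    exists_quad_model hU hconn hL hN fun p hp => h.exists_isHorizontal hp
  have hhex₁ := fun h : IsHexagonal U L₁ L₂ N₁ =>
    exists_quad_model hU hconn hL hN fun p hp =>
      h.exists_isHorizontal hU hL hN (σ := 1) (by norm_num)
        (fun q v w hf => by rw [hf.N₁_eq, one_smul]) hp
  have hhex₂ := fun h : IsHexagonal U L₁ L₂ N₂ =>
    exists_quad_model hU hconn hL hN fun p hp =>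
      h.exists_isHorizontal hU hL hN (σ := -1) (by norm_num)
        (fun q v w hf => by rw [hf.N₂_eq, neg_one_smul, sub_eq_add_neg]) hp
  refine ⟨⟨fun h => ?_, fun h => ?_⟩, ⟨fun h => ?_, fun h => ?_⟩, fun h =>
    ⟨fun V hVU hV hVc hVne => ?_, ?_⟩⟩
  · obtain ⟨c, b, a, k, hmod⟩ := hhex₁ h
    exact isConformallyFlat_of_model hU differentiable_quadPoly.differentiableOn hmod
  · obtain ⟨c, b, a, k, hmod⟩ := hflat h
    exact (isHexagonal_of_quad_model hU hL hmod).1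
  · obtain ⟨c, b, a, k, hmod⟩ := hhex₂ h
    exact isConformallyFlat_of_model hU differentiable_quadPoly.differentiableOn hmod
  · obtain ⟨c, b, a, k, hmod⟩ := hflat h
    exact (isHexagonal_of_quad_model hU hL hmod).2
  · obtain ⟨c, b, a, k, hmod⟩ := hflat h
    obtain ⟨S, T, hST⟩ := exists_parallelCoords_of_quad_model hL hmod hVU hV hVc
    exact hST.rank_and_quartic hV hVc.isPreconnected hVne
  · obtain ⟨c, b, a, k, hmod⟩ := hflat h
    exact tangentCase_or_pencilCase hU hconn hL hmod
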